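/- **Setting (transductive online model).** Let $T\ge 1$ and let $v_1,\dots,v_T$ be instances in a set $\mathcal X$, which are known to the forecaster in advance (repetitions are allowed). An arbitrary permutation $\pi$ of $\{1,\dots,T\}$ and arbitrary outcomes $y_1,\dots,y_T$ are fixed in advance but unknown to the forecaster. At round $t$ the position $\pi_t$ is revealed, i.e. the instance is $x_t=v_{\pi_t}$; the forecaster outputs a (random) prediction $p_t$; then $y_t$ is revealed and the loss $\ell(p_t,y_t)$ is incurred. For a nonempty class $\mathcal F$ of functions on $\mathcal X$ the regret is $\sum_{t=1}^T\ell(p_t,y_t)-\inf_{f\in\mathcal F}\sum_{t=1}^T\ell(f(x_t),y_t)$. The Rademacher complexity is $\mathcal R_T(\mathcal F)=\mathbb E\big[\sup_{f\in\mathcal F}\sum_{i=1}^T\sigma_i f(v_i)\big]$ with i.i.d. uniform signs $\sigma_i$. **Playout.** Let $G\subseteq[-1,1]^T$ be nonempty and $L^*(w)=\inf_{g\in G}\sum_{i=1}^T|g_i-w_i|$ for $w\in\{-1,1\}^T$. Suppose that the positions visited before the current position $i$ carry signs, and let $Y\in\{-1,1\}^T$. Let $w^{\pm}$ be the sign vector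 that has these signs at the visited positions, $\pm1$ at position $i$, and the signs $Y_j$ at all other positions $j$. Put $\Delta(i,Y)=\tfrac12\big(L^*(w^-)-L^*(w^+)\big)\in[-1,1]$. **Forecaster MF\*** (classes of $\{0,1\}$-valued functions, zero-one loss). Take $G=\{(2f(v_i)-1)_{i}:f\in\mathcal F\}$; a visited position $\pi_s$ carries the sign $2y_s-1$. At round $t$, with $Y$ uniform on $\{-1,1\}^T$ (either drawn afresh in each round, or drawn once before the first round and reused), predict the label $1$ with probability $(1+\Delta(\pi_t,Y))/2$ and the label $0$ otherwise. **$R^2$ Forecaster** (classes of $[-b,b]$-valued functions, $b>0$; losses $\ell(p,y)$ with $p,y\in[-b,b]$ that are convex and $\rho$-Lipschitz in $p$, $\rho>0$; for each $p,y\in[-b,b]$ any fixed subgradient $g(p,y)$ at $p$ of $\ell(\cdot,y)$ on $[-b,b]$ with $|g(p,y)|\le\rho$; a constant $\eta>0$). Take $G=\{(f(v_i)/b)_i:f\in\mathcal F\}$ and $m=\lceil\eta T\rceil$. At round $t$ draw independent uniform $Y^{(1)},\dots,Y^{(m)}\in\{-1,1\}^T$, predict $p_t=\frac bm\sum_{j=1}^m\Delta(\pi_t,Y^{(j)})$,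 receive $y_t\in[-b,b]$, and let the position $\pi_t$ carry from now on the sign $z_t$, where $z_t=1$ with probability $\frac12\big(1-\frac1\rho g(p_t,y_t)\big)$ and $z_t=-1$ otherwise. **Machine model.** Randomized programs on a real RAM with unit-cost exact real arithmetic, unit-cost coins of given bias, bounded loops, and calls of subroutines whose running times are charged. Programs are fixed, independently of $T$, of the class, of the instances and of the loss. An empirical risk minimizer (ERM) with time $c$ is a subroutine that on each label vector returns the least empirical risk over the class on $v_1,\dots,v_T$ and takes at most $c$ steps. **Theorem.** 1. There is an absolute constant $C$ such that for every class $\mathcal F$ of $\{0,1\}$-valued functions of finite VC dimension $d$, every $T\ge1$, all $v$, $\pi$ and all $y\in\{0,1\}^T$, the expected regret of MF\* (with fresh or with reused signs) with respect to the zero-one loss is at most $C\sqrt{dT}$. Moreover MF\* is efficient if ERM is: there are programs and a constant $K$ such that for every nonempty class of $\{0,1\}$-valued functions and every ERM with respect to the zero-one loss (labels in $\{0,1\}$) with time $c$, the predictions of the program have exactly the distribution of those of MF\*, and its total running time over all $T$ rounds is always at most $K\,T(c+T)$. 2. For every $\eta>0$ there is a constant $C$, depending only on $\eta$, such that for all $b,\rho>0$,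 every $\ell$ and $g$ as above, every nonempty class $\mathcal F$ of $[-b,b]$-valued functions, every $T\ge1$, all $v$, $\pi$, all $y\in[-b,b]^T$ and all $\delta\in(0,1)$, with probability at least $1-\delta$ the regret of the $R^2$ Forecaster is at most $\rho\,\mathcal R_T(\mathcal F)+C\rho b\sqrt{T\ln(T/\delta)}$. Moreover the $R^2$ Forecaster is efficient if ERM is: there are a program and, for every $\eta>0$, a constant $K$ such that for every ERM with time $c$ (for the absolute loss over the scaled class $\mathcal F/b$ with labels in $\{-1,1\}$) and every subroutine evaluating $g$ on $[-b,b]^2$ in time at most $c'$, the predictions of the program have exactly the distribution of those of the $R^2$ Forecaster, and its total running time is always at most $K\,(T^2(c+T)+T c')$. -/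

import Mathlib

universe u

noncomputable section

namespace Transductive

/-! ## Randomness -/

/-- The biased coin: `true` with probability `r`, where `r` is first clipped to `[0, 1]`. -/
def coin (r : ℝ) : PMF Bool :=
  PMF.ofFintype
    (fun c => if c then ENNReal.ofReal (max 0 (min 1 r))
      else ENNReal.ofReal (1 - max 0 (min 1 r)))
    (by
      have h0 : (0 : ℝ) ≤ max 0 (min 1 r) := le_max_left _ _
      have h1 : max 0 (min 1 r) ≤ (1 : ℝ) := max_le zero_le_one (min_le_left _ _)
      rw [Fintype.sum_bool]
      simp only [if_true, Bool.false_eq_true, if_false]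
      rw [← ENNReal.ofReal_add h0 (by linarith)]
      simp)

/-- `true` stands for `+1` and `false` for `-1`. -/
def sgn (c : Bool) : ℝ := if c then 1 else -1

/-- `true` stands for `1` and `false` for `0`. -/
def bit (c : Bool) : ℝ := if c then 1 else 0

/-- `T` independent Rademacher variables. -/
def signs (T : ℕ) : PMF (Fin T → Bool) := PMF.uniformOfFintype (Fin T → Bool)

/-- Rademacher complexity (not divided by `T`) of a set of vectors:
the expectation of `sup_{f ∈ G} ∑ i, σ i * f i` over uniformly random signs `σ`. -/
def rademacher {T : ℕ} (G : Set (Fin T → ℝ)) : ℝ :=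
  (∑ σ : Fin T → Bool, ⨆ f : G, ∑ i, sgn (σ i) * f.1 i) / 2 ^ T

/-! ## Function classes and losses -/

/-- The finite set `S` is shattered by the class `F`. -/
def Shatters {X : Type u} (F : Set (X → Bool)) (S : Finset X) : Prop :=
  ∀ g : X → Bool, ∃ f ∈ F, ∀ x ∈ S, f x = g x

/-- `F` has VC dimension exactly `d`. -/
def HasVCDim {X : Type u} (F : Set (X → Bool)) (d : ℕ) : Prop :=
  (∃ S : Finset X, S.card = d ∧ Shatters F S) ∧ ∀ S : Finset X, Shatters F S → S.card ≤ d

/-- The zero-one loss. -/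
def zeroOne (p y : Bool) : ℝ := if p = y then 0 else 1

/-- Cumulative loss of a list of predictions on a list of outcomes. -/
def cumLoss {P Y : Type} (l : P → Y → ℝ) (ps : List P) (ys : List Y) : ℝ :=
  (List.zipWith l ps ys).sum

/-- The regret of a list of predictions in the transductive online model: `x t` and `y t` are the
instance and the outcome of round `t`. -/
def regret {X : Type u} {P : Type} {T : ℕ} (l : P → P → ℝ) (F : Set (X → P))
    (x : Fin T → X) (y : Fin T → P) (ps : List P) : ℝ :=
  cumLoss l ps (List.ofFn y) - ⨅ f : F, ∑ t, l (f.1 (x t)) (y t)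

/-- `g p y` is a subgradient at `p` of the function `l · y` on `[-b, b]`, bounded by `ρ`. -/
def IsSubgradient (l g : ℝ → ℝ → ℝ) (b ρ : ℝ) : Prop :=
  ∀ p ∈ Set.Icc (-b) b, ∀ y ∈ Set.Icc (-b) b,
    |g p y| ≤ ρ ∧ ∀ q ∈ Set.Icc (-b) b, l p y + g p y * (q - p) ≤ l q y

/-! ## The forecasters

The instances `u 0, …, u (T-1)` are known in advance and a class of static experts is a set `G` of
vectors indexed by the *positions* `Fin T`. In each round a position is revealed, the forecaster
predicts, and the outcome is revealed. A *round* is the pair of the position and the outcome. The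
forecaster remembers a partial labelling of the positions (`none` where not yet visited). -/

/-- The least cumulative absolute loss over the class `G` on the outcome vector `v`. -/
def infLoss {T : ℕ} (G : Set (Fin T → ℝ)) (v : Fin T → Bool) : ℝ :=
  ⨅ f : G, ∑ i, |f.1 i - sgn (v i)|

/-- The labels seen so far, completed by the labels `Y`. -/
def fill {T : ℕ} (s : Fin T → Option Bool) (Y : Fin T → Bool) : Fin T → Bool :=
  fun i => (s i).getD (Y i)

/-- The minimax prediction at position `i` with random playout `Y`: half the difference of the
least losses with the label `-1` and with the label `+1` at position `i`. -/
def playout {T : ℕ} (G : Set (Fin T → ℝ)) (s : Fin T → Option Bool) (i : Fin T)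
    (Y : Fin T → Bool) : ℝ :=
  (infLoss G (Function.update (fill s Y) i false)
    - infLoss G (Function.update (fill s Y) i true)) / 2

/-- The forecaster `MF*` with fresh random signs in each round: its prediction `p ∈ [-1, 1]` is
rounded to the label `1` with probability `(1 + p) / 2` and to the label `0` otherwise.
The result is the distribution of the list of predicted labels. -/
def mfFreshFrom {T : ℕ} (G : Set (Fin T → ℝ)) :
    List (Fin T × Bool) → (Fin T → Option Bool) → PMF (List Bool)
  | [], _ => PMF.pure []
  | (i, y) :: rest, s =>
      (signs T).bind fun Y =>
        (coin ((1 + playout G s i Y) / 2)).bind fun c =>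
          (mfFreshFrom G rest (Function.update s i (some y))).map fun cs => c :: cs

/-- The same forecaster when it uses the given signs `Y` in all rounds. -/
def mfWith {T : ℕ} (G : Set (Fin T → ℝ)) (Y : Fin T → Bool) :
    List (Fin T × Bool) → (Fin T → Option Bool) → PMF (List Bool)
  | [], _ => PMF.pure []
  | (i, y) :: rest, s =>
      (coin ((1 + playout G s i Y) / 2)).bind fun c =>
        (mfWith G Y rest (Function.update s i (some y))).map fun cs => c :: cs

/-- `MF*` on a sequence of rounds; `reuse` says whether the random signs are drawn once, before
the first round, or afresh in each round. -/
def mfStar {T : ℕ} (reuse : Bool) (G : Set (Fin T → ℝ)) (rounds : List (Fin T × Bool)) :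
    PMF (List Bool) :=
  if reuse then (signs T).bind fun Y => mfWith G Y rounds fun _ => none
  else mfFreshFrom G rounds fun _ => none

/-- The `R²` Forecaster with `m` playouts per round, on the class `G ⊆ [-1, 1]^T` of experts scaled
by `1 / b`, with the subgradients `g`. The partial labelling holds the rounded values `z`. -/
def r2From {T : ℕ} (m : ℕ) (b ρ : ℝ) (g : ℝ → ℝ → ℝ) (G : Set (Fin T → ℝ)) :
    List (Fin T × ℝ) → (Fin T → Option Bool) → PMF (List ℝ)
  | [], _ => PMF.pure []
  | (i, y) :: rest, s =>
      (PMF.uniformOfFintype (Fin m → Fin T → Bool)).bind fun Y =>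
        (coin ((1 - g (b / m * ∑ j, playout G s i (Y j)) y / ρ) / 2)).bind fun z =>
          (r2From m b ρ g G rest (Function.update s i (some z))).map fun ps =>
            (b / m * ∑ j, playout G s i (Y j)) :: ps

/-- The `R²` Forecaster on a sequence of rounds. -/
def r2 {T : ℕ} (m : ℕ) (b ρ : ℝ) (g : ℝ → ℝ → ℝ) (G : Set (Fin T → ℝ))
    (rounds : List (Fin T × ℝ)) : PMF (List ℝ) :=
  r2From m b ρ g G rounds fun _ => none

/-- The experts of a `{0,1}`-valued class on the instances `v`, as vectors in `{-1, 1}^T`. -/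
def signExperts {X : Type u} {T : ℕ} (F : Set (X → Bool)) (v : Fin T → X) :
    Set (Fin T → ℝ) :=
  (fun (f : X → Bool) (i : Fin T) => sgn (f (v i))) '' F

/-- The experts of a real-valued class on the instances `v`, multiplied by `c`. -/
def experts {X : Type u} {T : ℕ} (c : ℝ) (F : Set (X → ℝ)) (v : Fin T → X) :
    Set (Fin T → ℝ) :=
  (fun (f : X → ℝ) (i : Fin T) => c * f (v i)) '' F

/-- The rounds when the positions are visited in the order `π 0, π 1, …`. -/
def roundsOf {Y : Type} {T : ℕ} (π : Equiv.Perm (Fin T)) (y : Fin T → Y) : List (Fin T × Y) :=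
  List.ofFn fun t => (π t, y t)

/-! ## Machine model

Randomized programs over a real RAM: counters, real registers, arrays of reals, unit-cost real
arithmetic, unit-cost coins, bounded loops, and calls of two subroutines, whose running times are
charged. -/

/-- A memory state: counters, real registers, arrays. -/
structure Mem where
  nat : ℕ → ℕ
  real : ℕ → ℝ
  arr : ℕ → ℕ → ℝ

def Mem.setNat (s : Mem) (k v : ℕ) : Mem := { s with nat := Function.update s.nat k v }

def Mem.setReal (s : Mem) (k : ℕ) (v : ℝ) : Mem := { s with real := Function.update s.real k v }

def Mem.setArr (s : Mem) (a i : ℕ) (v : ℝ) : Mem :=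
  { s with arr := Function.update s.arr a (Function.update (s.arr a) i v) }

/-- The four arithmetic operations. -/
inductive ArithOp where
  | add
  | sub
  | mul
  | div

def ArithOp.apply : ArithOp → ℝ → ℝ → ℝ
  | .add, x, y => x + y
  | .sub, x, y => x - y
  | .mul, x, y => x * y
  | .div, x, y => x / y

/-- The subroutines at the disposal of a program with horizon `T`: an empirical risk minimizer,
which maps a vector of labels to a real, and an evaluation of subgradients, each with its
running time. -/
structure Subroutines (T : ℕ) where
  erm : (Fin T → ℝ) → ℝ
  ermTime : (Fin T → ℝ) → ℕ
  grad : ℝ → ℝ → ℝ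
  gradTime : ℝ → ℝ → ℕ

/-- Programs. Numbers name counters, registers and arrays. -/
inductive Cmd where
  /-- do nothing -/
  | skip
  /-- run two programs one after the other -/
  | seq (c d : Cmd)
  /-- counter `i := k` -/
  | natConst (i k : ℕ)
  /-- counter `i :=` counter `j` -/
  | natCopy (i j : ℕ)
  /-- increment counter `i` -/
  | natSucc (i : ℕ)
  /-- register `x := q` -/
  | const (x : ℕ) (q : ℚ)
  /-- register `x :=` counter `i` -/
  | cast (x i : ℕ)
  /-- register `x :=` register `y` op register `z` -/
  | arith (x : ℕ) (op : ArithOp) (y z : ℕ)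
  /-- register `x :=` entry of array `a` at the index in counter `i` -/
  | load (x a i : ℕ)
  /-- entry of array `a` at the index in counter `i :=` register `x` -/
  | store (a i x : ℕ)
  /-- if register `x ≤` register `y` then `c` else `d` -/
  | ifLe (x y : ℕ) (c d : Cmd)
  /-- for counter `i := 0, …, n - 1` do `c`, where `n` is the value of counter `k` on entry -/
  | loop (i k : ℕ) (c : Cmd)
  /-- register `x := 1` with the probability in register `y`, and `x := 0` otherwise -/
  | toss (x y : ℕ)
  /-- register `x :=` value of the empirical risk minimizer on the first `T` entries of array `a` -/
  | erm (x a : ℕ)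
  /-- register `x :=` subgradient at prediction (register `y`) and outcome (register `z`) -/
  | grad (x y z : ℕ)

/-- One step of cost `n` leading to the state `s`. -/
def step (s : Mem) (n : ℕ) : PMF (Mem × ℕ) := PMF.pure (s, n)

/-- Sequential composition; the costs are added. -/
def andThen (p : PMF (Mem × ℕ)) (f : Mem → PMF (Mem × ℕ)) : PMF (Mem × ℕ) :=
  p.bind fun a => (f a.1).map fun c => (c.1, a.2 + c.2)

/-- `n` iterations of `body` with the counter `i` set to `0, …, n - 1`; each iteration has an
overhead of one step. -/
def iterate (body : Mem → PMF (Mem × ℕ)) (i : ℕ) : ℕ → Mem → PMF (Mem × ℕ)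
  | 0, s => step s 0
  | n + 1, s => andThen (iterate body i n s) fun s' => andThen (step (s'.setNat i n) 1) body

/-- Execution of a program: the joint distribution of the final state and of the running time. -/
def exec {T : ℕ} (O : Subroutines T) : Cmd → Mem → PMF (Mem × ℕ)
  | .skip, s => step s 1
  | .seq c d, s => andThen (exec O c s) (exec O d)
  | .natConst i k, s => step (s.setNat i k) 1
  | .natCopy i j, s => step (s.setNat i (s.nat j)) 1
  | .natSucc i, s => step (s.setNat i (s.nat i + 1)) 1
  | .const x q, s => step (s.setReal x (q : ℝ)) 1
  | .cast x i, s => step (s.setReal x (s.nat i : ℝ)) 1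
  | .arith x op y z, s => step (s.setReal x (op.apply (s.real y) (s.real z))) 1
  | .load x a i, s => step (s.setReal x (s.arr a (s.nat i))) 1
  | .store a i x, s => step (s.setArr a (s.nat i) (s.real x)) 1
  | .ifLe x y c d, s =>
      open Classical in
      andThen (step s 1) (if s.real x ≤ s.real y then exec O c else exec O d)
  | .loop i k c, s => andThen (step s 1) (iterate (exec O c) i (s.nat k))
  | .toss x y, s => (coin (s.real y)).bind fun c => step (s.setReal x (bit c)) 1
  | .erm x a, s =>
      step (s.setReal x (O.erm fun i => s.arr a i)) (1 + O.ermTime fun i => s.arr a i)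
  | .grad x y z, s =>
      step (s.setReal x (O.grad (s.real y) (s.real z))) (1 + O.gradTime (s.real y) (s.real z))

/-- An online program: `setup` runs once before the first round; in each round `predict` runs when
counter `2` holds the revealed position and must leave the prediction in register `2`; then
`update` runs when register `3` holds the revealed outcome. -/
structure OnlineProgram where
  setup : Cmd
  predict : Cmd
  update : Cmd

/-- The joint distribution of the predictions and of the total running time from a given state. -/
def OnlineProgram.playFrom {T : ℕ} (A : OnlineProgram) (O : Subroutines T) :
    List (Fin T × ℝ) → Mem → PMF (List ℝ × ℕ)
  | [], _ => PMF.pure ([], 0)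
  | (i, y) :: rest, s =>
      (exec O A.predict (s.setNat 2 i)).bind fun a =>
        (exec O A.update (a.1.setReal 3 y)).bind fun c =>
          (A.playFrom O rest c.1).map fun q => (a.1.real 2 :: q.1, a.2 + c.2 + q.2)

/-- The initial memory: counters `0`, `1` hold `T`, `m`, registers `0`, `1` hold `b`, `ρ`, and
everything else is zero. -/
def inputMem (T m : ℕ) (b ρ : ℝ) : Mem where
  nat := fun k => if k = 0 then T else if k = 1 then m else 0
  real := fun k => if k = 0 then b else if k = 1 then ρ else 0
  arr := fun _ _ => 0

/-- The joint distribution of the predictions and of the total running time of an online program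
with inputs `T`, `m`, `b`, `ρ`. -/
def OnlineProgram.play {T : ℕ} (A : OnlineProgram) (O : Subroutines T) (m : ℕ) (b ρ : ℝ)
    (rounds : List (Fin T × ℝ)) : PMF (List ℝ × ℕ) :=
  (exec O A.setup (inputMem T m b ρ)).bind fun a =>
    (A.playFrom O rounds a.1).map fun q => (q.1, a.2 + q.2)

/-- `O.erm` performs empirical risk minimization with respect to the zero-one loss over `F` on the
instances `v` (labels are `0` and `1`) in time at most `c`. -/
def Subroutines.ZeroOneERM {X : Type u} {T : ℕ} (O : Subroutines T) (F : Set (X → Bool))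
    (v : Fin T → X) (c : ℕ) : Prop :=
  ∀ w : Fin T → Bool,
    O.erm (fun i => bit (w i)) = (⨅ f : F, ∑ i, zeroOne (f.1 (v i)) (w i)) ∧
    O.ermTime (fun i => bit (w i)) ≤ c

/-- `O.erm` performs empirical risk minimization with respect to the absolute loss over the class
`F / b` on the instances `v` (labels are `-1` and `1`) in time at most `c`. -/
def Subroutines.AbsERM {X : Type u} {T : ℕ} (O : Subroutines T) (F : Set (X → ℝ)) (b : ℝ)
    (v : Fin T → X) (c : ℕ) : Prop :=
  ∀ w : Fin T → Bool,
    O.erm (fun i => sgn (w i)) = (⨅ f : F, ∑ i, |f.1 (v i) / b - sgn (w i)|) ∧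
    O.ermTime (fun i => sgn (w i)) ≤ c

end Transductive

end

/-! Both regret bounds rest on `potential G s`, the mean of `infLoss` over uniform completions of
the labels seen so far. Labelling an unvisited position `i` by `c` changes it by `- sgn c *
meanPlayout G s i` (`potential_update`): the two labels average to the old value, and half their
difference is the mean playout. Since `|h - σ| = 1 - σ h` for a sign `σ` and `|h| ≤ 1`, the
potential starts at `T - rademacher G`; it ends at the least loss on the full labelling.

For `MF*`, the probability of a mistake, averaged over the signs, is half of one plus the increment
of the potential. The sum telescopes, and the expected regret is exactly half the Rademacher
complexity (`hasMean_regret_mfStar`), for fresh and for reused signs alike, by linearity of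
expectation and because the outcomes are fixed in advance. The VC bound `rademacher_signExperts_le`
is chaining: random sampling of positions and Sauer–Shelah bound the entropy at relative scale `ε`
by `2 d log (4/ε) + 1/2`, independently of `T`, and Massart's lemma between nets at Hamming scales
`4^(-k) T` gives a geometric series.

For the `R²` Forecaster, the subgradient inequality linearises the loss, and the random sign `z` has
conditional mean `-g/ρ`, so the linearised loss becomes a correlation with signs and the potential
telescopes again, up to two errors: the rounding to `z`, and the distance of the average playout
from its mean. `r2From_tail` bounds both through an exponential moment carried along the rounds.
Averaging `m` playouts costs `log 2 / m + 2 t²` in the exponent of each round, hence with `m ≥ η T`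
only `log 2 / η` plus quadratic terms in total. A single round needs a bound without error term
(`r2_regret_one`).

Efficiency is proved by couplings. `Run` is a Hoare triple with a time bound, saying that a program
can be coupled with a draw from a given law. A coupling of the whole play with the forecaster, on
which the outputs agree and the clock is bounded, yields equality of the laws and a bound valid on
every run. -/

namespace Transductive

/-! ### Sauer–Shelah and the metric entropy of VC classes -/

section VC

open Finset

/-- A set of positions shattered by patterns of `F` yields a set of the same size shattered by `F`. -/
lemma shatters_of_trace {X : Type u} {F : Set (X → Bool)} {m : ℕ} {v : Fin m → X}
    {P : Finset (Fin m → Bool)} (hP : ∀ a ∈ P, ∃ f ∈ F, ∀ i, a i = f (v i))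
    {S : Finset (Fin m)}
    (hS : (P.image fun a => univ.filter fun i => a i = true).Shatters S) :
    ∃ S' : Finset X, S'.card = S.card ∧ Shatters F S' := by
  classical
  have key : ∀ t ⊆ S, ∃ f ∈ F, ∀ i ∈ S, (f (v i) = true ↔ i ∈ t) := by
    intro t ht
    obtain ⟨u, hu, hut⟩ := hS ht
    obtain ⟨a, ha, rfl⟩ := mem_image.1 hu
    obtain ⟨f, hf, hfa⟩ := hP a ha
    refine ⟨f, hf, fun i hi => ?_⟩
    rw [← hut, mem_inter, mem_filter, hfa]
    simp [hi]
  -- Two positions with the same instance cannot both lie in a shattered set: the pattern cutting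
  -- out `{i}` would have to separate them. Hence passing from positions to instances preserves the
  -- size.
  have hinj : Set.InjOn v S := by
    intro i hi j hj hij
    obtain ⟨f, -, hf⟩ := key {i} (by simpa using hi)
    have h1 := (hf i hi).2 (by simp)
    rw [hij] at h1
    have h2 := (hf j hj).1 h1
    exact (mem_singleton.1 h2).symm
  refine ⟨S.image v, card_image_of_injOn hinj, fun g => ?_⟩
  obtain ⟨f, hf, h⟩ := key (S.filter fun i => g (v i) = true) (filter_subset _ _)
  refine ⟨f, hf, fun x hx => ?_⟩
  obtain ⟨i, hi, rfl⟩ := mem_image.1 hx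
  have := h i hi
  rw [mem_filter] at this
  rw [Bool.eq_iff_iff]
  simpa [hi] using this

/-- Sauer–Shelah for the patterns of a class on a sequence of points. -/
lemma card_traces_le {X : Type u} {F : Set (X → Bool)} {d m : ℕ}
    (hF : ∀ S : Finset X, Shatters F S → S.card ≤ d) {v : Fin m → X}
    {P : Finset (Fin m → Bool)} (hP : ∀ a ∈ P, ∃ f ∈ F, ∀ i, a i = f (v i)) :
    P.card ≤ ∑ k ∈ range (d + 1), m.choose k := by
  classical
  set A := P.image fun a => univ.filter fun i => a i = true with hA
  have hinj : Function.Injective fun a : Fin m → Bool => univ.filter fun i => a i = true := by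
    intro a b hab
    funext i
    have : i ∈ (univ.filter fun i => a i = true) ↔ i ∈ univ.filter fun i => b i = true := by
      simp only at hab
      rw [hab]
    rw [mem_filter, mem_filter] at this
    exact Bool.eq_iff_iff.2 (by simpa using this)
  have h1 : P.card = A.card := (card_image_of_injective _ hinj).symm
  have hd : A.vcDim ≤ d := by
    refine Finset.sup_le fun S hS => ?_
    obtain ⟨S', hS', hsh⟩ := shatters_of_trace hP (mem_shatterer.1 hS)
    exact hS' ▸ hF S' hsh
  calc P.card = A.card := h1
    _ ≤ A.shatterer.card := card_le_card_shatterer A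
    _ ≤ ∑ k ∈ Iic A.vcDim, (Fintype.card (Fin m)).choose k := card_shatterer_le_sum_vcDim
    _ ≤ ∑ k ∈ range (d + 1), m.choose k := by
      rw [Fintype.card_fin]
      refine sum_le_sum_of_subset fun k hk => ?_
      rw [mem_Iic] at hk
      rw [mem_range]
      omega

/-- For `k ≤ d` one has `x ^ d ≤ x ^ k`, so the left side is part of the binomial expansion of `(x +
1) ^ m`. Leaving `x` free avoids any case distinction between `m` and `d`. -/
lemma sum_choose_mul_pow_le (d m : ℕ) {x : ℝ} (hx : 0 < x) (hx1 : x ≤ 1) :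
    (∑ k ∈ range (d + 1), (m.choose k : ℝ)) * x ^ d ≤ Real.exp (x * m) := by
  have h1 : (∑ k ∈ range (d + 1), (m.choose k : ℝ)) * x ^ d
      ≤ ∑ k ∈ range (d + 1), (m.choose k : ℝ) * x ^ k := by
    rw [sum_mul]
    refine sum_le_sum fun k hk => mul_le_mul_of_nonneg_left ?_ (Nat.cast_nonneg _)
    exact pow_le_pow_of_le_one hx.le hx1 (by rw [mem_range] at hk; omega)
  have h2 : ∑ k ∈ range (d + 1), (m.choose k : ℝ) * x ^ k
      ≤ ∑ k ∈ range (m + 1), (m.choose k : ℝ) * x ^ k := by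
    have h : ∑ k ∈ range (m + 1), (m.choose k : ℝ) * x ^ k
        = ∑ k ∈ range (m + 1 + (d + 1)), (m.choose k : ℝ) * x ^ k := by
      refine sum_subset (range_subset_range.2 (by omega)) fun k _ hk => ?_
      rw [mem_range] at hk
      rw [Nat.choose_eq_zero_of_lt (by omega), Nat.cast_zero, zero_mul]
    rw [h]
    exact sum_le_sum_of_subset_of_nonneg (range_subset_range.2 (by omega))
      fun k _ _ => by positivity
  have h3 : ∑ k ∈ range (m + 1), (m.choose k : ℝ) * x ^ k = (x + 1) ^ m := by
    rw [add_pow]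
    refine sum_congr rfl fun k _ => ?_
    rw [one_pow, mul_one, mul_comm]
  calc _ ≤ (x + 1) ^ m := h3 ▸ h1.trans h2
    _ ≤ Real.exp x ^ m := pow_le_pow_left₀ (by linarith) (Real.add_one_le_exp x) m
    _ = Real.exp (x * m) := by rw [← Real.exp_nat_mul, mul_comm]

/-- The number of positions where two sign patterns differ. -/
def diffCount {T : ℕ} (a b : Fin T → Bool) : ℕ := (univ.filter fun i => a i ≠ b i).card

/-- If all pairs of patterns are far apart, then some `m` positions tell all of them apart. -/
lemma exists_separating_sample {T m : ℕ} {P : Finset (Fin T → Bool)} {ε : ℝ} (hT : 1 ≤ T)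
    (hsep : ∀ a ∈ P, ∀ b ∈ P, a ≠ b → ε * T ≤ diffCount a b)
    (hm : (P.card : ℝ) ^ 2 * Real.exp (-(ε * m)) ≤ 1) :
    ∃ τ : Fin m → Fin T, Set.InjOn (fun a : Fin T → Bool => a ∘ τ) P := by
  classical
  by_contra! hcon
  have hTpos : (0 : ℝ) < T := by exact_mod_cast hT
  -- The union bound in counting form: if no sample works, each sample lies in the agreement set of
  -- some pair. A separated pair agrees on at most `(1 - ε) T ≤ T e^(-ε)` positions, so the fewer
  -- than `P.card ^ 2` ordered pairs cannot cover all `T ^ m` samples.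
  have hcov : (univ : Finset (Fin m → Fin T)) ⊆ P.offDiag.biUnion fun q =>
      Fintype.piFinset fun _ => univ.filter fun i => q.1 i = q.2 i := by
    intro τ _
    have h := hcon τ
    simp only [Set.InjOn, not_forall] at h
    obtain ⟨a, ha, b, hb, hab, hne⟩ := h
    refine mem_biUnion.2 ⟨(a, b), mem_offDiag.2 ⟨ha, hb, hne⟩, ?_⟩
    simp only [Fintype.mem_piFinset, mem_filter, mem_univ, true_and]
    exact fun j => congrFun hab j
  have hcard : (T : ℝ) ^ m ≤ ∑ q ∈ P.offDiag, (T * Real.exp (-ε)) ^ m := by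
    have h1 := (card_le_card hcov).trans card_biUnion_le
    rw [card_univ, Fintype.card_fun, Fintype.card_fin, Fintype.card_fin] at h1
    have h2 : ((T ^ m : ℕ) : ℝ) ≤ _ := Nat.cast_le.2 h1
    rw [Nat.cast_pow] at h2
    refine h2.trans ?_
    rw [Nat.cast_sum]
    refine sum_le_sum fun q hq => ?_
    obtain ⟨ha, hb, hne⟩ := mem_offDiag.1 hq
    rw [Fintype.card_piFinset, prod_const, card_univ, Fintype.card_fin, Nat.cast_pow]
    refine pow_le_pow_left₀ (Nat.cast_nonneg _) ?_ m
    have h3 := hsep _ ha _ hb hne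
    have h4 : (univ.filter fun i => q.1 i = q.2 i).card + diffCount q.1 q.2 = T := by
      have := card_filter_add_card_filter_not (s := (univ : Finset (Fin T)))
        (fun i => q.1 i = q.2 i)
      rw [card_univ, Fintype.card_fin] at this
      exact this
    have h5 : ((univ.filter fun i => q.1 i = q.2 i).card : ℝ) + diffCount q.1 q.2 = T := by
      exact_mod_cast h4
    have h6 := Real.add_one_le_exp (-ε)
    nlinarith
  rw [sum_const, nsmul_eq_mul, mul_pow, ← Real.exp_nat_mul, offDiag_card] at hcard
  have hexp : Real.exp (m * -ε) = Real.exp (-(ε * m)) := by congr 1; ring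
  rw [hexp] at hcard
  have hTm : (0 : ℝ) < T ^ m := by positivity
  have hE := Real.exp_pos (-(ε * m))
  have h7 : (1 : ℝ) ≤ ((P.card * P.card - P.card : ℕ) : ℝ) * Real.exp (-(ε * m)) := by
    have : (T : ℝ) ^ m * 1 ≤
        T ^ m * (((P.card * P.card - P.card : ℕ) : ℝ) * Real.exp (-(ε * m))) := by
      linarith
    exact le_of_mul_le_mul_left this hTm
  rcases Nat.eq_zero_or_pos P.card with h0 | h0
  · rw [h0] at h7; norm_num at h7
  · have h8 : ((P.card * P.card - P.card : ℕ) : ℝ) < (P.card : ℝ) ^ 2 := by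
      have : P.card * P.card - P.card < P.card ^ 2 := by
        rw [sq]; exact Nat.sub_lt (Nat.mul_pos h0 h0) h0
      exact_mod_cast this
    nlinarith

/-- Metric entropy of a class of finite VC dimension. -/
lemma log_card_le_of_separated {X : Type u} {F : Set (X → Bool)} {d T : ℕ}
    (hF : ∀ S : Finset X, Shatters F S → S.card ≤ d) (hT : 1 ≤ T) {v : Fin T → X}
    {P : Finset (Fin T → Bool)} (hP : ∀ a ∈ P, ∃ f ∈ F, ∀ i, a i = f (v i))
    {ε : ℝ} (hε : 0 < ε) (hε1 : ε ≤ 1)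
    (hsep : ∀ a ∈ P, ∀ b ∈ P, a ≠ b → ε * T ≤ diffCount a b) :
    Real.log P.card ≤ 2 * d * Real.log (4 / ε) + 1 / 2 := by
  classical
  have hlog4 : 0 ≤ Real.log (4 / ε) :=
    Real.log_nonneg ((one_le_div hε).2 (by linarith))
  rcases Nat.eq_zero_or_pos P.card with h0 | h0
  · rw [h0, Nat.cast_zero, Real.log_zero]; positivity
  have hN : (1 : ℝ) ≤ P.card := by exact_mod_cast h0
  set L := Real.log P.card with hL
  have hLnn : 0 ≤ L := Real.log_nonneg hN
  have hexpL : (P.card : ℝ) = Real.exp L := (Real.exp_log (by linarith)).symm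
  -- The least sample size with `P.card ^ 2 * exp (-(ε m)) ≤ 1`.
  set m := ⌈2 * L / ε⌉₊ with hm
  have hm1 : 2 * L / ε ≤ m := Nat.le_ceil _
  have hm2 : (m : ℝ) < 2 * L / ε + 1 := Nat.ceil_lt_add_one (by positivity)
  have hm3 : 2 * L ≤ ε * m := by
    rw [div_le_iff₀ hε] at hm1; linarith
  have hm4 : ε * m ≤ 2 * L + ε := by
    have := mul_le_mul_of_nonneg_left hm2.le hε.le
    have h' : ε * (2 * L / ε + 1) = 2 * L + ε := by field_simp
    linarith
  obtain ⟨τ, hτ⟩ := exists_separating_sample (m := m) hT hsep (by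
    rw [hexpL, ← Real.exp_nat_mul, ← Real.exp_add]
    rw [Real.exp_le_one_iff]
    push_cast
    linarith)
  have hcard := card_traces_le hF (v := v ∘ τ) (P := P.image fun a => a ∘ τ) (by
    intro a ha
    obtain ⟨a', ha', rfl⟩ := mem_image.1 ha
    obtain ⟨f, hf, h⟩ := hP a' ha'
    exact ⟨f, hf, fun i => h (τ i)⟩)
  rw [card_image_of_injOn hτ] at hcard
  have hcard' : (P.card : ℝ) ≤ ∑ k ∈ range (d + 1), (m.choose k : ℝ) := by exact_mod_cast hcard
  -- With `x = ε / 4` the exponent `x m` is at most `L / 2 + 1 / 4`, so half of `L` can be absorbed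
  -- on the left.
  have hx : 0 < ε / 4 := by positivity
  have h1 := sum_choose_mul_pow_le d m hx (by linarith)
  have hpow : 0 < (ε / 4) ^ d := pow_pos hx d
  have hPpos : (0 : ℝ) < P.card := by linarith
  have h2 : (P.card : ℝ) * (ε / 4) ^ d ≤ Real.exp (ε / 4 * m) :=
    (mul_le_mul_of_nonneg_right hcard' hpow.le).trans h1
  have h3 := Real.log_le_log (mul_pos hPpos hpow) h2
  rw [Real.log_exp, Real.log_mul hPpos.ne' hpow.ne', Real.log_pow] at h3
  have h4 : Real.log (ε / 4) = -Real.log (4 / ε) := by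
    rw [← Real.log_inv, inv_div]
  rw [h4] at h3
  change L + _ ≤ _ at h3
  nlinarith

/-- A maximal separated subset is a net. -/
lemma exists_separated_net {T : ℕ} (P : Finset (Fin T → Bool)) {r : ℝ} (hr : 0 < r) :
    ∃ B ⊆ P, (∀ a ∈ B, ∀ b ∈ B, a ≠ b → r ≤ diffCount a b) ∧
      ∀ a ∈ P, ∃ b ∈ B, (diffCount a b : ℝ) ≤ r := by
  classical
  have hcomm : ∀ a b : Fin T → Bool, diffCount a b = diffCount b a := fun a b => by
    simp only [diffCount, ne_comm]
  let Q := P.powerset.filter fun B => ∀ a ∈ B, ∀ b ∈ B, a ≠ b → r ≤ diffCount a b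
  have hQ : Q.Nonempty := ⟨∅, by simp [Q]⟩
  obtain ⟨B, hB, hmax⟩ := exists_max_image Q card hQ
  obtain ⟨hBP, hsep⟩ := mem_filter.1 hB
  rw [mem_powerset] at hBP
  refine ⟨B, hBP, hsep, fun a ha => ?_⟩
  by_contra! hcon
  have haB : a ∉ B := fun h => by
    have := hcon a h
    simp [diffCount] at this
    linarith
  have hins : insert a B ∈ Q := by
    refine mem_filter.2 ⟨mem_powerset.2 (insert_subset ha hBP), ?_⟩
    intro x hx y hy hxy
    rcases mem_insert.1 hx with rfl | hx' <;> rcases mem_insert.1 hy with rfl | hy'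
    · exact absurd rfl hxy
    · exact (hcon y hy').le
    · rw [hcomm]; exact (hcon x hx').le
    · exact hsep x hx' y hy' hxy
  have := hmax _ hins
  rw [card_insert_of_notMem haB] at this
  omega

end VC

/-! ### Massart's lemma and chaining -/

section Chaining

open Finset

lemma sgn_sq (c : Bool) : sgn c ^ 2 = 1 := by cases c <;> simp [sgn]

lemma abs_sgn (c : Bool) : |sgn c| = 1 := by cases c <;> simp [sgn]

/-- The moment generating function of a Rademacher sum. -/
lemma sum_exp_signs_le {T : ℕ} (u : Fin T → ℝ) {V : ℝ} (hu : ∑ i, u i ^ 2 ≤ V) (t : ℝ) :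
    ∑ σ : Fin T → Bool, Real.exp (t * ∑ i, sgn (σ i) * u i)
      ≤ 2 ^ T * Real.exp (t ^ 2 * V / 2) := by
  have h1 : ∑ σ : Fin T → Bool, Real.exp (t * ∑ i, sgn (σ i) * u i)
      = ∏ i, ∑ c : Bool, Real.exp (t * (sgn c * u i)) := by
    rw [Fintype.prod_sum]
    refine sum_congr rfl fun σ _ => ?_
    rw [mul_sum, Real.exp_sum]
  have h2 : ∀ i, ∑ c : Bool, Real.exp (t * (sgn c * u i)) ≤ 2 * Real.exp (t ^ 2 * u i ^ 2 / 2) := by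
    intro i
    have h := Real.cosh_le_exp_half_sq (t * u i)
    rw [Real.cosh_eq, mul_pow] at h
    have h' : ∑ c : Bool, Real.exp (t * (sgn c * u i))
        = Real.exp (t * u i) + Real.exp (-(t * u i)) := by
      simp [sgn]
    rw [h']
    linarith
  rw [h1]
  calc _ ≤ ∏ i, 2 * Real.exp (t ^ 2 * u i ^ 2 / 2) :=
        prod_le_prod (fun i _ => sum_nonneg fun c _ => (Real.exp_pos _).le) fun i _ => h2 i
    _ = 2 ^ T * Real.exp (t ^ 2 * (∑ i, u i ^ 2) / 2) := by
      rw [prod_mul_distrib, ← Real.exp_sum, prod_const, card_univ, Fintype.card_fin, mul_sum,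
        sum_div]
    _ ≤ 2 ^ T * Real.exp (t ^ 2 * V / 2) := by
      gcongr

/-- Massart's finite class lemma, for selections. -/
lemma sum_selection_le {T : ℕ} (A : Finset (Fin T → Bool)) (u : (Fin T → Bool) → Fin T → ℝ)
    {V L : ℝ} (hV : 0 < V) (hL : 0 < L) (hu : ∀ a ∈ A, ∑ i, u a i ^ 2 ≤ V)
    (hA : Real.log A.card ≤ L) (a : (Fin T → Bool) → Fin T → Bool) (ha : ∀ σ, a σ ∈ A) :
    ∑ σ : Fin T → Bool, ∑ i, sgn (σ i) * u (a σ) i ≤ Real.sqrt (2 * V * L) * 2 ^ T := by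
  have hcard : 0 < (A.card : ℝ) := by
    exact_mod_cast card_pos.2 ⟨_, ha fun _ => true⟩
  set R := Real.sqrt (2 * V * L) with hR
  have hR2 : R ^ 2 = 2 * V * L := Real.sq_sqrt (by positivity)
  have hRpos : 0 < R := Real.sqrt_pos.2 (by positivity)
  -- The minimiser of `L / t + t V / 2`, whose minimum is `R`.
  set t := R / V with ht
  have htpos : 0 < t := by positivity
  have htV : t * V = R := by rw [ht]; field_simp
  have hc : L + t ^ 2 * V / 2 = t * R := by
    have h1 : t ^ 2 * V = t * R := by rw [← htV]; ring
    have h2 : t * R = 2 * L := by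
      rw [ht, div_mul_eq_mul_div, ← sq, hR2]; field_simp
    rw [h1, h2]; ring
  -- The inequality `1 + x ≤ exp x` takes the place of Jensen; the selected term is then bounded by
  -- the sum over all of `A`, which no longer depends on the selection.
  have h1 : ∀ σ : Fin T → Bool, t * (∑ i, sgn (σ i) * u (a σ) i) - t * R + 1 ≤
      ∑ b ∈ A, Real.exp (t * ∑ i, sgn (σ i) * u b i) * Real.exp (-(t * R)) := by
    intro σ
    refine (Real.add_one_le_exp _).trans ?_
    rw [sub_eq_add_neg, Real.exp_add]
    exact single_le_sum (f := fun b => Real.exp (t * ∑ i, sgn (σ i) * u b i) * Real.exp (-(t * R)))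
      (fun b _ => by positivity) (ha σ)
  have h2 := sum_le_sum fun σ (_ : σ ∈ (univ : Finset (Fin T → Bool))) => h1 σ
  rw [sum_comm, sum_add_distrib, sum_sub_distrib, ← mul_sum, sum_const, sum_const, card_univ,
    Fintype.card_fun, Fintype.card_bool, Fintype.card_fin] at h2
  have h3 : ∑ b ∈ A, ∑ σ : Fin T → Bool,
      Real.exp (t * ∑ i, sgn (σ i) * u b i) * Real.exp (-(t * R)) ≤ 2 ^ T := by
    calc _ ≤ ∑ b ∈ A, 2 ^ T * Real.exp (t ^ 2 * V / 2) * Real.exp (-(t * R)) := by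
          refine sum_le_sum fun b hb => ?_
          rw [← sum_mul]
          exact mul_le_mul_of_nonneg_right (sum_exp_signs_le _ (hu b hb) t) (Real.exp_pos _).le
      _ = 2 ^ T * (Real.exp (Real.log A.card) * Real.exp (t ^ 2 * V / 2) * Real.exp (-(t * R))) := by
          rw [sum_const, nsmul_eq_mul, Real.exp_log hcard]; ring
      _ ≤ 2 ^ T * 1 := by
          refine mul_le_mul_of_nonneg_left ?_ (by positivity)
          rw [← Real.exp_add, ← Real.exp_add, Real.exp_le_one_iff]
          linarith
      _ = 2 ^ T := mul_one _
  have h4 := h2.trans h3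
  simp only [nsmul_eq_mul, Nat.cast_pow, Nat.cast_ofNat, mul_one] at h4
  have h5 : t * (∑ σ : Fin T → Bool, ∑ i, sgn (σ i) * u (a σ) i) ≤ t * (R * 2 ^ T) := by linarith
  exact le_of_mul_le_mul_left h5 htpos

/-- Every selection from `A` has correlation at most `r` with random signs. -/
def CorrBound {T : ℕ} (A : Finset (Fin T → Bool)) (r : ℝ) : Prop :=
  ∀ a : (Fin T → Bool) → Fin T → Bool, (∀ σ, a σ ∈ A) →
    ∑ σ : Fin T → Bool, ∑ i, sgn (σ i) * sgn (a σ i) ≤ r * 2 ^ T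

lemma sum_sgn_sub_sq {T : ℕ} (a b : Fin T → Bool) :
    ∑ i, (sgn (a i) - sgn (b i)) ^ 2 = 4 * diffCount a b := by
  rw [diffCount, card_filter, Nat.cast_sum, mul_sum]
  refine sum_congr rfl fun i _ => ?_
  cases a i <;> cases b i <;> norm_num [sgn]

/-- One step of chaining. -/
lemma CorrBound.of_net {T : ℕ} {A B : Finset (Fin T → Bool)} {r h L : ℝ} (hB : CorrBound B r)
    (hh : 0 < h) (hL : 0 < L) (hA : Real.log A.card ≤ L)
    (hnet : ∀ a ∈ A, ∃ b ∈ B, (diffCount a b : ℝ) ≤ h) :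
    CorrBound A (r + Real.sqrt (8 * h * L)) := by
  choose! p hpB hp using hnet
  intro a ha
  have h1 := hB (fun σ => p (a σ)) fun σ => hpB _ (ha σ)
  -- The selection is its projection to the net plus a remainder. The remainder has squared length
  -- four times a Hamming distance, hence at most `4 h`, and is indexed by `A`.
  have h2 := sum_selection_le A (fun a i => sgn (a i) - sgn (p a i)) (V := 4 * h) (by linarith) hL
    (fun a ha => by rw [sum_sgn_sub_sq]; linarith [hp a ha]) hA a ha
  have h3 : ∑ σ : Fin T → Bool, ∑ i, sgn (σ i) * sgn (a σ i) =
      ∑ σ : Fin T → Bool, ∑ i, sgn (σ i) * sgn (p (a σ) i) +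
      ∑ σ : Fin T → Bool, ∑ i, sgn (σ i) * (sgn (a σ i) - sgn (p (a σ) i)) := by
    simp only [mul_sub, sum_sub_distrib]; ring
  rw [h3, add_mul]
  have h4 : 2 * (4 * h) * L = 8 * h * L := by ring
  rw [h4] at h2
  exact add_le_add h1 h2

lemma sum_signs_apply {T : ℕ} (i : Fin T) : ∑ σ : Fin T → Bool, sgn (σ i) = 0 := by
  have h : ∑ σ : Fin T → Bool, sgn (σ i) = ∑ σ : Fin T → Bool, sgn (!(σ i)) :=
    Fintype.sum_equiv (Equiv.piCongrRight fun _ => Equiv.boolNot) _ _ fun σ => by simp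
  have h' : ∀ c, sgn (!c) = -sgn c := fun c => by cases c <;> simp [sgn]
  simp only [h', sum_neg_distrib] at h
  linarith

/-- A constant selection cannot follow the signs, each of which has mean zero. This settles VC
dimension `0`, where the entropy bounds of the chaining argument vanish while `sum_selection_le`
needs `L > 0`. -/
lemma CorrBound.of_subsingleton {T : ℕ} {A : Finset (Fin T → Bool)} (hA : A.card ≤ 1) :
    CorrBound A 0 := by
  intro a ha
  have h : ∀ σ, a σ = a fun _ => true := fun σ => card_le_one.1 hA _ (ha _) _ (ha _)
  simp only [fun σ => h σ]
  rw [sum_comm]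
  simp only [← sum_mul, sum_signs_apply]
  simp

lemma log_four_lt : Real.log 4 < 3 / 2 := by
  have : (4 : ℝ) = 2 ^ 2 := by norm_num
  rw [this, Real.log_pow]
  have := Real.log_two_lt_d9
  push_cast
  linarith

/-- Chaining: the Rademacher averages of a class of VC dimension `d`. -/
lemma corrBound_of_vc {X : Type u} {F : Set (X → Bool)} {d T : ℕ}
    (hF : ∀ S : Finset X, Shatters F S → S.card ≤ d) (hT : 1 ≤ T) {v : Fin T → X}
    {P : Finset (Fin T → Bool)} (hP : ∀ a ∈ P, ∃ f ∈ F, ∀ i, a i = f (v i)) :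
    CorrBound P (53 * Real.sqrt (d * T)) := by
  have hTpos : (0 : ℝ) < T := by exact_mod_cast hT
  rcases Nat.eq_zero_or_pos d with rfl | hd
  · have h1 := card_traces_le hF hP
    simp only [zero_add, range_one, sum_singleton, Nat.choose_zero_right] at h1
    simpa using CorrBound.of_subsingleton h1
  have hd1 : (1 : ℝ) ≤ d := by exact_mod_cast hd
  -- At relative scale `ε = 4^(-k)` the entropy bound reads `2 d (k + 1) log 4 + 1/2`; `log 4 < 3/2`
  -- and `d ≥ 1` bring it under `7 d (k + 1)`.
  have hnet : ∀ k : ℕ, ∃ B ⊆ P, Real.log B.card ≤ 7 * d * (k + 1) ∧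
      ∀ a ∈ P, ∃ b ∈ B, (diffCount a b : ℝ) ≤ (1 / 4) ^ k * T := by
    intro k
    obtain ⟨B, hBP, hsep, hB⟩ := exists_separated_net P (r := (1 / 4) ^ k * T) (by positivity)
    refine ⟨B, hBP, ?_, hB⟩
    refine (log_card_le_of_separated hF hT (fun a ha => hP a (hBP ha)) (by positivity)
      (pow_le_one₀ (by norm_num) (by norm_num)) hsep).trans ?_
    have h1 : (4 : ℝ) / (1 / 4) ^ k = 4 ^ (k + 1) := by
      rw [one_div, inv_pow, div_inv_eq_mul, pow_succ]; ring
    rw [h1, Real.log_pow]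
    push_cast
    have h2 := log_four_lt
    have h3 : 2 * (d : ℝ) * ((k + 1) * Real.log 4) ≤ 2 * d * ((k + 1) * (3 / 2)) := by gcongr
    have h4 : (1 : ℝ) ≤ d * (k + 1) := by
      have : (0 : ℝ) ≤ k := Nat.cast_nonneg k
      nlinarith
    nlinarith
  choose B hBP hBlog hBnet using hnet
  set Q := Real.sqrt (112 * (d * T)) with hQ
  -- The increments decay geometrically: Bernoulli gives `k + 2 ≤ 2 (9/4)^k`, and `(1/4) (9/4) =
  -- (3/4)^2`.
  have hstep : ∀ k : ℕ,
      Real.sqrt (8 * ((1 / 4) ^ k * T) * (7 * d * ((k + 1 : ℕ) + 1))) ≤ Q * (3 / 4) ^ k := by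
    intro k
    have hb := one_add_mul_le_pow (a := (5 / 4 : ℝ)) (by norm_num) k
    have h1 : ((k : ℝ) + 2) ≤ 2 * (9 / 4) ^ k := by
      have : (0 : ℝ) ≤ k := Nat.cast_nonneg k
      norm_num at hb
      linarith
    rw [Real.sqrt_le_left (by positivity), mul_pow, hQ, Real.sq_sqrt (by positivity)]
    have h2 : ((3 / 4 : ℝ) ^ k) ^ 2 = (1 / 4) ^ k * (9 / 4) ^ k := by
      rw [← pow_mul, mul_comm, pow_mul, ← mul_pow]; norm_num
    rw [h2]
    have h3 : 56 * (d * T) * ((1 / 4) ^ k * ((k : ℝ) + 2)) ≤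
        56 * (d * T) * ((1 / 4 : ℝ) ^ k * (2 * (9 / 4) ^ k)) := by gcongr
    push_cast
    linarith
  -- The coarsest net costs at most `Q`; the steps add `Q ∑_{j<k} (3/4)^j = 4 Q (1 - (3/4)^k)`.
  have hchain : ∀ k, CorrBound (B k) (Q * (5 - 4 * (3 / 4) ^ k)) := by
    intro k
    induction k with
    | zero =>
      intro a ha
      have h := sum_selection_le (B 0) (fun a i => sgn (a i)) (V := T) (L := 7 * d * ((0 : ℕ) + 1))
        hTpos (by push_cast; linarith) (fun a _ => by simp [sgn_sq]) (hBlog 0) a ha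
      refine h.trans (mul_le_mul_of_nonneg_right ?_ (by positivity))
      have h5 : Real.sqrt (2 * T * (7 * d * ((0 : ℕ) + 1))) ≤ Q :=
        Real.sqrt_le_sqrt (by push_cast; nlinarith)
      norm_num at h5 ⊢
      linarith
    | succ k ih =>
      intro a ha
      refine (CorrBound.of_net ih (h := (1 / 4) ^ k * T)
        (L := 7 * d * ((k + 1 : ℕ) + 1)) (by positivity) (by positivity) (hBlog (k + 1))
        (fun a ha => hBnet k a (hBP _ ha)) a ha).trans
        (mul_le_mul_of_nonneg_right ?_ (by positivity))
      have := hstep k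
      rw [pow_succ]
      linarith
  -- Below a scale of one position, a pattern within reach of the net equals its net point, so the
  -- net is all of `P`.
  obtain ⟨K, hK⟩ := exists_pow_lt_of_lt_one (inv_pos.2 hTpos) (by norm_num : (1 / 4 : ℝ) < 1)
  have hPB : ∀ a ∈ P, a ∈ B K := by
    intro a ha
    obtain ⟨b, hb, hab⟩ := hBnet K a ha
    have h1 : (1 / 4 : ℝ) ^ K * T < 1 := by
      have := mul_lt_mul_of_pos_right hK hTpos
      rwa [inv_mul_cancel₀ hTpos.ne'] at this
    have h2 : diffCount a b = 0 := by
      have : (diffCount a b : ℝ) < 1 := hab.trans_lt h1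
      exact_mod_cast Nat.lt_one_iff.1 (by exact_mod_cast this)
    have h3 : a = b := by
      funext i
      by_contra hne
      have := (card_eq_zero.1 h2)
      exact notMem_empty i (this ▸ mem_filter.2 ⟨mem_univ i, hne⟩)
    exact h3 ▸ hb
  intro a ha
  refine (hchain K a fun σ => hPB _ (ha σ)).trans
    (mul_le_mul_of_nonneg_right ?_ (by positivity))
  -- The constant `53` exceeds `5 √112`.
  have h1 : Q ≤ 53 / 5 * Real.sqrt (d * T) := by
    rw [hQ, Real.sqrt_mul (by norm_num)]
    refine mul_le_mul_of_nonneg_right ?_ (Real.sqrt_nonneg _)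
    rw [Real.sqrt_le_left (by norm_num)]
    norm_num
  have h2 : (0 : ℝ) ≤ (3 / 4) ^ K := by positivity
  have h3 : 0 ≤ Q := Real.sqrt_nonneg _
  nlinarith

/-- The Rademacher complexity of a class of VC dimension `d`. -/
lemma rademacher_signExperts_le {X : Type u} {F : Set (X → Bool)} {d T : ℕ} (hne : F.Nonempty)
    (hF : ∀ S : Finset X, Shatters F S → S.card ≤ d) (hT : 1 ≤ T) (v : Fin T → X) :
    rademacher (signExperts F v) ≤ 53 * Real.sqrt (d * T) := by
  classical
  let P : Finset (Fin T → Bool) := univ.filter fun a => ∃ f ∈ F, ∀ i, a i = f (v i)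
  have hPne : P.Nonempty := by
    obtain ⟨f, hf⟩ := hne
    exact ⟨fun i => f (v i), mem_filter.2 ⟨mem_univ _, f, hf, fun _ => rfl⟩⟩
  have hmax : ∀ σ : Fin T → Bool, ∃ a ∈ P, ∀ b ∈ P,
      ∑ i, sgn (σ i) * sgn (b i) ≤ ∑ i, sgn (σ i) * sgn (a i) := fun σ =>
    exists_max_image P _ hPne
  choose a haP ha using hmax
  have h := corrBound_of_vc hF hT (P := P) (fun a ha => (mem_filter.1 ha).2) a haP
  rw [rademacher, div_le_iff₀ (by positivity)]
  refine (sum_le_sum fun σ _ => ?_).trans h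
  have : Nonempty (signExperts F v) := (hne.image _).to_subtype
  refine ciSup_le ?_
  rintro ⟨_, f, hf, rfl⟩
  exact ha σ (fun i => f (v i)) (mem_filter.2 ⟨mem_univ _, f, hf, fun _ => rfl⟩)

end Chaining

noncomputable section

/-! ### The potential and its martingale identity -/

section Potential

open Finset

variable {T : ℕ}

lemma bddBelow_loss (G : Set (Fin T → ℝ)) (w : Fin T → Bool) :
    BddBelow (Set.range fun f : G => ∑ i, |f.1 i - sgn (w i)|) :=
  ⟨0, by rintro _ ⟨f, rfl⟩; exact sum_nonneg fun _ _ => abs_nonneg _⟩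

lemma infLoss_le {G : Set (Fin T → ℝ)} {h : Fin T → ℝ} (hh : h ∈ G) (w : Fin T → Bool) :
    infLoss G w ≤ ∑ i, |h i - sgn (w i)| :=
  ciInf_le (bddBelow_loss G w) ⟨h, hh⟩

lemma infLoss_update_le {G : Set (Fin T → ℝ)} (hne : G.Nonempty)
    (hG : ∀ h ∈ G, ∀ i, |h i| ≤ 1) (w : Fin T → Bool) (i : Fin T) (c c' : Bool) :
    infLoss G (Function.update w i c) ≤ infLoss G (Function.update w i c') + 2 := by
  have : Nonempty G := hne.to_subtype
  rw [← sub_le_iff_le_add]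
  refine le_ciInf fun f => ?_
  rw [sub_le_iff_le_add]
  refine (infLoss_le f.2 _).trans ?_
  rw [← sum_erase_add _ _ (mem_univ i), ← sum_erase_add _ _ (mem_univ i)]
  have h1 : ∑ x ∈ univ.erase i, |f.1 x - sgn (Function.update w i c x)| =
      ∑ x ∈ univ.erase i, |f.1 x - sgn (Function.update w i c' x)| := by
    refine sum_congr rfl fun x hx => ?_
    rw [Function.update_of_ne (ne_of_mem_erase hx), Function.update_of_ne (ne_of_mem_erase hx)]
  rw [h1, Function.update_self, Function.update_self]
  have h2 := abs_le.1 (hG f.1 f.2 i)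
  have h3 : |f.1 i - sgn c| ≤ |f.1 i - sgn c'| + 2 := by
    cases c <;> cases c' <;> simp only [sgn, if_true, Bool.false_eq_true, if_false] <;>
      rw [abs_le] <;> constructor <;>
      linarith [le_abs_self (f.1 i - 1), neg_abs_le (f.1 i - 1), le_abs_self (f.1 i - -1),
        neg_abs_le (f.1 i - -1), h2.1, h2.2, abs_nonneg (f.1 i - 1), abs_nonneg (f.1 i - -1)]
  linarith

/-- Playouts are in `[-1, 1]`. -/
lemma abs_playout_le {G : Set (Fin T → ℝ)} (hne : G.Nonempty) (hG : ∀ h ∈ G, ∀ i, |h i| ≤ 1)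
    (s : Fin T → Option Bool) (i : Fin T) (Y : Fin T → Bool) : |playout G s i Y| ≤ 1 := by
  have h1 := infLoss_update_le hne hG (fill s Y) i true false
  have h2 := infLoss_update_le hne hG (fill s Y) i false true
  rw [playout, abs_le]
  constructor <;> linarith

lemma fill_update_some (s : Fin T → Option Bool) (Y : Fin T → Bool) (i : Fin T) (c : Bool) :
    fill (Function.update s i (some c)) Y = Function.update (fill s Y) i c := by
  funext j
  by_cases h : j = i
  · subst h; simp [fill]
  · simp [fill, h]

lemma fill_update_of_none {s : Fin T → Option Bool} {i : Fin T} (hi : s i = none)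
    (Y : Fin T → Bool) (c : Bool) :
    fill s (Function.update Y i c) = Function.update (fill s Y) i c := by
  funext j
  by_cases h : j = i
  · subst h; simp [fill, hi]
  · simp [fill, h]

/-- The expected least loss over the random completions of the labels seen so far. -/
def potential (G : Set (Fin T → ℝ)) (s : Fin T → Option Bool) : ℝ :=
  (∑ Y : Fin T → Bool, infLoss G (fill s Y)) / 2 ^ T

/-- The expected playout. -/
def meanPlayout (G : Set (Fin T → ℝ)) (s : Fin T → Option Bool) (i : Fin T) : ℝ :=
  (∑ Y : Fin T → Bool, playout G s i Y) / 2 ^ T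

/-- Flipping coordinate `i` is an involution, so the sum over `Y` equals the sum over the flipped
vectors; `Y` and its flip are the two updates in some order. -/
lemma sum_update_add (f : (Fin T → Bool) → ℝ) (i : Fin T) :
    2 * ∑ Y : Fin T → Bool, f Y = ∑ Y : Fin T → Bool,
      (f (Function.update Y i true) + f (Function.update Y i false)) := by
  have hinv : Function.Involutive fun Y : Fin T → Bool => Function.update Y i (!(Y i)) := by
    intro Y; simp
  have h : ∑ Y : Fin T → Bool, f Y = ∑ Y : Fin T → Bool, f (Function.update Y i (!(Y i))) :=
    (Equiv.sum_comp hinv.toPerm f).symm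
  rw [two_mul]
  nth_rewrite 2 [h]
  rw [← sum_add_distrib]
  refine sum_congr rfl fun Y _ => ?_
  have hY := Function.update_eq_self i Y
  cases hc : Y i <;> rw [hc] at hY
  · simp [hY, add_comm]
  · simp [hY]

/-- While `i` is unvisited, the uniform `Y i` fills it, so the old potential is the mean of the two
new ones; half of their difference is the mean playout by definition. Both regret bounds telescope
this identity. -/
lemma potential_update (G : Set (Fin T → ℝ)) {s : Fin T → Option Bool} {i : Fin T}
    (hi : s i = none) (c : Bool) :
    potential G (Function.update s i (some c)) = potential G s - sgn c * meanPlayout G s i := by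
  have h := sum_update_add (fun Y => infLoss G (fill s Y)) i
  simp only [fill_update_of_none hi, sum_add_distrib] at h
  simp only [potential, meanPlayout, playout, fill_update_some, ← sum_div, sum_sub_distrib]
  have h2 : (2 : ℝ) ^ T ≠ 0 := by positivity
  cases c <;> simp only [sgn, if_true, Bool.false_eq_true, if_false] <;> field_simp <;> linarith

lemma sum_abs_sub_sgn {h : Fin T → ℝ} (hh : ∀ i, |h i| ≤ 1) (w : Fin T → Bool) :
    ∑ i, |h i - sgn (w i)| = T - ∑ i, sgn (w i) * h i := by
  have : ∀ i, |h i - sgn (w i)| = 1 - sgn (w i) * h i := by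
    intro i
    have := abs_le.1 (hh i)
    cases w i <;> simp only [sgn, if_true, Bool.false_eq_true, if_false]
    · rw [abs_of_nonneg (by linarith)]; ring
    · rw [abs_of_nonpos (by linarith)]; ring
  simp [this]

/-- Against a sign the absolute loss is affine on `[-1, 1]`, so the least loss is `T` minus the best
correlation. This is how the Rademacher complexity enters. -/
lemma infLoss_eq {G : Set (Fin T → ℝ)} (hne : G.Nonempty) (hG : ∀ h ∈ G, ∀ i, |h i| ≤ 1)
    (w : Fin T → Bool) : infLoss G w = T - ⨆ f : G, ∑ i, sgn (w i) * f.1 i := by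
  have : Nonempty G := hne.to_subtype
  have hb : BddAbove (Set.range fun f : G => ∑ i, sgn (w i) * f.1 i) := by
    refine ⟨T, ?_⟩
    rintro _ ⟨f, rfl⟩
    have h := sum_abs_sub_sgn (hG f.1 f.2) w
    have h' : 0 ≤ ∑ i, |f.1 i - sgn (w i)| := sum_nonneg fun _ _ => abs_nonneg _
    simp only
    linarith
  apply le_antisymm
  · rw [le_sub_comm]
    refine ciSup_le fun f => ?_
    have h := infLoss_le f.2 w
    rw [sum_abs_sub_sgn (hG f.1 f.2)] at h
    linarith
  · refine le_ciInf fun f => ?_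
    rw [sum_abs_sub_sgn (hG f.1 f.2)]
    have h : ∑ i, sgn (w i) * f.1 i ≤ _ := le_ciSup hb f
    linarith

/-- The potential of the empty labelling. -/
lemma potential_none {G : Set (Fin T → ℝ)} (hne : G.Nonempty) (hG : ∀ h ∈ G, ∀ i, |h i| ≤ 1) :
    potential G (fun _ => none) = T - rademacher G := by
  have h : ∀ Y : Fin T → Bool, fill (fun _ => none) Y = Y := fun Y => rfl
  simp only [potential, rademacher, h, infLoss_eq hne hG, sum_sub_distrib, sum_const, card_univ,
    Fintype.card_fun, Fintype.card_bool, Fintype.card_fin, nsmul_eq_mul]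
  push_cast
  field_simp

/-- The potential of a complete labelling. -/
lemma potential_some (G : Set (Fin T → ℝ)) (w : Fin T → Bool) :
    potential G (fun i => some (w i)) = infLoss G w := by
  have h : ∀ Y : Fin T → Bool, fill (fun i => some (w i)) Y = w := fun Y => rfl
  simp only [potential, h, sum_const, card_univ, Fintype.card_fun, Fintype.card_bool,
    Fintype.card_fin, nsmul_eq_mul]
  push_cast
  field_simp

/-- The labelling after a list of rounds. -/
def labelAfter : List (Fin T × Bool) → (Fin T → Option Bool) → Fin T → Option Bool
  | [], s => s
  | (i, c) :: rest, s => labelAfter rest (Function.update s i (some c))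

lemma labelAfter_of_notMem (rounds : List (Fin T × Bool)) (s : Fin T → Option Bool) (i : Fin T)
    (hi : i ∉ rounds.map Prod.fst) : labelAfter rounds s i = s i := by
  induction rounds generalizing s with
  | nil => rfl
  | cons r rest ih =>
    simp only [List.map_cons, List.mem_cons, not_or] at hi
    rw [labelAfter, ih _ hi.2, Function.update_of_ne hi.1]

lemma labelAfter_of_mem {rounds : List (Fin T × Bool)} (hnd : (rounds.map Prod.fst).Nodup)
    (s : Fin T → Option Bool) {i : Fin T} {c : Bool} (hi : (i, c) ∈ rounds) :
    labelAfter rounds s i = some c := by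
  induction rounds generalizing s with
  | nil => simp at hi
  | cons r rest ih =>
    simp only [List.map_cons, List.nodup_cons] at hnd
    rcases List.mem_cons.1 hi with h | h
    · subst h
      rw [labelAfter, labelAfter_of_notMem _ _ _ hnd.1, Function.update_self]
    · exact ih hnd.2 _ h

lemma roundsOf_fst {Y : Type} (π : Equiv.Perm (Fin T)) (y : Fin T → Y) :
    (roundsOf π y).map Prod.fst = List.ofFn π := by
  simp only [roundsOf, List.map_ofFn]
  rfl

lemma nodup_roundsOf {Y : Type} (π : Equiv.Perm (Fin T)) (y : Fin T → Y) :
    ((roundsOf π y).map Prod.fst).Nodup := by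
  rw [roundsOf_fst, List.nodup_ofFn]
  exact π.injective

lemma labelAfter_roundsOf (π : Equiv.Perm (Fin T)) (y : Fin T → Bool) (s : Fin T → Option Bool) :
    labelAfter (roundsOf π y) s = fun i => some (y (π.symm i)) := by
  funext i
  refine labelAfter_of_mem (nodup_roundsOf π y) s ?_
  rw [roundsOf, List.mem_ofFn]
  exact ⟨π.symm i, by simp⟩

end Potential

/-! ### Expectations under discrete distributions -/

section Mean

/-- The expectation of `f` under `p` exists and equals `r`. -/
def HasMean {α : Type} (p : PMF α) (f : α → ℝ) (r : ℝ) : Prop :=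
  HasSum (fun a => (p a).toReal * f a) r

lemma hasMean_pure {α : Type} (a : α) (f : α → ℝ) : HasMean (PMF.pure a) f (f a) := by
  classical
  have h := hasSum_ite_eq a (f a)
  refine h.congr_fun fun b => ?_
  by_cases hb : b = a <;> simp [hb, PMF.pure_apply]

/-- The first stage ranges over a finite type, so it can be exchanged with the infinite sum over
outcomes without further summability conditions. -/
lemma HasMean.bind {α β : Type} [Fintype α] {p : PMF α} {k : α → PMF β} {f : β → ℝ} {r : α → ℝ}
    (h : ∀ a, HasMean (k a) f (r a)) : HasMean (p.bind k) f (∑ a, (p a).toReal * r a) := by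
  have h1 := hasSum_sum (s := Finset.univ) fun a _ => (h a).mul_left (p a).toReal
  refine h1.congr_fun fun b => ?_
  rw [PMF.bind_apply, tsum_fintype, ENNReal.toReal_sum, Finset.sum_mul]
  · refine Finset.sum_congr rfl fun a _ => ?_
    rw [ENNReal.toReal_mul, mul_assoc]
  · intro a _
    exact ENNReal.mul_ne_top (p.apply_ne_top a) ((k a).apply_ne_top b)

lemma HasMean.map {α β : Type} {p : PMF α} {h : α → β} (hinj : Function.Injective h) {f : β → ℝ}
    {r : ℝ} (hf : HasMean p (fun a => f (h a)) r) : HasMean (p.map h) f r := by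
  rw [HasMean, ← hinj.hasSum_iff]
  · refine hf.congr_fun fun a => ?_
    simp only [Function.comp]
    congr 2
    rw [PMF.map_apply, tsum_eq_single a]
    · simp
    · intro b hb
      rw [if_neg fun hab => hb (hinj hab).symm]
  · intro b hb
    have : p.map h b = 0 := by
      rw [PMF.map_apply, ENNReal.tsum_eq_zero]
      intro a
      rw [if_neg fun hab => hb ⟨a, hab.symm⟩]
    simp [this]

lemma hasSum_toReal {α : Type} (p : PMF α) : HasSum (fun a => (p a).toReal) 1 := by
  have h := ENNReal.hasSum_toReal p.tsum_coe_ne_top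
  rwa [← ENNReal.tsum_toReal_eq p.apply_ne_top, p.tsum_coe, ENNReal.toReal_one] at h

lemma HasMean.const_add {α : Type} {p : PMF α} {f : α → ℝ} {r : ℝ} (c : ℝ) (h : HasMean p f r) :
    HasMean p (fun a => c + f a) (c + r) := by
  have h1 := ((hasSum_toReal p).mul_right c).add h
  rw [one_mul] at h1
  exact h1.congr_fun fun a => by ring

lemma coin_true_toReal {r : ℝ} (h0 : 0 ≤ r) (h1 : r ≤ 1) : (coin r true).toReal = r := by
  rw [coin, PMF.ofFintype_apply]
  simp [h0, h1]

lemma coin_false_toReal {r : ℝ} (h0 : 0 ≤ r) (h1 : r ≤ 1) : (coin r false).toReal = 1 - r := by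
  rw [coin, PMF.ofFintype_apply]
  simp [h0, h1]

lemma signs_toReal {T : ℕ} (Y : Fin T → Bool) : (signs T Y).toReal = 1 / 2 ^ T := by
  simp [signs]

end Mean

/-! ### Expected regret of MF* -/

section MFRegret

open Finset

variable {T : ℕ}

/-- The conditional expectation, given the signs `Y`, of the number of mistakes of `MF*`. -/
def mfLoss (G : Set (Fin T → ℝ)) (Y : Fin T → Bool) :
    List (Fin T × Bool) → (Fin T → Option Bool) → ℝ
  | [], _ => 0
  | (i, y) :: rest, s =>
      (1 - sgn y * playout G s i Y) / 2 + mfLoss G Y rest (Function.update s i (some y))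

lemma coin_mistake {p : ℝ} (hp : |p| ≤ 1) (y : Bool) (r : ℝ) :
    ∑ c : Bool, (coin ((1 + p) / 2) c).toReal * (zeroOne c y + r) = (1 - sgn y * p) / 2 + r := by
  have h := abs_le.1 hp
  rw [Fintype.sum_bool, coin_true_toReal (by linarith) (by linarith),
    coin_false_toReal (by linarith) (by linarith)]
  cases y <;> simp [zeroOne, sgn] <;> ring

lemma cumLoss_cons {P Y : Type} (l : P → Y → ℝ) (p : P) (ps : List P) (y : Y) (ys : List Y) :
    cumLoss l (p :: ps) (y :: ys) = l p y + cumLoss l ps ys := by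
  simp [cumLoss]

lemma list_cons_injective {α : Type} (a : α) : Function.Injective fun l : List α => a :: l :=
  fun _ _ h => (List.cons.inj h).2

lemma hasMean_mfWith {G : Set (Fin T → ℝ)} (hne : G.Nonempty) (hG : ∀ h ∈ G, ∀ i, |h i| ≤ 1)
    (Y : Fin T → Bool) (rounds : List (Fin T × Bool)) (s : Fin T → Option Bool) :
    HasMean (mfWith G Y rounds s) (fun ps => cumLoss zeroOne ps (rounds.map Prod.snd))
      (mfLoss G Y rounds s) := by
  induction rounds generalizing s with
  | nil => exact hasMean_pure _ _
  | cons r rest ih =>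
    obtain ⟨i, y⟩ := r
    rw [mfWith, mfLoss, ← coin_mistake (abs_playout_le hne hG s i Y)]
    refine HasMean.bind fun c => HasMean.map (list_cons_injective c) ?_
    simp only [List.map_cons, cumLoss_cons]
    exact (ih _).const_add _

lemma sum_signs_toReal_mul (f : (Fin T → Bool) → ℝ) :
    ∑ Y, (signs T Y).toReal * f Y = (∑ Y, f Y) / 2 ^ T := by
  simp only [signs_toReal, ← mul_sum]
  ring

/-- The labelling after a round depends on the revealed outcome but not on the signs drawn. By
linearity, averaging each round over its own signs equals averaging the whole loss over common
signs. -/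
lemma hasMean_mfFreshFrom {G : Set (Fin T → ℝ)} (hne : G.Nonempty)
    (hG : ∀ h ∈ G, ∀ i, |h i| ≤ 1) (rounds : List (Fin T × Bool)) (s : Fin T → Option Bool) :
    HasMean (mfFreshFrom G rounds s) (fun ps => cumLoss zeroOne ps (rounds.map Prod.snd))
      ((∑ Y, mfLoss G Y rounds s) / 2 ^ T) := by
  induction rounds generalizing s with
  | nil =>
    simp only [mfLoss, sum_const_zero, zero_div]
    exact hasMean_pure _ _
  | cons r rest ih =>
    obtain ⟨i, y⟩ := r
    rw [mfFreshFrom]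
    have h1 : (∑ Y, mfLoss G Y ((i, y) :: rest) s) / 2 ^ T =
        ∑ Y, (signs T Y).toReal * ∑ c : Bool, (coin ((1 + playout G s i Y) / 2) c).toReal *
          (zeroOne c y + (∑ Y, mfLoss G Y rest (Function.update s i (some y))) / 2 ^ T) := by
      simp only [fun Y => coin_mistake (abs_playout_le hne hG s i Y), sum_signs_toReal_mul,
        mfLoss, sum_add_distrib]
      rw [add_div, add_div, sum_const, card_univ, Fintype.card_fun, Fintype.card_bool,
        Fintype.card_fin, nsmul_eq_mul]
      push_cast
      congr 1
      field_simp
    rw [h1]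
    refine HasMean.bind fun Y => HasMean.bind fun c => HasMean.map (list_cons_injective c) ?_
    simp only [List.map_cons, cumLoss_cons]
    exact (ih _).const_add _

/-- The expected number of mistakes in terms of the potential. -/
lemma sum_mfLoss (G : Set (Fin T → ℝ)) (rounds : List (Fin T × Bool))
    (hnd : (rounds.map Prod.fst).Nodup) (s : Fin T → Option Bool)
    (hs : ∀ i ∈ rounds.map Prod.fst, s i = none) :
    (∑ Y, mfLoss G Y rounds s) / 2 ^ T =
      (rounds.length + potential G (labelAfter rounds s) - potential G s) / 2 := by
  induction rounds generalizing s with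
  | nil => simp [mfLoss, labelAfter]
  | cons r rest ih =>
    obtain ⟨i, y⟩ := r
    simp only [List.map_cons, List.nodup_cons, List.mem_cons, forall_eq_or_imp] at hnd hs
    have h1 := ih hnd.2 (Function.update s i (some y)) fun j hj => by
      rw [Function.update_of_ne (ne_of_mem_of_not_mem hj hnd.1)]
      exact hs.2 j hj
    -- The mean probability of a mistake in this round is `(1 - sgn y * meanPlayout G s i) / 2`,
    -- half of one plus the increment of the potential.
    rw [potential_update G hs.1] at h1
    simp only [mfLoss, sum_add_distrib, add_div, labelAfter, List.length_cons]
    rw [h1, ← sum_div, sum_sub_distrib, ← mul_sum, meanPlayout, sum_const, card_univ,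
      Fintype.card_fun, Fintype.card_bool, Fintype.card_fin, nsmul_eq_mul]
    push_cast
    field_simp
    ring

lemma abs_signExperts_le {X : Type u} {F : Set (X → Bool)} {v : Fin T → X} :
    ∀ h ∈ signExperts F v, ∀ i, |h i| ≤ 1 := by
  rintro _ ⟨f, -, rfl⟩ i
  exact (abs_sgn _).le

/-- Both sides are `sInf` of the same set of reals, so neither boundedness nor nonemptiness is
needed. -/
lemma iInf_image {ι : Type*} {α : Type*} (F : Set ι) (e : ι → α) (J : α → ℝ) :
    ⨅ f : (e '' F), J f.1 = ⨅ f : F, J (e f.1) := by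
  rw [iInf, iInf]
  congr 1
  ext r
  constructor
  · rintro ⟨⟨_, f, hf, rfl⟩, rfl⟩
    exact ⟨⟨f, hf⟩, rfl⟩
  · rintro ⟨⟨f, hf⟩, rfl⟩
    exact ⟨⟨_, f, hf, rfl⟩, rfl⟩

lemma infLoss_signExperts {X : Type u} (F : Set (X → Bool)) (v : Fin T → X)
    (w : Fin T → Bool) :
    infLoss (signExperts F v) w = 2 * ⨅ f : F, ∑ i, zeroOne (f.1 (v i)) (w i) := by
  rw [infLoss, signExperts,
    iInf_image F _ (fun h : Fin T → ℝ => ∑ i, |h i - sgn (w i)|), Real.mul_iInf_of_nonneg (by norm_num)]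
  congr 1
  funext f
  rw [mul_sum]
  refine sum_congr rfl fun i _ => ?_
  cases f.1 (v i) <;> cases w i <;> norm_num [sgn, zeroOne]

/-- The expected regret of `MF*` is half the Rademacher complexity. -/
lemma hasMean_regret_mfStar {X : Type u} {F : Set (X → Bool)} (hne : F.Nonempty)
    (v : Fin T → X) (π : Equiv.Perm (Fin T)) (y : Fin T → Bool) (reuse : Bool) :
    HasMean (mfStar reuse (signExperts F v) (roundsOf π y))
      (regret zeroOne F (fun t => v (π t)) y) (rademacher (signExperts F v) / 2) := by
  have hGne : (signExperts F v).Nonempty := hne.image _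
  have hG : ∀ h ∈ signExperts F v, ∀ i, |h i| ≤ 1 := abs_signExperts_le
  have hsnd : (roundsOf π y).map Prod.snd = List.ofFn y := by
    simp only [roundsOf, List.map_ofFn]; rfl
  have h1 : HasMean (mfStar reuse (signExperts F v) (roundsOf π y))
      (fun ps => cumLoss zeroOne ps (List.ofFn y))
      ((∑ Y, mfLoss (signExperts F v) Y (roundsOf π y) fun _ => none) / 2 ^ T) := by
    rw [← hsnd, mfStar]
    split_ifs
    · rw [← sum_signs_toReal_mul]
      exact HasMean.bind fun Y => hasMean_mfWith hGne hG Y _ _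
    · exact hasMean_mfFreshFrom hGne hG _ _
  rw [sum_mfLoss _ _ (nodup_roundsOf π y) _ (fun _ _ => rfl), labelAfter_roundsOf, potential_some,
    potential_none hGne hG, infLoss_signExperts] at h1
  have h2 : ∀ f : F, ∑ t, zeroOne (f.1 (v (π t))) (y t) =
      ∑ i, zeroOne (f.1 (v i)) (y (π.symm i)) := fun f => by
    rw [← Equiv.sum_comp π fun i => zeroOne (f.1 (v i)) (y (π.symm i))]; simp
  have h3 := h1.const_add (-⨅ f : F, ∑ t, zeroOne (f.1 (v (π t))) (y t))
  convert h3 using 1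
  · funext ps
    rw [regret]; ring
  · simp only [h2, roundsOf, List.length_ofFn]
    ring

end MFRegret

/-! ### Exponential moments -/

section Concentration

open Finset

/-- Hoeffding's lemma for a finite distribution, with a crude constant. -/
lemma sum_exp_centered_le {α : Type} [Fintype α] {w D : α → ℝ} (hw : ∀ a, 0 ≤ w a)
    (hw1 : ∑ a, w a = 1) (hD : ∀ a, |D a| ≤ 1) (t : ℝ) :
    ∑ a, w a * Real.exp (t * (D a - ∑ c, w c * D c)) ≤ Real.exp (2 * t ^ 2) := by
  set μ := ∑ c, w c * D c with hμ
  -- Symmetrisation: multiplying by this factor, at least one by `1 + x ≤ exp x`, replaces the mean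
  -- `μ` by an independent copy of `D`.
  have h1 : 1 ≤ ∑ c, w c * Real.exp (-(t * (D c - μ))) := by
    have h : ∑ c, w c * (-(t * (D c - μ)) + 1) = 1 := by
      have : ∀ c, w c * (-(t * (D c - μ)) + 1) = -t * (w c * D c) + (t * μ + 1) * w c := fun c => by
        ring
      simp only [this, sum_add_distrib, ← mul_sum, hw1, ← hμ]
      ring
    rw [← h]
    exact sum_le_sum fun c _ => mul_le_mul_of_nonneg_left (Real.add_one_le_exp _) (hw c)
  have hnn : 0 ≤ ∑ a, w a * Real.exp (t * (D a - μ)) :=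
    sum_nonneg fun a _ => mul_nonneg (hw a) (Real.exp_pos _).le
  set S := ∑ a, ∑ c, w a * w c * Real.exp (t * (D a - D c)) with hS
  have h2 : ∑ a, w a * Real.exp (t * (D a - μ)) ≤ S := by
    refine (le_mul_of_one_le_right hnn h1).trans (le_of_eq ?_)
    rw [sum_mul_sum, hS]
    refine sum_congr rfl fun a _ => sum_congr rfl fun c _ => ?_
    have : t * (D a - D c) = t * (D a - μ) + -(t * (D c - μ)) := by ring
    rw [this, Real.exp_add]
    ring
  -- Exchanging the two copies turns the exponential into `cosh (t (D a - D c))`, at most `exp (t² ·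
  -- 4 / 2)` because the copies differ by at most `2`.
  have h3 : 2 * S ≤ 2 * Real.exp (2 * t ^ 2) := by
    have hswap : S = ∑ a, ∑ c, w a * w c * Real.exp (-(t * (D a - D c))) := by
      rw [hS, sum_comm]
      refine sum_congr rfl fun a _ => sum_congr rfl fun c _ => ?_
      have : t * (D c - D a) = -(t * (D a - D c)) := by ring
      rw [this]; ring
    calc 2 * S = S + ∑ a, ∑ c, w a * w c * Real.exp (-(t * (D a - D c))) := by rw [← hswap]; ring
      _ = ∑ a, ∑ c, w a * w c * (2 * Real.cosh (t * (D a - D c))) := by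
        rw [hS, ← sum_add_distrib]
        refine sum_congr rfl fun a _ => ?_
        rw [← sum_add_distrib]
        refine sum_congr rfl fun c _ => ?_
        rw [Real.cosh_eq]; ring
      _ ≤ ∑ a, ∑ c, w a * w c * (2 * Real.exp (2 * t ^ 2)) := by
        refine sum_le_sum fun a _ => sum_le_sum fun c _ => ?_
        refine mul_le_mul_of_nonneg_left ?_ (mul_nonneg (hw a) (hw c))
        refine mul_le_mul_of_nonneg_left ?_ (by norm_num)
        refine (Real.cosh_le_exp_half_sq _).trans (Real.exp_le_exp.2 ?_)
        have ha := abs_le.1 (hD a)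
        have hc := abs_le.1 (hD c)
        have : (D a - D c) ^ 2 ≤ 4 := by nlinarith
        rw [mul_pow]
        nlinarith [sq_nonneg t]
      _ = 2 * Real.exp (2 * t ^ 2) := by
        simp only [← sum_mul, ← mul_sum, hw1]
        ring
  linarith

/-- The deviation of an average of `m` independent draws. -/
lemma sum_exp_abs_average_le {α : Type} [Fintype α] [Nonempty α] {D : α → ℝ} (hD : ∀ a, |D a| ≤ 1)
    {m : ℕ} (hm : 0 < m) (t : ℝ) :
    ∑ Y : Fin m → α, (1 / (Fintype.card (Fin m → α) : ℕ) : ℝ) *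
        Real.exp (t * |1 / m * ∑ j, D (Y j) - (∑ a, D a) / (Fintype.card α : ℕ)|)
      ≤ Real.exp (Real.log 2 / m + 2 * t ^ 2) := by
  have hmpos : (0 : ℝ) < m := by exact_mod_cast hm
  have hN : (0 : ℝ) < Fintype.card α := by exact_mod_cast Fintype.card_pos
  set N : ℝ := ((Fintype.card α : ℕ) : ℝ) with hNdef
  set μ := (∑ a, D a) / N with hμ
  have hcard : ((Fintype.card (Fin m → α) : ℕ) : ℝ) = N ^ m := by
    rw [Fintype.card_fun, Fintype.card_fin, Nat.cast_pow]
  rw [hcard]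
  have hone : ∀ x : ℝ, x ^ 2 = t ^ 2 →
      ∑ Y : Fin m → α, (1 / N ^ m) * Real.exp (x * (m * (1 / m * ∑ j, D (Y j) - μ)))
        ≤ Real.exp (2 * (m * t ^ 2)) := by
    intro x hx
    have h1 : ∀ Y : Fin m → α, (1 / N ^ m) * Real.exp (x * (m * (1 / m * ∑ j, D (Y j) - μ))) =
        ∏ j, (1 / N * Real.exp (x * (D (Y j) - μ))) := by
      intro Y
      rw [prod_mul_distrib, prod_const, card_univ, Fintype.card_fin, ← Real.exp_sum, ← mul_sum,
        sum_sub_distrib, sum_const, card_univ, Fintype.card_fin, nsmul_eq_mul, one_div_pow]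
      congr 3
      field_simp
    have h2 := sum_exp_centered_le (w := fun _ : α => 1 / N) (D := D) (fun _ => by positivity)
      (by rw [sum_const, card_univ, nsmul_eq_mul, ← hNdef]; field_simp) hD x
    have h3 : ∑ c, 1 / N * D c = μ := by rw [← mul_sum, hμ]; ring
    rw [h3] at h2
    simp only [h1]
    have h4 := Fintype.prod_sum fun (_ : Fin m) (a : α) => 1 / N * Real.exp (x * (D a - μ))
    rw [← h4, prod_const, card_univ, Fintype.card_fin]
    refine (pow_le_pow_left₀ (sum_nonneg fun a _ => by positivity) h2 m).trans (le_of_eq ?_)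
    rw [← Real.exp_nat_mul, hx]
    congr 1; ring
  -- The absolute value costs a factor `2`, from `exp |u| ≤ exp u + exp (-u)`.
  have habs : ∑ Y : Fin m → α, (1 / N ^ m) *
      Real.exp (t * |1 / m * ∑ j, D (Y j) - μ|) ^ m ≤ 2 * Real.exp (2 * (m * t ^ 2)) := by
    have := add_le_add (hone t rfl) (hone (-t) (by ring))
    rw [← sum_add_distrib] at this
    refine le_trans (sum_le_sum fun Y _ => ?_) (this.trans (le_of_eq (by ring)))
    rw [← mul_add]
    refine mul_le_mul_of_nonneg_left ?_ (by positivity)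
    rw [← Real.exp_nat_mul]
    set W := 1 / (m : ℝ) * ∑ j, D (Y j) - μ
    rcases abs_cases W with ⟨h, -⟩ | ⟨h, -⟩ <;> rw [h]
    · have : (m : ℝ) * (t * W) = t * (m * W) := by ring
      rw [this]
      linarith [Real.exp_pos (-t * (m * W))]
    · have : (m : ℝ) * (t * -W) = -t * (m * W) := by ring
      rw [this]
      linarith [Real.exp_pos (t * (m * W))]
  -- The estimate was made for the `m`-th power. By convexity of `x ↦ x ^ m` a root can be taken,
  -- which lowers the factor `2` to `2^(1/m)`; this keeps the total over `T` rounds bounded when `m`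
  -- is proportional to `T`.
  refine le_of_pow_le_pow_left₀ hm.ne' (Real.exp_pos _).le ?_
  have hpow := Real.pow_arith_mean_le_arith_mean_pow (univ : Finset (Fin m → α))
    (fun _ => 1 / N ^ m) (fun Y => Real.exp (t * |1 / m * ∑ j, D (Y j) - μ|))
    (fun _ _ => by positivity)
    (by rw [sum_const, card_univ, nsmul_eq_mul, hcard]; field_simp)
    (fun _ _ => (Real.exp_pos _).le) m
  refine hpow.trans (habs.trans (le_of_eq ?_))
  have h5 : (m : ℝ) * (Real.log 2 / m + 2 * t ^ 2) = Real.log 2 + 2 * (m * t ^ 2) := by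
    field_simp
  rw [← Real.exp_nat_mul, h5, Real.exp_add, Real.exp_log (by norm_num)]

end Concentration

/-! ### Tail bound for the `R²` Forecaster against one expert -/

section Tail

open Finset

lemma toOuterMeasure_bind_le {α β : Type} [Fintype α] {p : PMF α} {k : α → PMF β} {s : Set β}
    {u : α → ℝ} (hu : ∀ a, 0 ≤ u a) (h : ∀ a, (k a).toOuterMeasure s ≤ ENNReal.ofReal (u a)) :
    (p.bind k).toOuterMeasure s ≤ ENNReal.ofReal (∑ a, (p a).toReal * u a) := by
  rw [PMF.toOuterMeasure_bind_apply, tsum_fintype,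
    ENNReal.ofReal_sum_of_nonneg fun a _ => mul_nonneg ENNReal.toReal_nonneg (hu a)]
  refine sum_le_sum fun a _ => ?_
  rw [ENNReal.ofReal_mul ENNReal.toReal_nonneg, ENNReal.ofReal_toReal (p.apply_ne_top a)]
  gcongr
  exact h a

lemma toOuterMeasure_le_one {α : Type} (p : PMF α) (s : Set α) : p.toOuterMeasure s ≤ 1 := by
  have h : p.toOuterMeasure Set.univ = 1 := (p.toOuterMeasure_apply_eq_one_iff _).2 (Set.subset_univ _)
  exact h ▸ p.toOuterMeasure.mono (Set.subset_univ s)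

lemma le_toOuterMeasure_of_compl {α : Type} {p : PMF α} {s t : Set α} {δ : ℝ} (hδ : 0 ≤ δ)
    (hst : ∀ a, a ∉ s → a ∈ t) (h : p.toOuterMeasure t ≤ ENNReal.ofReal δ) :
    ENNReal.ofReal (1 - δ) ≤ p.toOuterMeasure s := by
  have h1 : p.toOuterMeasure Set.univ = 1 := (p.toOuterMeasure_apply_eq_one_iff _).2 (Set.subset_univ _)
  have h2 : (1 : ENNReal) ≤ p.toOuterMeasure s + p.toOuterMeasure t := by
    rw [← h1]
    refine (p.toOuterMeasure.mono fun a _ => ?_).trans (MeasureTheory.measure_union_le s t)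
    by_cases ha : a ∈ s
    · exact Or.inl ha
    · exact Or.inr (hst a ha)
  rw [ENNReal.ofReal_sub _ hδ, ENNReal.ofReal_one]
  exact tsub_le_iff_right.2 (h2.trans (by gcongr))

variable {T : ℕ}

/-- The potential of the `R²` Forecaster relative to the expert `h`. -/
def excessPotential (G : Set (Fin T → ℝ)) (h : Fin T → ℝ) (s : Fin T → Option Bool) : ℝ :=
  T - (∑ i, (s i).elim 0 fun c => sgn c * h i) - potential G s

lemma excessPotential_update (G : Set (Fin T → ℝ)) (h : Fin T → ℝ) {s : Fin T → Option Bool}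
    {i : Fin T} (hi : s i = none) (c : Bool) :
    excessPotential G h (Function.update s i (some c)) =
      excessPotential G h s + sgn c * (meanPlayout G s i - h i) := by
  have h1 : ∑ j, ((Function.update s i (some c)) j).elim 0 (fun c => sgn c * h j) =
      (∑ j, (s j).elim 0 fun c => sgn c * h j) + sgn c * h i := by
    rw [← sum_erase_add _ _ (mem_univ i), ← sum_erase_add _ (fun j => (s j).elim 0 _) (mem_univ i)]
    rw [Function.update_self, hi]
    simp only [Option.elim, add_zero]
    congr 1
    refine sum_congr rfl fun x hx => ?_
    rw [Function.update_of_ne (ne_of_mem_erase hx)]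
  rw [excessPotential, h1, potential_update G hi, excessPotential]
  ring

/-- On a complete labelling this is the absolute loss of `h` minus the least loss over `G`. -/
lemma excessPotential_nonneg {G : Set (Fin T → ℝ)} (hG : ∀ h ∈ G, ∀ i, |h i| ≤ 1)
    {h : Fin T → ℝ} (hh : h ∈ G) {s : Fin T → Option Bool} (hs : ∀ i, s i ≠ none) :
    0 ≤ excessPotential G h s := by
  choose w hw using fun i => Option.ne_none_iff_exists'.1 (hs i)
  obtain rfl : s = fun i => some (w i) := funext hw
  rw [excessPotential, potential_some]
  have h1 := infLoss_le hh w
  rw [sum_abs_sub_sgn (hG h hh)] at h1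
  simp only [Option.elim]
  linarith

lemma coin_toReal_sum {r : ℝ} : ∑ c : Bool, (coin r c).toReal = 1 := by
  rw [← hasSum_fintype _ |>.unique (hasSum_toReal (coin r))]

/-- Tail bound for the loss of the `R²` Forecaster in excess of the loss of the expert `h`. -/
lemma r2From_tail {G : Set (Fin T → ℝ)} (hG : ∀ h ∈ G, ∀ i, |h i| ≤ 1) {h : Fin T → ℝ}
    (hh : h ∈ G) {m : ℕ} (hm : 0 < m) {b ρ : ℝ} (hb : 0 < b) (hρ : 0 < ρ) {l g : ℝ → ℝ → ℝ}
    (hg : IsSubgradient l g b ρ) {t : ℝ} (ht : 0 ≤ t) (rounds : List (Fin T × ℝ))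
    (hnd : (rounds.map Prod.fst).Nodup) (hy : ∀ r ∈ rounds, r.2 ∈ Set.Icc (-b) b)
    (s : Fin T → Option Bool) (hs : ∀ i, s i = none ↔ i ∈ rounds.map Prod.fst) (θ : ℝ) :
    (r2From m b ρ g G rounds s).toOuterMeasure
        {ps | ρ * b * θ < cumLoss l ps (rounds.map Prod.snd) -
          (rounds.map fun r => l (b * h r.1) r.2).sum} ≤
      ENNReal.ofReal (Real.exp (rounds.length * (Real.log 2 / m + 10 * t ^ 2) +
        t * (excessPotential G h s - θ))) := by
  induction rounds generalizing s θ with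
  | nil =>
    -- No rounds remain and the excess loss is `0`: for `θ < 0` the claimed bound is at least one,
    -- otherwise the event is empty.
    by_cases hθ : θ < 0
    · refine (toOuterMeasure_le_one _ _).trans ?_
      rw [ENNReal.one_le_ofReal, Real.one_le_exp_iff]
      have := excessPotential_nonneg hG hh (s := s) fun i hi => by
        simpa using (hs i).1 hi
      simp only [List.length_nil, Nat.cast_zero, zero_mul, zero_add]
      exact mul_nonneg ht (by linarith)
    · have : {ps : List ℝ | ρ * b * θ < cumLoss l ps (([] : List (Fin T × ℝ)).map Prod.snd) -
          (([] : List (Fin T × ℝ)).map fun r => l (b * h r.1) r.2).sum} = ∅ := by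
        ext ps
        simp only [cumLoss, List.map_nil, List.zipWith_nil_right, List.sum_nil, sub_zero,
          Set.mem_ofPred_eq, Set.mem_empty_iff_false, iff_false, not_lt]
        have : 0 ≤ θ := not_lt.1 hθ
        positivity
      rw [this]
      simp
  | cons r rest ih =>
    obtain ⟨i, y⟩ := r
    have hne : G.Nonempty := ⟨h, hh⟩
    simp only [List.map_cons, List.nodup_cons] at hnd
    have hi : s i = none := (hs i).2 (by simp)
    have hyi : y ∈ Set.Icc (-b) b := hy (i, y) (by simp)
    have hhi := abs_le.1 (hG h hh i)
    have hmpos : (0 : ℝ) < m := by exact_mod_cast hm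
    have hs' : ∀ z j, Function.update s i (some z) j = none ↔ j ∈ rest.map Prod.fst := by
      intro z j
      by_cases hj : j = i
      · subst hj
        simp [hnd.1]
      · rw [Function.update_of_ne hj, hs j, List.map_cons, List.mem_cons]
        simp [hj]
    set n : ℝ := ((rest.length : ℕ) : ℝ) with hn
    set c := Real.log 2 / m + 10 * t ^ 2 with hc
    set Ψ := excessPotential G h s with hΨ
    set Δ := meanPlayout G s i with hΔ
    rw [r2From]
    set q : (Fin m → Fin T → Bool) → ℝ := fun Y => 1 / m * ∑ j, playout G s i (Y j) with hq
    have hpq : ∀ Y : Fin m → Fin T → Bool, b / m * ∑ j, playout G s i (Y j) = b * q Y := by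
      intro Y; rw [hq]; ring
    have hq1 : ∀ Y, |q Y| ≤ 1 := by
      intro Y
      rw [hq, abs_mul, abs_of_pos (by positivity : 0 < 1 / (m : ℝ))]
      have h1 : |∑ j, playout G s i (Y j)| ≤ m := by
        refine (abs_sum_le_sum_abs _ _).trans ?_
        refine (sum_le_sum fun j _ => abs_playout_le hne hG s i (Y j)).trans ?_
        simp
      calc 1 / (m : ℝ) * |∑ j, playout G s i (Y j)| ≤ 1 / m * m := by gcongr
        _ = 1 := by field_simp
    simp only [hpq]
    have hbi : b * h i ∈ Set.Icc (-b) b := ⟨by nlinarith, by nlinarith⟩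
    have hbq : ∀ Y, b * q Y ∈ Set.Icc (-b) b := fun Y => by
      have := abs_le.1 (hq1 Y)
      exact ⟨by nlinarith, by nlinarith⟩
    have hgq : ∀ Y, |g (b * q Y) y / ρ| ≤ 1 := fun Y => by
      rw [abs_div, abs_of_pos hρ, div_le_one hρ]
      exact (hg _ (hbq Y) _ hyi).1
    -- The linearised loss of the round, `ρ b (g/ρ)(q - h i)`, is charged to the threshold `θ`. With
    -- the change `sgn z (Δ - h i)` of the excess potential, `Ψ - θ` changes by `(q - h i)(sgn z +
    -- g/ρ) + sgn z (Δ - q)`: a term centred in `z` and one of size at most `|q - Δ|`.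
    have hstep : ∀ Y z, (PMF.map (fun ps => b * q Y :: ps)
          (r2From m b ρ g G rest (Function.update s i (some z)))).toOuterMeasure
          {ps | ρ * b * θ < cumLoss l ps (((i, y) :: rest).map Prod.snd) -
            (((i, y) :: rest).map fun r => l (b * h r.1) r.2).sum} ≤
        ENNReal.ofReal (Real.exp (n * c + t * (Ψ - θ) + t * |q Y - Δ|) *
          Real.exp (t * (q Y - h i) * (sgn z - -(g (b * q Y) y / ρ)))) := by
      intro Y z
      rw [PMF.toOuterMeasure_map_apply, ← Real.exp_add]
      have h1 := ih hnd.2 (fun r hr => hy r (List.mem_cons_of_mem _ hr)) _ (hs' z)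
        (θ - g (b * q Y) y / ρ * (q Y - h i))
      refine (MeasureTheory.OuterMeasure.mono _ ?_).trans (h1.trans ?_)
      · intro ps hps
        simp only [List.map_cons, List.sum_cons, cumLoss_cons, Set.mem_preimage,
          Set.mem_ofPred_eq] at hps ⊢
        have h2 := (hg _ (hbq Y) _ hyi).2 _ hbi
        have h3 : ρ * b * (θ - g (b * q Y) y / ρ * (q Y - h i)) =
            ρ * b * θ + g (b * q Y) y * (b * h i - b * q Y) := by
          field_simp
          ring
        rw [h3]
        linarith
      · refine ENNReal.ofReal_le_ofReal (Real.exp_le_exp.2 ?_)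
        rw [excessPotential_update G h hi]
        have h4 : sgn z * (Δ - q Y) ≤ |q Y - Δ| := by
          refine (le_abs_self _).trans ?_
          rw [abs_mul, abs_sgn, one_mul, abs_sub_comm]
        have h5 := mul_le_mul_of_nonneg_left h4 ht
        rw [← hΨ, ← hΔ]
        linarith
    -- Averaging over `z`: Hoeffding's lemma with parameter `t (q - h i)` and `|q - h i| ≤ 2` gives
    -- `8 t²`.
    have hinner : ∀ Y, ((coin ((1 - g (b * q Y) y / ρ) / 2)).bind fun z =>
          PMF.map (fun ps => b * q Y :: ps)
            (r2From m b ρ g G rest (Function.update s i (some z)))).toOuterMeasure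
          {ps | ρ * b * θ < cumLoss l ps (((i, y) :: rest).map Prod.snd) -
            (((i, y) :: rest).map fun r => l (b * h r.1) r.2).sum} ≤
        ENNReal.ofReal (Real.exp (n * c + t * (Ψ - θ) + 8 * t ^ 2) * Real.exp (t * |q Y - Δ|)) := by
      intro Y
      refine (toOuterMeasure_bind_le (fun z => by positivity) (hstep Y)).trans
        (ENNReal.ofReal_le_ofReal ?_)
      have hgY := abs_le.1 (hgq Y)
      have hmean : ∑ z, (coin ((1 - g (b * q Y) y / ρ) / 2) z).toReal * sgn z =
          -(g (b * q Y) y / ρ) := by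
        rw [Fintype.sum_bool, coin_true_toReal (by linarith) (by linarith),
          coin_false_toReal (by linarith) (by linarith)]
        simp only [sgn, if_true, Bool.false_eq_true, if_false]
        ring
      have h6 := sum_exp_centered_le (w := fun z => (coin ((1 - g (b * q Y) y / ρ) / 2) z).toReal)
        (D := sgn) (fun _ => ENNReal.toReal_nonneg) coin_toReal_sum (fun z => (abs_sgn z).le)
        (t * (q Y - h i))
      rw [hmean] at h6
      have h7 : ∑ z, (coin ((1 - g (b * q Y) y / ρ) / 2) z).toReal *
          (Real.exp (n * c + t * (Ψ - θ) + t * |q Y - Δ|) *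
            Real.exp (t * (q Y - h i) * (sgn z - -(g (b * q Y) y / ρ)))) =
          Real.exp (n * c + t * (Ψ - θ) + t * |q Y - Δ|) *
          ∑ z, (coin ((1 - g (b * q Y) y / ρ) / 2) z).toReal *
            Real.exp (t * (q Y - h i) * (sgn z - -(g (b * q Y) y / ρ))) := by
        rw [mul_sum]
        exact sum_congr rfl fun z _ => by ring
      rw [h7]
      refine (mul_le_mul_of_nonneg_left h6 (Real.exp_pos _).le).trans ?_
      rw [← Real.exp_add, ← Real.exp_add]
      refine Real.exp_le_exp.2 ?_
      have hqY := abs_le.1 (hq1 Y)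
      have h8 : (q Y - h i) ^ 2 ≤ 4 := by nlinarith
      have h9 : t ^ 2 * (q Y - h i) ^ 2 ≤ t ^ 2 * 4 := by gcongr
      rw [mul_pow]
      linarith
    refine (toOuterMeasure_bind_le (fun Y => by positivity) hinner).trans
      (ENNReal.ofReal_le_ofReal ?_)
    -- Averaging over the playouts adds `log 2 / m + 2 t²`, which completes the `10 t²` per round.
    have h10 := sum_exp_abs_average_le (D := playout G s i) (abs_playout_le hne hG s i) hm t
    have h11 : (∑ Y, playout G s i Y) / (Fintype.card (Fin T → Bool) : ℕ) = Δ := by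
      rw [hΔ, meanPlayout, Fintype.card_fun, Fintype.card_bool, Fintype.card_fin]
      push_cast
      rfl
    rw [h11] at h10
    have h12 : ∀ Y : Fin m → Fin T → Bool,
        ((PMF.uniformOfFintype (Fin m → Fin T → Bool)) Y).toReal =
          1 / (Fintype.card (Fin m → Fin T → Bool) : ℕ) := by
      intro Y
      rw [PMF.uniformOfFintype_apply, ENNReal.toReal_inv, ENNReal.toReal_natCast, one_div]
    calc _ = Real.exp (n * c + t * (Ψ - θ) + 8 * t ^ 2) *
          ∑ Y : Fin m → Fin T → Bool, (1 / (Fintype.card (Fin m → Fin T → Bool) : ℕ) : ℝ) *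
            Real.exp (t * |q Y - Δ|) := by
          rw [mul_sum]
          refine sum_congr rfl fun Y _ => ?_
          rw [h12]; ring
      _ ≤ Real.exp (n * c + t * (Ψ - θ) + 8 * t ^ 2) *
          Real.exp (Real.log 2 / m + 2 * t ^ 2) :=
        mul_le_mul_of_nonneg_left h10 (Real.exp_pos _).le
      _ = _ := by
        rw [← Real.exp_add]
        congr 1
        rw [List.length_cons, Nat.cast_succ, ← hn, hc]
        ring

end Tail

/-! ### Regret of the `R²` Forecaster -/

section R2Regret

open Finset

variable {T : ℕ}

lemma abs_experts_le {X : Type u} {F : Set (X → ℝ)} {b : ℝ} (hb : 0 < b)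
    (hF : ∀ f ∈ F, ∀ x, f x ∈ Set.Icc (-b) b) (v : Fin T → X) :
    ∀ h ∈ experts (1 / b) F v, ∀ i, |h i| ≤ 1 := by
  rintro _ ⟨f, hf, rfl⟩ i
  have := hF f hf (v i)
  rw [one_div, abs_mul, abs_inv, abs_of_pos hb, inv_mul_le_one₀ hb, abs_le]
  exact this

lemma rademacher_experts {X : Type u} {F : Set (X → ℝ)} {b : ℝ} (hb : 0 < b) (v : Fin T → X) :
    rademacher (experts 1 F v) = b * rademacher (experts (1 / b) F v) := by
  have hsup : ∀ (J : (Fin T → ℝ) → ℝ) (c : ℝ),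
      ⨆ f : experts c F v, J f.1 = ⨆ f : F, J fun i => c * f.1 (v i) := by
    intro J c
    rw [iSup, iSup]
    congr 1
    ext r
    constructor
    · rintro ⟨⟨_, f, hf, rfl⟩, rfl⟩
      exact ⟨⟨f, hf⟩, rfl⟩
    · rintro ⟨⟨f, hf⟩, rfl⟩
      exact ⟨⟨_, f, hf, rfl⟩, rfl⟩
  rw [rademacher, rademacher, ← mul_div_assoc, mul_sum]
  congr 1
  refine sum_congr rfl fun σ _ => ?_
  rw [hsup (fun h => ∑ i, sgn (σ i) * h i), hsup (fun h => ∑ i, sgn (σ i) * h i),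
    Real.mul_iSup_of_nonneg hb.le]
  congr 1
  funext f
  rw [mul_sum]
  refine sum_congr rfl fun i _ => ?_
  field_simp

lemma labels_none_iff {Y : Type} (π : Equiv.Perm (Fin T)) (y : Fin T → Y) (i : Fin T) :
    (none : Option Bool) = none ↔ i ∈ (roundsOf π y).map Prod.fst := by
  rw [roundsOf_fst, List.mem_ofFn]
  simp only [true_iff]
  exact ⟨π.symm i, by simp⟩

/-- Tail bound for the regret of the `R²` Forecaster. -/
lemma r2_regret_tail {X : Type u} {F : Set (X → ℝ)} (hne : F.Nonempty) {b ρ : ℝ} (hb : 0 < b)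
    (hρ : 0 < ρ) (hF : ∀ f ∈ F, ∀ x, f x ∈ Set.Icc (-b) b) {l g : ℝ → ℝ → ℝ}
    (hg : IsSubgradient l g b ρ) {m : ℕ} (hm : 0 < m) {t : ℝ} (ht : 0 ≤ t) (v : Fin T → X)
    (π : Equiv.Perm (Fin T)) {y : Fin T → ℝ} (hy : ∀ t, y t ∈ Set.Icc (-b) b) {a : ℝ}
    (ha : 0 < a) :
    (r2 m b ρ g (experts (1 / b) F v) (roundsOf π y)).toOuterMeasure
        {ps | ρ * rademacher (experts 1 F v) + 2 * (ρ * b * a) <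
          regret l F (fun t => v (π t)) y ps} ≤
      ENNReal.ofReal (Real.exp (T * (Real.log 2 / m + 10 * t ^ 2) - t * a)) := by
  have hG := abs_experts_le hb hF v
  have : Nonempty F := hne.to_subtype
  -- The infimum need not be attained; a comparator within `ρ b a` of it accounts for the factor
  -- `2`. It depends only on the fixed outcomes, so no union bound over the class is needed.
  obtain ⟨f, hf⟩ := exists_lt_of_ciInf_lt
    (lt_add_of_pos_right (⨅ f : F, ∑ t, l (f.1 (v (π t))) (y t)) (by positivity : 0 < ρ * b * a))
  set h : Fin T → ℝ := fun i => 1 / b * f.1 (v i) with hh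
  have hmem : h ∈ experts (1 / b) F v := ⟨f.1, f.2, rfl⟩
  have hbh : ∀ i, b * h i = f.1 (v i) := fun i => by rw [hh]; field_simp
  have htail := r2From_tail hG hmem hm hb hρ hg ht (roundsOf π y) (nodup_roundsOf π y)
    (fun r hr => by
      obtain ⟨j, rfl⟩ := List.mem_ofFn.1 hr
      exact hy j) (fun _ => none) (fun i => labels_none_iff π y i)
    (rademacher (experts (1 / b) F v) + a)
  have hpot : excessPotential (experts (1 / b) F v) h (fun _ => none) =
      rademacher (experts (1 / b) F v) := by
    rw [excessPotential, potential_none ⟨h, hmem⟩ hG]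
    simp
  have hlen : (roundsOf π y).length = T := by simp [roundsOf]
  rw [hpot, hlen] at htail
  refine (MeasureTheory.OuterMeasure.mono _ ?_).trans (htail.trans (le_of_eq ?_))
  · intro ps hps
    have hsnd : (roundsOf π y).map Prod.snd = List.ofFn y := by
      simp only [roundsOf, List.map_ofFn]; rfl
    have hsum : ((roundsOf π y).map fun r => l (b * h r.1) r.2).sum =
        ∑ t, l (f.1 (v (π t))) (y t) := by
      simp only [hbh, roundsOf, List.map_ofFn, List.sum_ofFn, Function.comp]
    simp only [Set.mem_ofPred_eq, hsnd, hsum, regret, rademacher_experts hb v] at hps ⊢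
    linarith
  · congr 2
    ring

/-- With a single round the `R²` Forecaster predicts the midrange of the class. -/
lemma playout_one {G : Set (Fin 1 → ℝ)} (hne : G.Nonempty) (hG : ∀ h ∈ G, ∀ i, |h i| ≤ 1)
    (s : Fin 1 → Option Bool) (i : Fin 1) (Y : Fin 1 → Bool) {h : Fin 1 → ℝ} (hh : h ∈ G) :
    |playout G s i Y - h i| ≤ rademacher G := by
  have hup : ∀ c, Function.update (fill s Y) i c = fun _ => c := fun c => by
    funext j; rw [Subsingleton.elim j i, Function.update_self]
  obtain rfl : i = 0 := Subsingleton.elim _ _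
  have hinf : ∀ c : Bool, infLoss G (fun _ => c) ≤ |h 0 - sgn c| := fun c => by
    simpa using infLoss_le hh fun _ => c
  -- The two least losses are `1 - sup` and `1 + inf` of the class: the playout is the midrange, and
  -- the Rademacher complexity is half the spread.
  have hrad : rademacher G = 1 - (infLoss G (fun _ => true) + infLoss G (fun _ => false)) / 2 := by
    have h1 := potential_none hne hG
    have h2 : potential G (fun _ => none) =
        (infLoss G (fun _ => true) + infLoss G (fun _ => false)) / 2 := by
      have h3 : ∀ Y : Fin 1 → Bool, fill (fun _ => none) Y = Y := fun Y => rfl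
      simp only [potential, h3]
      rw [← Equiv.sum_comp (Equiv.funUnique (Fin 1) Bool).symm, Fintype.sum_bool]
      norm_num
      rfl
    rw [h2] at h1
    push_cast at h1
    linarith
  have h4 := hinf true
  have h5 := hinf false
  have h6 := abs_le.1 (hG h hh 0)
  simp only [sgn, if_true, Bool.false_eq_true, if_false] at h4 h5
  rw [abs_of_nonpos (by linarith)] at h4
  rw [abs_of_nonneg (by linarith)] at h5
  rw [playout, hup, hup, hrad, abs_le]
  constructor <;> linarith

/-- For `T = 1` the term `log (T / δ)` tends to `0` as `δ` tends to `1`, so it cannot absorb any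
constant. Here the regret bound holds surely: every playout is the midrange, within `rademacher` of
each scaled expert, and the loss is Lipschitz. -/
lemma r2_regret_one {X : Type u} {F : Set (X → ℝ)} (hne : F.Nonempty) {b ρ : ℝ} (hb : 0 < b)
    (hρ : 0 < ρ) (hF : ∀ f ∈ F, ∀ x, f x ∈ Set.Icc (-b) b) {l g : ℝ → ℝ → ℝ}
    (hl : ∀ y ∈ Set.Icc (-b) b, ∀ p ∈ Set.Icc (-b) b, ∀ q ∈ Set.Icc (-b) b,
      |l p y - l q y| ≤ ρ * |p - q|) {m : ℕ} (hm : 0 < m) (v : Fin 1 → X)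
    (π : Equiv.Perm (Fin 1)) {y : Fin 1 → ℝ} (hy : ∀ t, y t ∈ Set.Icc (-b) b) :
    ∀ ps ∈ (r2 m b ρ g (experts (1 / b) F v) (roundsOf π y)).support,
      regret l F (fun t => v (π t)) y ps ≤ ρ * rademacher (experts 1 F v) := by
  intro ps hps
  have hG := abs_experts_le hb hF v
  have hGne : (experts (1 / b) F v).Nonempty := hne.image _
  have hmpos : (0 : ℝ) < m := by exact_mod_cast hm
  have hr : roundsOf π y = [(π 0, y 0)] := by simp [roundsOf]
  rw [r2, hr, r2From] at hps
  simp only [PMF.mem_support_bind_iff, PMF.mem_support_map_iff, r2From, PMF.mem_support_pure_iff] at hps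
  obtain ⟨Y, -, z, -, _, rfl, rfl⟩ := hps
  set q := 1 / (m : ℝ) * ∑ j, playout (experts (1 / b) F v) (fun _ => none) (π 0) (Y j) with hq
  have hpq : b / m * ∑ j, playout (experts (1 / b) F v) (fun _ => none) (π 0) (Y j) = b * q := by
    rw [hq]; ring
  have havg : ∀ (x r : ℝ), (∀ j, |playout (experts (1 / b) F v) (fun _ => none) (π 0) (Y j) - x| ≤ r) →
      |q - x| ≤ r := by
    intro x r hx
    have h1 : q - x =
        1 / m * ∑ j, (playout (experts (1 / b) F v) (fun _ => none) (π 0) (Y j) - x) := by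
      rw [sum_sub_distrib, sum_const, card_univ, Fintype.card_fin, nsmul_eq_mul, hq]
      field_simp
    rw [h1, abs_mul, abs_of_pos (by positivity : 0 < 1 / (m : ℝ))]
    have h2 := (abs_sum_le_sum_abs _ _).trans (sum_le_sum fun j (_ : j ∈ univ) => hx j)
    rw [sum_const, card_univ, Fintype.card_fin, nsmul_eq_mul] at h2
    calc _ ≤ 1 / (m : ℝ) * (m * r) := by gcongr
      _ = r := by field_simp
  have hq1 : |q| ≤ 1 := by
    simpa using havg 0 1 fun j => by simpa using abs_playout_le hGne hG _ _ (Y j)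
  have hq1' := abs_le.1 hq1
  have : Nonempty F := hne.to_subtype
  have key : ∀ f : F, l (b * q) (y 0) - ρ * (b * rademacher (experts (1 / b) F v)) ≤
      ∑ t, l (f.1 (v (π t))) (y t) := by
    intro f
    have h1 := havg (1 / b * f.1 (v (π 0))) _ fun j =>
      playout_one hGne hG (fun _ => none) (π 0) (Y j)
        (h := fun i => 1 / b * f.1 (v i)) ⟨f.1, f.2, rfl⟩
    have h2 := (le_abs_self _).trans
      (hl _ (hy 0) (b * q) ⟨by nlinarith, by nlinarith⟩ _ (hF f.1 f.2 (v (π 0))))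
    have h3 : b * q - f.1 (v (π 0)) = b * (q - 1 / b * f.1 (v (π 0))) := by field_simp
    rw [h3, abs_mul, abs_of_pos hb] at h2
    have h4 : ρ * (b * |q - 1 / b * f.1 (v (π 0))|) ≤
        ρ * (b * rademacher (experts (1 / b) F v)) := by gcongr
    simp only [univ_unique, Fin.default_eq_zero, Fin.isValue, sum_singleton]
    linarith
  have h5 := le_ciInf key
  rw [regret, rademacher_experts hb v, hpq]
  have h6 : cumLoss l [b * q] (List.ofFn y) = l (b * q) (y 0) := by simp [cumLoss]
  rw [h6]
  linarith

/-- The regret of the `R²` Forecaster with high probability. -/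
lemma r2_regret {η : ℝ} (hη : 0 < η) {X : Type u} {F : Set (X → ℝ)} (hne : F.Nonempty) {b ρ : ℝ}
    (hb : 0 < b) (hρ : 0 < ρ) (hF : ∀ f ∈ F, ∀ x, f x ∈ Set.Icc (-b) b) {l g : ℝ → ℝ → ℝ}
    (hl : ∀ y ∈ Set.Icc (-b) b, ∀ p ∈ Set.Icc (-b) b, ∀ q ∈ Set.Icc (-b) b,
      |l p y - l q y| ≤ ρ * |p - q|)
    (hg : IsSubgradient l g b ρ) (hT : 1 ≤ T) (v : Fin T → X)
    (π : Equiv.Perm (Fin T)) {y : Fin T → ℝ} (hy : ∀ t, y t ∈ Set.Icc (-b) b) {δ : ℝ}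
    (hδ : 0 < δ) (hδ1 : δ < 1) :
    ENNReal.ofReal (1 - δ) ≤
      (r2 ⌈η * T⌉₊ b ρ g (experts (1 / b) F v) (roundsOf π y)).toOuterMeasure
        {ps | regret l F (fun t => v (π t)) y ps ≤ ρ * rademacher (experts 1 F v) +
          2 * (11 + 1 / η) * (ρ * b * Real.sqrt (T * Real.log (T / δ)))} := by
  have hTpos : (0 : ℝ) < T := by exact_mod_cast hT
  have hm : 0 < ⌈η * T⌉₊ := Nat.ceil_pos.2 (by positivity)
  have hmge : η * T ≤ ⌈η * T⌉₊ := Nat.le_ceil _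
  set m := ⌈η * T⌉₊
  have hmpos : (0 : ℝ) < m := by exact_mod_cast hm
  set C := 11 + 1 / η with hC
  have hCpos : 0 < C := by positivity
  -- From `T ≥ 2` follows `log 2 ≤ L`, which pays for the playout cost `log 2 / η`.
  rcases Nat.lt_or_ge 1 T with hT2 | hT1
  · have hT2' : (2 : ℝ) ≤ T := by exact_mod_cast hT2
    set L := Real.log (T / δ) with hL
    have hL1 : Real.log 2 ≤ L := by
      refine Real.log_le_log (by norm_num) ?_
      rw [le_div_iff₀ hδ]
      nlinarith
    have hL2 : -Real.log δ ≤ L := by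
      rw [hL, Real.log_div hTpos.ne' hδ.ne']
      have := Real.log_nonneg (by linarith : (1 : ℝ) ≤ T)
      linarith
    have hLpos : 0 < L := (Real.log_pos (by norm_num)).trans_le hL1
    set S := Real.sqrt (T * L) with hS
    have hSpos : 0 < S := Real.sqrt_pos.2 (by positivity)
    have hS2 : S ^ 2 = T * L := Real.sq_sqrt (by positivity)
    -- With `t = L / S` one has `T t² = L` and `t a = C L`. The exponent is at most `L / η + 10 L -
    -- (11 + 1 / η) L = -L ≤ log δ`.
    have htail := r2_regret_tail hne hb hρ hF hg hm (t := L / S) (by positivity) v π hy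
      (a := C * S) (by positivity)
    refine le_toOuterMeasure_of_compl hδ.le (fun ps hps => ?_)
      (htail.trans (ENNReal.ofReal_le_ofReal ?_))
    · simp only [Set.mem_ofPred_eq, not_le] at hps ⊢
      linarith
    · have h1 : L / S * (C * S) = C * L := by field_simp
      have h2 : T * (L / S) ^ 2 = L := by
        rw [div_pow, hS2]; field_simp
      have h3 : T * (Real.log 2 / m) ≤ 1 / η * L := by
        have h4 : T / (m : ℝ) ≤ 1 / η := by
          rw [div_le_div_iff₀ hmpos hη]; linarith
        calc T * (Real.log 2 / m) = T / m * Real.log 2 := by ring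
          _ ≤ 1 / η * L := mul_le_mul h4 hL1 (Real.log_nonneg (by norm_num)) (by positivity)
      calc _ ≤ Real.exp (Real.log δ) := by
            refine Real.exp_le_exp.2 ?_
            rw [h1, mul_add, hC]
            linarith
        _ = δ := Real.exp_log hδ
  · obtain rfl : T = 1 := le_antisymm hT1 hT
    have h1 : (r2 m b ρ g (experts (1 / b) F v) (roundsOf π y)).toOuterMeasure
        {ps | regret l F (fun t => v (π t)) y ps ≤ ρ * rademacher (experts 1 F v) +
          2 * C * (ρ * b * Real.sqrt ((1 : ℕ) * Real.log ((1 : ℕ) / δ)))} = 1 := by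
      rw [PMF.toOuterMeasure_apply_eq_one_iff]
      intro ps hps
      refine (r2_regret_one hne hb hρ hF hl hm v π hy ps hps).trans ?_
      have : 0 ≤ 2 * C * (ρ * b * Real.sqrt ((1 : ℕ) * Real.log ((1 : ℕ) / δ))) := by positivity
      linarith
    rw [h1, ENNReal.ofReal_le_one]
    linarith

end R2Regret

/-! ### Couplings and a program logic with time bounds -/

section Simulation

/-- The distributions `p` and `μ` have a coupling supported on `R`. -/
def Sim {α β : Type} (p : PMF β) (μ : PMF α) (R : α → β → Prop) : Prop :=
  ∃ κ : PMF (α × β), κ.map Prod.fst = μ ∧ κ.map Prod.snd = p ∧ ∀ x ∈ κ.support, R x.1 x.2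

lemma Sim.pure {α β : Type} {R : α → β → Prop} {a : α} {b : β} (h : R a b) :
    Sim (PMF.pure b) (PMF.pure a) R :=
  ⟨PMF.pure (a, b), PMF.pure_map _ _, PMF.pure_map _ _, fun x hx => by
    rw [PMF.mem_support_pure_iff] at hx; subst hx; exact h⟩

lemma Sim.mono {α β : Type} {p : PMF β} {μ : PMF α} {R R' : α → β → Prop} (h : Sim p μ R)
    (hR : ∀ a b, R a b → R' a b) : Sim p μ R' := by
  obtain ⟨κ, h1, h2, h3⟩ := h
  exact ⟨κ, h1, h2, fun x hx => hR _ _ (h3 x hx)⟩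

lemma Sim.trivial {α β : Type} (p : PMF β) (μ : PMF α) : Sim p μ fun _ _ => True := by
  refine ⟨μ.bind fun a => p.map fun b => (a, b), ?_, ?_, fun _ _ => True.intro⟩
  · simp only [PMF.map_bind, PMF.map_comp]
    have : ∀ a : α, (Prod.fst ∘ fun b : β => (a, b)) = Function.const β a := fun a => rfl
    simp only [this, PMF.map_const, PMF.bind_pure]
  · simp only [PMF.map_bind, PMF.map_comp]
    have : ∀ a : α, (Prod.snd ∘ fun b : β => (a, b)) = id := fun a => rfl
    simp only [this, PMF.map_id, PMF.bind_const]

lemma Sim.bind {α β α' β' : Type} {p : PMF β} {μ : PMF α} {R : α → β → Prop} {k : β → PMF β'}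
    {k' : α → PMF α'} {R' : α' → β' → Prop} (h : Sim p μ R)
    (hk : ∀ a b, R a b → Sim (k b) (k' a) R') : Sim (p.bind k) (μ.bind k') R' := by
  obtain ⟨κ, rfl, rfl, h3⟩ := h
  have hex : ∀ x : α × β, ∃ ν : PMF (α' × β'), ν.map Prod.fst = k' x.1 ∧ ν.map Prod.snd = k x.2 ∧
      (R x.1 x.2 → ∀ z ∈ ν.support, R' z.1 z.2) := by
    intro x
    -- A kernel is needed at every pair, also off `R`, where the independent coupling serves; such
    -- pairs lie outside the support of `κ`.
    by_cases hx : R x.1 x.2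
    · obtain ⟨ν, h1, h2, h3⟩ := hk _ _ hx
      exact ⟨ν, h1, h2, fun _ => h3⟩
    · obtain ⟨ν, h1, h2, -⟩ := Sim.trivial (k x.2) (k' x.1)
      exact ⟨ν, h1, h2, fun h => absurd h hx⟩
  choose ν h1 h2 h4 using hex
  refine ⟨κ.bind ν, ?_, ?_, ?_⟩
  · rw [PMF.map_bind, PMF.bind_map]
    congr 1
    funext x
    exact h1 x
  · rw [PMF.map_bind, PMF.bind_map]
    congr 1
    funext x
    exact h2 x
  · intro z hz
    rw [PMF.mem_support_bind_iff] at hz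
    obtain ⟨x, hx, hz⟩ := hz
    exact h4 x (h3 x hx) z hz

lemma Sim.map {α β α' β' : Type} {p : PMF β} {μ : PMF α} {R : α → β → Prop} {f : β → β'}
    {f' : α → α'} {R' : α' → β' → Prop} (h : Sim p μ R) (hR : ∀ a b, R a b → R' (f' a) (f b)) :
    Sim (p.map f) (μ.map f') R' :=
  h.bind fun a b hab => Sim.pure (hR a b hab)

lemma Sim.map_left {α β β' : Type} {p : PMF β} {μ : PMF α} {R : α → β → Prop} {f : β → β'}
    {R' : α → β' → Prop} (h : Sim p μ R) (hR : ∀ a b, R a b → R' a (f b)) :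
    Sim (p.map f) μ R' := by
  have := h.map (f := f) (f' := id) (R' := R') hR
  rwa [PMF.map_id] at this

/-- Coupled variables that agree on the support of the coupling have the same law. This gives the
exact distribution of the predictions. -/
lemma Sim.map_eq {α β γ : Type} {p : PMF β} {μ : PMF α} {R : α → β → Prop} (h : Sim p μ R)
    {f : β → γ} {f' : α → γ} (hR : ∀ a b, R a b → f b = f' a) : p.map f = μ.map f' := by
  obtain ⟨κ, rfl, rfl, h3⟩ := h
  rw [PMF.map_comp, PMF.map_comp]
  ext c
  rw [PMF.map_apply, PMF.map_apply]
  refine tsum_congr fun x => ?_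
  by_cases hx : x ∈ κ.support
  · have e : (f ∘ Prod.snd) x = (f' ∘ Prod.fst) x := hR _ _ (h3 x hx)
    rw [e]
  · rw [PMF.mem_support_iff, not_not] at hx
    simp [hx]

lemma Sim.forall_support {α β : Type} {p : PMF β} {μ : PMF α} {R : α → β → Prop} (h : Sim p μ R)
    {b : β} (hb : b ∈ p.support) : ∃ a, R a b := by
  obtain ⟨κ, -, rfl, h3⟩ := h
  rw [PMF.mem_support_map_iff] at hb
  obtain ⟨x, hx, rfl⟩ := hb
  exact ⟨x.1, h3 x hx⟩

variable {T : ℕ} {O : Subroutines T}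

/-- The program `c`, started in `s`, simulates a draw from `μ` with the postcondition `Q` in at most
`n` steps. -/
def Run {α : Type} (O : Subroutines T) (c : Cmd) (s : Mem) (μ : PMF α) (n : ℕ)
    (Q : α → Mem → Prop) : Prop :=
  Sim (exec O c s) μ fun a o => Q a o.1 ∧ o.2 ≤ n

lemma Run.mono {α : Type} {c : Cmd} {s : Mem} {μ : PMF α} {n n' : ℕ} {Q Q' : α → Mem → Prop}
    (h : Run O c s μ n Q) (hQ : ∀ a s, Q a s → Q' a s) (hn : n ≤ n') : Run O c s μ n' Q' :=
  Sim.mono h fun _ _ ho => ⟨hQ _ _ ho.1, ho.2.trans hn⟩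

lemma Run.of_step {α : Type} {c : Cmd} {s s' : Mem} {t n : ℕ} {a : α} {Q : α → Mem → Prop}
    (h : exec O c s = step s' t) (hQ : Q a s') (ht : t ≤ n) : Run O c s (PMF.pure a) n Q := by
  rw [Run, h]
  exact Sim.pure ⟨hQ, ht⟩

lemma Sim.andThen {α α' : Type} {p : PMF (Mem × ℕ)} {f : Mem → PMF (Mem × ℕ)} {μ : PMF α}
    {k : α → PMF α'} {Q : α → Mem → Prop} {Q' : α' → Mem → Prop} {n n' : ℕ}
    (h : Sim p μ fun a o => Q a o.1 ∧ o.2 ≤ n)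
    (hf : ∀ a s, Q a s → Sim (f s) (k a) fun a o => Q' a o.1 ∧ o.2 ≤ n') :
    Sim (Transductive.andThen p f) (μ.bind k) fun a o => Q' a o.1 ∧ o.2 ≤ n + n' :=
  h.bind fun a o ho => (hf a o.1 ho.1).map_left fun _ _ hb => ⟨hb.1, Nat.add_le_add ho.2 hb.2⟩

lemma Run.seq {α α' : Type} {c d : Cmd} {s : Mem} {μ : PMF α} {k : α → PMF α'} {n n' : ℕ}
    {Q : α → Mem → Prop} {Q' : α' → Mem → Prop} (h : Run O c s μ n Q)
    (hd : ∀ a s, Q a s → Run O d s (k a) n' Q') : Run O (.seq c d) s (μ.bind k) (n + n') Q' :=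
  Sim.andThen h hd

/-- A deterministic program after a random one. -/
lemma Run.seq_pure {α : Type} {c d : Cmd} {s : Mem} {μ : PMF α} {n n' : ℕ}
    {Q Q' : α → Mem → Prop} (h : Run O c s μ n Q)
    (hd : ∀ a s, Q a s → Run O d s (PMF.pure a) n' Q') : Run O (.seq c d) s μ (n + n') Q' := by
  have := Run.seq h hd
  rwa [PMF.bind_pure] at this

/-- A random program after a deterministic one. -/
lemma Run.pure_seq {α : Type} {c d : Cmd} {s : Mem} {μ : PMF α} {n n' : ℕ}
    {Q : Mem → Prop} {Q' : α → Mem → Prop} (h : Run O c s (PMF.pure ()) n fun _ => Q)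
    (hd : ∀ s, Q s → Run O d s μ n' Q') : Run O (.seq c d) s μ (n + n') Q' := by
  have := Run.seq (k := fun _ => μ) h fun _ => hd
  rwa [PMF.pure_bind] at this

lemma exec_seq_step {c d : Cmd} {s s' s'' : Mem} {t t' : ℕ} (h : exec O c s = step s' t)
    (h' : exec O d s' = step s'' t') : exec O (.seq c d) s = step s'' (t + t') := by
  rw [exec, h, andThen, step, PMF.pure_bind, h', step, PMF.pure_map]
  rfl

lemma Run.step_seq {α : Type} {c d : Cmd} {s s' : Mem} {t n : ℕ} {μ : PMF α}
    {Q : α → Mem → Prop} (h : exec O c s = step s' t) (hd : Run O d s' μ n Q) :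
    Run O (.seq c d) s μ (t + n) Q := by
  refine Run.pure_seq (Q := fun s => s = s') (Run.of_step h rfl le_rfl) ?_
  rintro s rfl
  exact hd

lemma Run.toss {x y : ℕ} {s : Mem} {r : ℝ} (hr : s.real y = r) {Q : Bool → Mem → Prop}
    (hQ : ∀ c, Q c (s.setReal x (bit c))) : Run O (.toss x y) s (coin r) 1 Q := by
  subst hr
  have h : Sim (exec O (.toss x y) s) ((coin (s.real y)).bind PMF.pure)
      fun a o => Q a o.1 ∧ o.2 ≤ 1 := by
    refine Sim.bind (R := fun a b => a = b) ⟨(coin (s.real y)).map fun c => (c, c), ?_, ?_, ?_⟩ ?_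
    · rw [PMF.map_comp]; exact PMF.map_id _
    · rw [PMF.map_comp]; exact PMF.map_id _
    · intro z hz
      rw [PMF.mem_support_map_iff] at hz
      obtain ⟨c, -, rfl⟩ := hz
      rfl
    · rintro a _ rfl
      exact Sim.pure ⟨hQ a, le_rfl⟩
  rwa [PMF.bind_pure] at h

lemma exec_ifLe_of_le {x y : ℕ} {c d : Cmd} {s s' : Mem} {t : ℕ} (h : s.real x ≤ s.real y)
    (hc : exec O c s = step s' t) : exec O (.ifLe x y c d) s = step s' (1 + t) := by
  rw [exec, if_pos h, andThen, step, PMF.pure_bind, hc, step, PMF.pure_map]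
  rfl

lemma exec_ifLe_of_lt {x y : ℕ} {c d : Cmd} {s s' : Mem} {t : ℕ} (h : s.real y < s.real x)
    (hd : exec O d s = step s' t) : exec O (.ifLe x y c d) s = step s' (1 + t) := by
  rw [exec, if_neg h.not_ge, andThen, step, PMF.pure_bind, hd, step, PMF.pure_map]
  rfl

/-- The invariant rule for loops. -/
lemma Run.loop {α : ℕ → Type} {μ : ∀ n, PMF (α n)} {k : ∀ n, α n → PMF (α (n + 1))}
    (hμ : ∀ n, μ (n + 1) = (μ n).bind (k n)) {a₀ : α 0} (hμ₀ : μ 0 = PMF.pure a₀)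
    {i j : ℕ} {c : Cmd} {s : Mem} {N t : ℕ} (hN : s.nat j = N) {Q : ∀ n, α n → Mem → Prop}
    (h0 : Q 0 a₀ s)
    (hstep : ∀ n < N, ∀ a s, Q n a s → Run O c (s.setNat i n) (k n a) t (Q (n + 1))) :
    Run O (.loop i j c) s (μ N) (N * (t + 1) + 1) (Q N) := by
  have key : ∀ n ≤ N, Sim (iterate (exec O c) i n s) (μ n)
      fun a o => Q n a o.1 ∧ o.2 ≤ n * (t + 1) := by
    intro n hn
    induction n with
    | zero => rw [hμ₀]; exact Sim.pure ⟨h0, by simp⟩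
    | succ n ih =>
      rw [hμ]
      refine (Sim.andThen (n' := 1 + t) (ih (by omega)) fun a s hs => ?_).mono fun a o ho =>
        ⟨ho.1, ho.2.trans (by rw [Nat.succ_mul]; omega)⟩
      have := Sim.andThen (p := step (s.setNat i n) 1) (f := exec O c) (μ := PMF.pure ())
        (k := fun _ => k n a) (Q := fun _ s' => s' = s.setNat i n) (n := 1) (n' := t)
        (Q' := Q (n + 1)) (Sim.pure ⟨rfl, le_rfl⟩) (by
          rintro - s' rfl
          exact hstep n (by omega) a s hs)
      rwa [PMF.pure_bind] at this
  have := Sim.andThen (p := step s 1) (f := iterate (exec O c) i (s.nat j)) (μ := PMF.pure ())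
    (k := fun _ => μ N) (Q := fun _ s' => s' = s) (n := 1) (n' := N * (t + 1)) (Q' := Q N)
    (Sim.pure ⟨rfl, le_rfl⟩) (by
      rintro - s' rfl
      rw [hN]
      exact key N le_rfl)
  rw [PMF.pure_bind] at this
  exact Sim.mono this fun a o ho => ⟨ho.1, ho.2.trans (by omega)⟩

end Simulation

/-! ### Uniform vectors drawn coordinate by coordinate -/

section Uniform

/-- The recursion required by `Run.loop`, used for the `T` signs of one playout and for the `m`
playouts of one round. -/
lemma uniform_snoc {α : Type} [Fintype α] [Nonempty α] (n : ℕ) :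
    PMF.uniformOfFintype (Fin (n + 1) → α) =
      (PMF.uniformOfFintype (Fin n → α)).bind fun Y =>
        (PMF.uniformOfFintype α).map fun a => (Fin.snoc Y a : Fin (n + 1) → α) := by
  ext Z
  rw [PMF.bind_apply, tsum_eq_single (Fin.init Z), PMF.map_apply,
    tsum_eq_single (Z (Fin.last n))]
  · rw [if_pos (Fin.snoc_init_self Z).symm]
    simp only [PMF.uniformOfFintype_apply, Fintype.card_fun, Fintype.card_fin]
    rw [← ENNReal.mul_inv (Or.inr (by simp)) (Or.inl (by simp)), pow_succ, Nat.cast_mul]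
  · intro a ha
    rw [if_neg]
    intro h
    exact ha (by rw [h, Fin.snoc_last])
  · intro Y hY
    have : (PMF.map (fun a => (Fin.snoc Y a : Fin (n + 1) → α)) (PMF.uniformOfFintype α)) Z = 0 := by
      rw [PMF.map_apply, ENNReal.tsum_eq_zero]
      intro a
      rw [if_neg]
      intro h
      exact hY (by rw [h, Fin.init_snoc])
    rw [this, mul_zero]

lemma uniform_zero {α : Type} [Fintype α] [Nonempty α] (a : Fin 0 → α) :
    PMF.uniformOfFintype (Fin 0 → α) = PMF.pure a := by
  ext Y
  rw [Subsingleton.elim Y a]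
  simp

lemma coin_half : coin (1 / 2) = PMF.uniformOfFintype Bool := by
  ext c
  rw [coin, PMF.ofFintype_apply, PMF.uniformOfFintype_apply, Fintype.card_bool]
  have h : ENNReal.ofReal (1 / 2) = 2⁻¹ := by
    rw [one_div, ENNReal.ofReal_inv_of_pos two_pos, ENNReal.ofReal_ofNat]
  cases c <;> norm_num [h]

end Uniform

/-! ### The programs and their memory invariants -/

section Programs

open Finset

/-- Replace the entries of array `1` at the positions without flag in array `0` by random labels. -/
def fillCmd : Cmd :=
  .loop 3 0 <|
    .seq (.toss 5 4) <| .seq (.arith 5 .mul 5 8) <| .seq (.arith 5 .add 5 9) <|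
    .seq (.load 6 0 3) <| .ifLe 6 4 (.store 1 3 5) .skip

/-- Leave in register `10` the difference of the empirical risks with the two labels at the current
position. -/
def compareCmd : Cmd :=
  .seq (.store 1 2 9) <| .seq (.erm 10 1) <| .seq (.store 1 2 11) <| .seq (.erm 12 1) <|
    .arith 10 .sub 10 12

/-- The constants for the encoding of the labels by `q` and `1`. -/
def initCmd (p q : ℚ) : Cmd :=
  .seq (.const 4 (1 / 2)) <| .seq (.const 8 p) <| .seq (.const 9 q) <| .const 11 1

/-- Round the playout in register `10` to a label. -/
def mfRoundCmd : Cmd :=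
  .seq (.arith 10 .add 10 11) <| .seq (.arith 10 .mul 10 4) <| .toss 2 10

/-- Store the outcome in register `3` as the label of the current position. -/
def mfUpdateCmd : Cmd := .seq (.store 1 2 3) (.store 0 2 11)

/-- `MF*` with fresh or with reused signs. -/
def mfProgram (reuse : Bool) : OnlineProgram where
  setup := if reuse then .seq (initCmd 1 0) fillCmd else initCmd 1 0
  predict :=
    if reuse then .seq compareCmd mfRoundCmd else .seq fillCmd (.seq compareCmd mfRoundCmd)
  update := mfUpdateCmd

/-- The `R²` Forecaster. -/
def r2Program : OnlineProgram where
  setup := initCmd 2 (-1)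
  predict :=
    .seq (.const 13 0) <|
    .seq (.loop 5 1 <| .seq fillCmd <| .seq compareCmd <|
      .seq (.arith 10 .mul 10 4) (.arith 13 .add 13 10)) <|
    .seq (.cast 14 1) <| .seq (.arith 14 .div 0 14) (.arith 2 .mul 14 13)
  update :=
    .seq (.grad 15 2 3) <| .seq (.arith 15 .div 15 1) <| .seq (.arith 15 .sub 11 15) <|
    .seq (.arith 15 .mul 15 4) <| .seq (.toss 15 15) <| .seq (.arith 15 .mul 15 8) <|
    .seq (.arith 15 .add 15 9) <| .seq (.store 1 2 15) (.store 0 2 11)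

variable {T : ℕ}

/-- The memory `M` holds the constants, the position `pos`, the accumulator `acc`, and the labels
seen so far in the encoding `e`. -/
structure Holds (e : Bool → ℝ) (m : ℕ) (b ρ : ℝ) (s : Fin T → Option Bool) (pos : ℕ) (acc : ℝ)
    (M : Mem) : Prop where
  nat0 : M.nat 0 = T
  nat1 : M.nat 1 = m
  nat2 : M.nat 2 = pos
  real0 : M.real 0 = b
  real1 : M.real 1 = ρ
  real4 : M.real 4 = 1 / 2
  real9 : M.real 9 = e false
  real11 : M.real 11 = e true
  real11_eq : M.real 11 = 1
  real13 : M.real 13 = acc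
  enc : ∀ c, bit c * M.real 8 + M.real 9 = e c
  flags : ∀ i : Fin T, M.arr 0 i = if (s i).isSome then 1 else 0
  labels : ∀ (i : Fin T) c, s i = some c → M.arr 1 i = e c

/-- Array `1` holds the labels `w` in the encoding `e`. -/
def HoldsLabels (e : Bool → ℝ) (w : Fin T → Bool) (M : Mem) : Prop :=
  ∀ i : Fin T, M.arr 1 i = e (w i)

@[simp] lemma nat_setNat (M : Mem) (k v j : ℕ) :
    (M.setNat k v).nat j = if j = k then v else M.nat j := Function.update_apply _ _ _ _

@[simp] lemma real_setNat (M : Mem) (k v : ℕ) : (M.setNat k v).real = M.real := rfl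

@[simp] lemma arr_setNat (M : Mem) (k v : ℕ) : (M.setNat k v).arr = M.arr := rfl

@[simp] lemma nat_setReal (M : Mem) (k : ℕ) (v : ℝ) : (M.setReal k v).nat = M.nat := rfl

@[simp] lemma real_setReal (M : Mem) (k : ℕ) (v : ℝ) (j : ℕ) :
    (M.setReal k v).real j = if j = k then v else M.real j := Function.update_apply _ _ _ _

@[simp] lemma arr_setReal (M : Mem) (k : ℕ) (v : ℝ) : (M.setReal k v).arr = M.arr := rfl

@[simp] lemma nat_setArr (M : Mem) (a i : ℕ) (v : ℝ) : (M.setArr a i v).nat = M.nat := rfl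

@[simp] lemma real_setArr (M : Mem) (a i : ℕ) (v : ℝ) : (M.setArr a i v).real = M.real := rfl

@[simp] lemma arr_setArr (M : Mem) (a i : ℕ) (v : ℝ) (a' i' : ℕ) :
    (M.setArr a i v).arr a' i' = if a' = a ∧ i' = i then v else M.arr a' i' := by
  by_cases h : a' = a
  · subst h
    by_cases h' : i' = i
    · subst h'; simp [Mem.setArr]
    · simp [Mem.setArr, h']
  · simp [Mem.setArr, h]

@[simp] lemma bit_false : bit false = 0 := rfl

@[simp] lemma bit_true : bit true = 1 := rfl

variable {O : Subroutines T} {e : Bool → ℝ} {m : ℕ} {b ρ : ℝ} {s : Fin T → Option Bool} {pos : ℕ}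
  {acc : ℝ} {M : Mem}

lemma Holds.setReal (h : Holds e m b ρ s pos acc M) {k : ℕ} (v : ℝ)
    (hk : k ∉ [0, 1, 4, 8, 9, 11, 13]) : Holds e m b ρ s pos acc (M.setReal k v) := by
  simp only [List.mem_cons, List.not_mem_nil, or_false, not_or, ← ne_eq] at hk
  obtain ⟨h0, h1, h4, h8, h9, h11, h13⟩ := hk
  constructor <;> simp only [nat_setReal, arr_setReal, real_setReal, h0.symm, h1.symm, h4.symm,
    h8.symm, h9.symm, h11.symm, h13.symm, if_false]
  exacts [h.nat0, h.nat1, h.nat2, h.real0, h.real1, h.real4, h.real9, h.real11, h.real11_eq,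
    h.real13, h.enc, h.flags, h.labels]

lemma Holds.setAcc (h : Holds e m b ρ s pos acc M) (v : ℝ) :
    Holds e m b ρ s pos v (M.setReal 13 v) := by
  constructor <;> simp only [nat_setReal, arr_setReal, real_setReal, OfNat.zero_ne_ofNat,
    OfNat.one_ne_ofNat, Nat.reduceEqDiff, if_false, if_true]
  exacts [h.nat0, h.nat1, h.nat2, h.real0, h.real1, h.real4, h.real9, h.real11, h.real11_eq,
    h.enc, h.flags, h.labels]

lemma Holds.setNat (h : Holds e m b ρ s pos acc M) {k : ℕ} (v : ℕ) (hk : k ∉ [0, 1, 2]) :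
    Holds e m b ρ s pos acc (M.setNat k v) := by
  simp only [List.mem_cons, List.not_mem_nil, or_false, not_or, ← ne_eq] at hk
  obtain ⟨h0, h1, h2⟩ := hk
  constructor <;> simp only [nat_setNat, arr_setNat, real_setNat, h0.symm, h1.symm, h2.symm,
    if_false]
  exacts [h.nat0, h.nat1, h.nat2, h.real0, h.real1, h.real4, h.real9, h.real11, h.real11_eq,
    h.real13, h.enc, h.flags, h.labels]

lemma Holds.setPos (h : Holds e m b ρ s pos acc M) (v : ℕ) :
    Holds e m b ρ s v acc (M.setNat 2 v) := by
  constructor <;> simp only [nat_setNat, arr_setNat, real_setNat, OfNat.zero_ne_ofNat,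
    OfNat.one_ne_ofNat, if_false, if_true]
  exacts [h.nat0, h.nat1, h.real0, h.real1, h.real4, h.real9, h.real11, h.real11_eq,
    h.real13, h.enc, h.flags, h.labels]

lemma Holds.setArr (h : Holds e m b ρ s pos acc M) {i : Fin T} (hi : s i = none) (v : ℝ) :
    Holds e m b ρ s pos acc (M.setArr 1 i v) := by
  constructor <;> simp only [nat_setArr, real_setArr, arr_setArr, zero_ne_one, false_and, if_false,
    true_and]
  · exact h.nat0
  · exact h.nat1
  · exact h.nat2
  · exact h.real0
  · exact h.real1
  · exact h.real4
  · exact h.real9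
  · exact h.real11
  · exact h.real11_eq
  · exact h.real13
  · exact h.enc
  · exact h.flags
  · intro j c hj
    have hne : (j : ℕ) ≠ i := fun hji => by
      rw [Fin.ext hji, hi] at hj
      cases hj
    rw [if_neg hne]
    exact h.labels j c hj

/-- Storing the label of the current position. -/
lemma Holds.visit (h : Holds e m b ρ s pos acc M) (i : Fin T) (c : Bool) :
    Holds e m b ρ (Function.update s i (some c)) pos acc ((M.setArr 1 i (e c)).setArr 0 i 1) := by
  constructor <;> simp only [nat_setArr, real_setArr, arr_setArr, zero_ne_one, one_ne_zero,
    false_and, if_false, true_and]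
  · exact h.nat0
  · exact h.nat1
  · exact h.nat2
  · exact h.real0
  · exact h.real1
  · exact h.real4
  · exact h.real9
  · exact h.real11
  · exact h.real11_eq
  · exact h.real13
  · exact h.enc
  · intro j
    by_cases hj : j = i
    · subst hj; simp
    · rw [if_neg fun h => hj (Fin.ext h), Function.update_of_ne hj]
      exact h.flags j
  · intro j c' hj
    by_cases hji : j = i
    · subst hji
      rw [Function.update_self, Option.some_inj] at hj
      rw [if_pos rfl, hj]
    · rw [Function.update_of_ne hji] at hj
      rw [if_neg fun h => hji (Fin.ext h)]
      exact h.labels j c' hj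

lemma HoldsLabels.setArr {w : Fin T → Bool} (h : HoldsLabels e w M) (i : Fin T) (c : Bool) :
    HoldsLabels e (Function.update w i c) (M.setArr 1 i (e c)) := by
  intro j
  rw [arr_setArr]
  by_cases hj : j = i
  · subst hj; simp
  · rw [if_neg fun h => hj (Fin.ext h.2), Function.update_of_ne hj]
    exact h j

/-- A coin is tossed at every position and discarded at the visited ones, so the simulated draw is
all of `signs T`. An iteration costs six steps and one of overhead. -/
lemma run_fillCmd (hM : Holds e m b ρ s pos acc M) :
    Run O fillCmd M (signs T) (7 * T + 1) fun Y M' =>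
      Holds e m b ρ s pos acc M' ∧ HoldsLabels e (fill s Y) M' := by
  have h := Run.loop (O := O) (α := fun n => Fin n → Bool)
    (μ := fun n => PMF.uniformOfFintype (Fin n → Bool))
    (k := fun n Y => (coin (1 / 2)).map fun a => (Fin.snoc Y a : Fin (n + 1) → Bool))
    (fun n => by rw [coin_half]; exact uniform_snoc n) (uniform_zero Fin.elim0)
    (i := 3) (j := 0) (t := 6) (s := M) (N := T)
    (c := .seq (.toss 5 4) <| .seq (.arith 5 .mul 5 8) <| .seq (.arith 5 .add 5 9) <|
      .seq (.load 6 0 3) <| .ifLe 6 4 (.store 1 3 5) .skip) hM.nat0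
    (Q := fun n Y M' => Holds e m b ρ s pos acc M' ∧
      ∀ (i : Fin T) (h : (i : ℕ) < n), M'.arr 1 i = e ((s i).getD (Y ⟨i, h⟩)))
    ⟨hM, fun i h => absurd h (Nat.not_lt_zero _)⟩ ?_
  · refine Run.mono h (fun Y M' hM' => ⟨hM'.1, fun i => ?_⟩) (by omega)
    exact hM'.2 i i.2
  intro n hn Y M' hM'
  obtain ⟨hM', hlab⟩ := hM'
  rw [← PMF.bind_pure_comp]
  refine Run.seq (n := 1) (n' := 5)
    (Q := fun c M'' => M'' = (M'.setNat 3 n).setReal 5 (bit c)) (Run.toss ?_ fun c => rfl) ?_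
  · simpa [Mem.setNat] using hM'.real4
  rintro c _ rfl
  refine Run.step_seq (t := 1) (n := 4) rfl (Run.step_seq (t := 1) (n := 3) rfl
    (Run.step_seq (t := 1) (n := 2) rfl ?_))
  set i : Fin T := ⟨n, hn⟩ with hi
  have henc := hM'.enc c
  have hfl : M'.arr 0 n = if (s i).isSome then 1 else 0 := hM'.flags i
  have h4 := hM'.real4
  set M₁ := (M'.setNat 3 n).setReal 5 (bit c) with hM₁
  set M₂ := M₁.setReal 5 (ArithOp.mul.apply (M₁.real 5) (M₁.real 8)) with hM₂
  set M₃ := M₂.setReal 5 (ArithOp.add.apply (M₂.real 5) (M₂.real 9)) with hM₃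
  set M₄ := M₃.setReal 6 (M₃.arr 0 (M₃.nat 3)) with hM₄
  have hH : Holds e m b ρ s pos acc M₄ :=
    ((((hM'.setNat n (by decide)).setReal _ (by decide)).setReal _ (by decide)).setReal _
      (by decide)).setReal _ (by decide)
  have harr : M₄.arr = M'.arr := rfl
  have hnat : M₄.nat 3 = n := by simp [hM₄, hM₃, hM₂, hM₁]
  have h5 : M₄.real 5 = e c := by
    simp [hM₄, hM₃, hM₂, hM₁, ArithOp.apply, henc]
  have h6 : M₄.real 6 = if (s i).isSome then 1 else 0 := by
    simp [hM₄, hM₃, hM₂, hM₁, hfl]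
  -- Flags are `0` or `1`; the coin bias `1/2` in register `4` also serves as the threshold for
  -- them.
  rcases hs : s i with _ | c'
  · rw [hs] at h6
    refine Run.of_step (t := 1 + 1) (exec_ifLe_of_le (t := 1) ?_ rfl) ⟨?_, ?_⟩ le_rfl
    · rw [h6, hH.real4]
      norm_num
    · rw [hnat]
      exact hH.setArr (i := i) hs _
    · intro j hj
      rw [arr_setArr, hnat, h5, harr]
      by_cases hjn : (j : ℕ) = n
      · obtain rfl : j = i := Fin.ext hjn
        rw [if_pos ⟨rfl, hjn⟩, hs]
        have : (Fin.snoc Y c : Fin (n + 1) → Bool) ⟨(i : ℕ), hj⟩ = c := Fin.snoc_last _ _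
        simp only [Option.getD_none, this]
      · have hlt : (j : ℕ) < n := by omega
        rw [if_neg fun h => hjn h.2, hlab j hlt]
        have : (Fin.snoc Y c : Fin (n + 1) → Bool) ⟨(j : ℕ), hj⟩ = Y ⟨j, hlt⟩ :=
          Fin.snoc_castSucc (α := fun _ => Bool) _ _ ⟨j, hlt⟩
        simp only [this]
  · rw [hs] at h6
    refine Run.of_step (t := 1 + 1) (exec_ifLe_of_lt (t := 1) ?_ rfl) ⟨hH, ?_⟩ le_rfl
    · rw [h6, hH.real4]
      norm_num
    · intro j hj
      rw [harr]
      by_cases hjn : (j : ℕ) = n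
      · obtain rfl : j = i := Fin.ext hjn
        rw [hs, Option.getD_some]
        exact hM'.labels i c' hs
      · have hlt : (j : ℕ) < n := by omega
        rw [hlab j hlt]
        have : (Fin.snoc Y c : Fin (n + 1) → Bool) ⟨(j : ℕ), hj⟩ = Y ⟨j, hlt⟩ :=
          Fin.snoc_castSucc (α := fun _ => Bool) _ _ ⟨j, hlt⟩
        simp only [this]

/-- A subroutine computing `R` on encoded labels in time at most `c`. -/
def Computes (O : Subroutines T) (e : Bool → ℝ) (R : (Fin T → Bool) → ℝ) (c : ℕ) : Prop :=
  ∀ w : Fin T → Bool, O.erm (fun i => e (w i)) = R w ∧ O.ermTime (fun i => e (w i)) ≤ c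

/-- The label `true` left behind at the current position is harmless: the next fill or update
overwrites it. -/
lemma run_compareCmd {R : (Fin T → Bool) → ℝ} {c : ℕ} (hO : Computes O e R c) {i : Fin T}
    (hi : s i = none) (hM : Holds e m b ρ s i acc M) {w : Fin T → Bool} (hw : HoldsLabels e w M) :
    Run O compareCmd M (PMF.pure ()) (2 * c + 5) fun _ M' =>
      Holds e m b ρ s i acc M' ∧ HoldsLabels e (Function.update w i true) M' ∧
        M'.real 10 = R (Function.update w i false) - R (Function.update w i true) := by
  have hstore : ∀ {M : Mem} {x : ℕ} {c : Bool}, M.nat 2 = i → M.real x = e c →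
      exec O (.store 1 2 x) M = step (M.setArr 1 i (e c)) 1 := fun h h' => by
    rw [exec, h, h']
  have herm : ∀ {M : Mem} {x : ℕ} {w : Fin T → Bool}, HoldsLabels e w M →
      exec O (.erm x 1) M = step (M.setReal x (R w)) (1 + O.ermTime fun i => e (w i)) := fun h => by
    have : (fun j : Fin T => _) = _ := funext h
    rw [exec, this, (hO _).1]
  have h1 := hM.setArr hi (e false)
  have w1 := hw.setArr i false
  have h2 := h1.setReal (k := 10) (R (Function.update w i false)) (by decide)
  have h3 := h2.setArr hi (e true)
  have w3 : HoldsLabels e (Function.update w i true) _ :=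
    Function.update_idem (α := Fin T) (β := fun _ => Bool) false true w ▸
      HoldsLabels.setArr (M := (M.setArr 1 i (e false)).setReal 10
        (R (Function.update w i false))) w1 i true
  have h4 := h3.setReal (k := 12) (R (Function.update w i true)) (by decide)
  have t1 := (hO (Function.update w i false)).2
  have t3 := (hO (Function.update w i true)).2
  refine Run.mono (Run.step_seq (hstore hM.nat2 hM.real9) (Run.step_seq (herm w1)
    (Run.step_seq (hstore h2.nat2 h2.real11) (Run.step_seq (herm w3)
    (Run.of_step (t := 1) (n := 1) rfl (Q := fun _ M' =>
      Holds e m b ρ s i acc M' ∧ HoldsLabels e (Function.update w i true) M' ∧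
        M'.real 10 = R (Function.update w i false) - R (Function.update w i true))
      ⟨h4.setReal _ (by decide), w3, ?_⟩ le_rfl)))))
    (fun _ _ h => h) (by omega)
  simp [ArithOp.apply]

lemma exec_initCmd (p q : ℚ) (M : Mem) : exec O (initCmd p q) M =
    step ((((M.setReal 4 (1 / 2)).setReal 8 p).setReal 9 q).setReal 11 1) 4 := by
  have h := exec_seq_step (O := O) (t := 1) (t' := 3) (c := .const 4 (1 / 2)) (s := M) rfl
    (exec_seq_step (t := 1) (t' := 2) (c := .const 8 p) rfl
      (exec_seq_step (t := 1) (t' := 1) (c := .const 9 q) (d := .const 11 1) rfl rfl))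
  norm_num at h
  exact h

lemma holds_init (T m : ℕ) (b ρ : ℝ) {p q : ℚ} {e : Bool → ℝ} (he : ∀ c, bit c * (p : ℝ) + q = e c)
    (he1 : e true = 1) :
    Holds (T := T) e m b ρ (fun _ => none) 0 0
      (((((inputMem T m b ρ).setReal 4 (1 / 2)).setReal 8 p).setReal 9 q).setReal 11 1) := by
  have h0 := he false
  simp only [bit_false, zero_mul, zero_add] at h0
  have h1 := he true
  rw [h0, he1, bit_true, one_mul] at h1
  constructor <;> simp [inputMem, he1, h0, h1]

end Programs

/-! ### Simulation of MF* -/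

section Play

open Finset

variable {T : ℕ} {O : Subroutines T} {e : Bool → ℝ} {m : ℕ} {b ρ : ℝ} {s : Fin T → Option Bool}
  {pos : ℕ} {acc : ℝ} {M : Mem}

/-- One round of an online program. -/
lemma Sim.playFrom_cons {α γ ξ : Type} {A : OnlineProgram} {i : Fin T} {y : ℝ}
    {rest : List (Fin T × ℝ)} {μ : PMF α} {ν : α → PMF γ} {k : α → γ → PMF (List ξ)}
    {f : ξ → ℝ} {out : α → ξ} {n n' N : ℕ} {Q : α → Mem → Prop} {Q' : α → γ → Mem → Prop}
    (hpred : Run O A.predict (M.setNat 2 i) μ n Q) (hout : ∀ a M, Q a M → M.real 2 = f (out a))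
    (hupd : ∀ a M, Q a M → Run O A.update (M.setReal 3 y) (ν a) n' (Q' a))
    (hrest : ∀ a z M, Q' a z M →
      Sim (A.playFrom O rest M) (k a z) fun ps q => q.1 = ps.map f ∧ q.2 ≤ N) :
    Sim (A.playFrom O ((i, y) :: rest) M)
      (μ.bind fun a => (ν a).bind fun z => (k a z).map fun ps => out a :: ps)
      fun ps q => q.1 = ps.map f ∧ q.2 ≤ n + n' + N := by
  rw [OnlineProgram.playFrom]
  refine Sim.bind hpred fun a o ho => Sim.bind (hupd a o.1 ho.1) fun z o' ho' =>
    Sim.map (hrest a z o'.1 ho'.1) fun ps q hq => ⟨?_, ?_⟩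
  · rw [hq.1, hout a _ ho.1, List.map_cons]
  · exact Nat.add_le_add (Nat.add_le_add ho.2 ho'.2) hq.2

lemma Sim.play {ξ : Type} {A : OnlineProgram} {rounds : List (Fin T × ℝ)} {μ : PMF (List ξ)}
    {f : ξ → ℝ} {n N : ℕ} {Q : Mem → Prop}
    (hset : Run O A.setup (inputMem T m b ρ) (PMF.pure ()) n fun _ => Q)
    (hplay : ∀ M, Q M → Sim (A.playFrom O rounds M) μ fun ps q => q.1 = ps.map f ∧ q.2 ≤ N) :
    Sim (A.play O m b ρ rounds) μ fun ps q => q.1 = ps.map f ∧ q.2 ≤ n + N := by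
  have h := Sim.bind (k' := fun _ => μ)
    (k := fun a => (A.playFrom O rounds a.1).map fun q => (q.1, a.2 + q.2))
    (R' := fun ps q => q.1 = ps.map f ∧ q.2 ≤ n + N) hset fun _ o ho =>
    (hplay o.1 ho.1).map_left fun _ _ hq => ⟨hq.1, Nat.add_le_add ho.2 hq.2⟩
  rwa [PMF.pure_bind] at h

lemma run_mfRoundCmd (hM : Holds e m b ρ s pos acc M) {p : ℝ} (hp : M.real 10 = p) :
    Run O mfRoundCmd M (coin ((1 + p) / 2)) 3 fun c M' =>
      M'.real 2 = bit c ∧ Holds e m b ρ s pos acc M' ∧ M'.arr = M.arr := by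
  refine Run.step_seq (t := 1) (n := 2) rfl (Run.step_seq (t := 1) (n := 1) rfl
    (Run.toss ?_ fun c => ⟨?_, ?_, ?_⟩))
  · have h4 := hM.real4
    have h11 := hM.real11_eq
    simp only [real_setReal, ArithOp.apply, Nat.reduceEqDiff, if_false, if_true, hp, h11, h4]
    ring
  · simp
  · exact ((hM.setReal _ (by decide)).setReal _ (by decide)).setReal _ (by decide)
  · rfl

lemma run_mfUpdateCmd {i : Fin T} (hM : Holds e m b ρ s i acc M) (y : Bool) {w : Fin T → Bool}
    (hw : HoldsLabels e w M) :
    Run O mfUpdateCmd (M.setReal 3 (e y)) (PMF.pure ()) 2 fun _ M' =>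
      Holds e m b ρ (Function.update s i (some y)) i acc M' ∧
        HoldsLabels e (Function.update w i y) M' := by
  have h3 : Holds e m b ρ s i acc (M.setReal 3 (e y)) := hM.setReal _ (by decide)
  have hstep : exec O mfUpdateCmd (M.setReal 3 (e y)) =
      step (((M.setReal 3 (e y)).setArr 1 i (e y)).setArr 0 i 1) (1 + 1) := by
    refine exec_seq_step (s' := (M.setReal 3 (e y)).setArr 1 i (e y)) ?_ ?_
    · rw [exec, h3.nat2]
      simp
    · rw [exec, nat_setArr, real_setArr, h3.nat2, h3.real11_eq]
  refine Run.of_step hstep ⟨h3.visit i y, fun j => ?_⟩ le_rfl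
  rw [arr_setArr, if_neg (by simp)]
  exact HoldsLabels.setArr (M := M.setReal 3 (e y)) hw i y j

lemma sim_mfFresh {G : Set (Fin T → ℝ)} {c : ℕ} (hO : Computes O bit (fun w => infLoss G w / 2) c)
    (rounds : List (Fin T × Bool)) (hnd : (rounds.map Prod.fst).Nodup)
    (hs : ∀ i ∈ rounds.map Prod.fst, s i = none) (hM : Holds bit m b ρ s pos acc M) :
    Sim ((mfProgram false).playFrom O (rounds.map fun r => (r.1, bit r.2)) M)
      (mfFreshFrom G rounds s)
      fun ps q => q.1 = ps.map bit ∧ q.2 ≤ rounds.length * (7 * T + 2 * c + 11) := by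
  induction rounds generalizing s pos M with
  | nil => exact Sim.pure ⟨rfl, by simp⟩
  | cons r rest ih =>
    obtain ⟨i, y⟩ := r
    simp only [List.map_cons, List.nodup_cons, List.mem_cons, forall_eq_or_imp] at hnd hs
    have hpred : Run O (mfProgram false).predict (M.setNat 2 i)
        ((signs T).bind fun Y => coin ((1 + playout G s i Y) / 2))
        (7 * T + 1 + (2 * c + 5 + 3))
        fun c M' => M'.real 2 = bit c ∧ Holds bit m b ρ s i acc M' ∧ ∃ w : Fin T → Bool, HoldsLabels bit w M' := by
      refine Run.seq (run_fillCmd (hM.setPos i)) fun Y M₁ h₁ => ?_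
      refine Run.pure_seq (run_compareCmd hO hs.1 h₁.1 h₁.2) fun M₂ h₂ => ?_
      refine Run.mono (run_mfRoundCmd h₂.1 (p := playout G s i Y) ?_)
        (fun c M' h' => ⟨h'.1, h'.2.1, Function.update (fill s Y) i true, ?_⟩) le_rfl
      -- The zero-one risk is half the absolute loss of the sign experts, so the difference of two
      -- ERM values is already the playout.
      · rw [h₂.2.2, playout]; ring
      · exact fun j => (congrFun (congrFun h'.2.2 1) j).trans (h₂.2.1 j)
    have h := Sim.playFrom_cons (A := mfProgram false) (f := bit) (out := fun c => c) (y := bit y)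
      (ν := fun _ => PMF.pure ()) (n' := 2)
      (Q' := fun _ _ M => Holds bit m b ρ (Function.update s i (some y)) i acc M) hpred
      (fun _ _ h => h.1)
      (fun _ _ h => Run.mono (run_mfUpdateCmd h.2.1 y h.2.2.choose_spec) (fun _ _ h => h.1) le_rfl)
      (k := fun _ _ => mfFreshFrom G rest (Function.update s i (some y)))
      fun _ _ M hM => ih hnd.2 (fun j hj => by
        rw [Function.update_of_ne (ne_of_mem_of_not_mem hj hnd.1)]
        exact hs.2 j hj) hM
    simp only [PMF.pure_bind, PMF.bind_bind] at h
    refine Sim.mono h fun ps q hq => ⟨hq.1, hq.2.trans ?_⟩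
    rw [List.length_cons, Nat.succ_mul rest.length]
    omega

/-- With reused signs, array `1` carries `fill s Y` through all rounds; only the current position is
rewritten. -/
lemma sim_mfWith {G : Set (Fin T → ℝ)} {c : ℕ} (hO : Computes O bit (fun w => infLoss G w / 2) c)
    (Y : Fin T → Bool) (rounds : List (Fin T × Bool)) (hnd : (rounds.map Prod.fst).Nodup)
    (hs : ∀ i ∈ rounds.map Prod.fst, s i = none) (hM : Holds bit m b ρ s pos acc M)
    (hw : HoldsLabels bit (fill s Y) M) :
    Sim ((mfProgram true).playFrom O (rounds.map fun r => (r.1, bit r.2)) M)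
      (mfWith G Y rounds s)
      fun ps q => q.1 = ps.map bit ∧ q.2 ≤ rounds.length * (2 * c + 10) := by
  induction rounds generalizing s pos M with
  | nil => exact Sim.pure ⟨rfl, by simp⟩
  | cons r rest ih =>
    obtain ⟨i, y⟩ := r
    simp only [List.map_cons, List.nodup_cons, List.mem_cons, forall_eq_or_imp] at hnd hs
    have hpred : Run O (mfProgram true).predict (M.setNat 2 i)
        (coin ((1 + playout G s i Y) / 2)) (2 * c + 5 + 3)
        fun c M' => M'.real 2 = bit c ∧ Holds bit m b ρ s i acc M' ∧
          HoldsLabels bit (Function.update (fill s Y) i true) M' := by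
      refine Run.pure_seq (run_compareCmd hO hs.1 (hM.setPos i)
        (M := M.setNat 2 i) (w := fill s Y) hw) fun M₂ h₂ => ?_
      refine Run.mono (run_mfRoundCmd h₂.1 (p := playout G s i Y) ?_)
        (fun c M' h' => ⟨h'.1, h'.2.1, ?_⟩) le_rfl
      · rw [h₂.2.2, playout]; ring
      · exact fun j => (congrFun (congrFun h'.2.2 1) j).trans (h₂.2.1 j)
    have h := Sim.playFrom_cons (A := mfProgram true) (f := bit) (out := fun c => c) (y := bit y)
      (ν := fun _ => PMF.pure ()) (n' := 2)
      (Q' := fun _ _ M => Holds bit m b ρ (Function.update s i (some y)) i acc M ∧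
        HoldsLabels bit (fill (Function.update s i (some y)) Y) M) hpred
      (fun _ _ h => h.1)
      (fun _ _ h => Run.mono (run_mfUpdateCmd h.2.1 y h.2.2) (fun _ _ h => ⟨h.1, by
        rw [fill_update_some]
        simpa using h.2⟩) le_rfl)
      (k := fun _ _ => mfWith G Y rest (Function.update s i (some y)))
      fun _ _ M hM => ih hnd.2 (fun j hj => by
        rw [Function.update_of_ne (ne_of_mem_of_not_mem hj hnd.1)]
        exact hs.2 j hj) hM.1 hM.2
    simp only [PMF.pure_bind] at h
    refine Sim.mono h fun ps q hq => ⟨hq.1, hq.2.trans ?_⟩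
    rw [List.length_cons, Nat.succ_mul rest.length]
    omega

lemma map_bit_roundsOf (π : Equiv.Perm (Fin T)) (y : Fin T → Bool) :
    (roundsOf π fun t => bit (y t)) = (roundsOf π y).map fun r => (r.1, bit r.2) := by
  simp only [roundsOf, List.map_ofFn]
  rfl

lemma length_roundsOf {Y : Type} (π : Equiv.Perm (Fin T)) (y : Fin T → Y) :
    (roundsOf π y).length = T := by simp [roundsOf]

lemma Subroutines.ZeroOneERM.computes {X : Type u} {F : Set (X → Bool)} {v : Fin T → X} {c : ℕ}
    (hO : O.ZeroOneERM F v c) : Computes O bit (fun w => infLoss (signExperts F v) w / 2) c := by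
  intro w
  refine ⟨?_, (hO w).2⟩
  simp only [(hO w).1, infLoss_signExperts]
  ring

lemma run_initCmd {p q : ℚ} (he : ∀ c, bit c * (p : ℝ) + q = e c) (he1 : e true = 1) :
    Run O (initCmd p q) (inputMem T m b ρ) (PMF.pure ()) 4 fun _ M =>
      Holds (T := T) e m b ρ (fun _ => none) 0 0 M :=
  Run.of_step (exec_initCmd p q _) (holds_init T m b ρ he he1) le_rfl

lemma sim_mfProgram {X : Type u} {F : Set (X → Bool)} {v : Fin T → X} {c : ℕ}
    (hO : O.ZeroOneERM F v c) (reuse : Bool) (π : Equiv.Perm (Fin T)) (y : Fin T → Bool) :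
    Sim ((mfProgram reuse).play O 0 0 0 (roundsOf π fun t => bit (y t)))
      (mfStar reuse (signExperts F v) (roundsOf π y))
      fun ps q => q.1 = ps.map bit ∧ q.2 ≤ 5 + 7 * T + T * (7 * T + 2 * c + 11) := by
  have hinit : Run O (initCmd 1 0) (inputMem T 0 0 0) (PMF.pure ()) 4 fun _ M =>
      Holds (T := T) bit 0 0 0 (fun _ => none) 0 0 M := run_initCmd (by simp) rfl
  rw [map_bit_roundsOf]
  cases reuse
  · refine Sim.mono (Sim.play (A := mfProgram false) (f := bit) hinit fun M hM =>
      sim_mfFresh hO.computes _ (nodup_roundsOf π y) (fun _ _ => rfl) hM)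
      fun ps q hq => ⟨hq.1, hq.2.trans ?_⟩
    rw [length_roundsOf]
    omega
  · have hset : Run O (mfProgram true).setup (inputMem T 0 0 0) (signs T) (4 + (7 * T + 1)) fun Y M =>
        Holds (T := T) bit 0 0 0 (fun _ => none) 0 0 M ∧
          HoldsLabels bit (fill (fun _ => none) Y) M :=
      Run.pure_seq hinit fun M hM => run_fillCmd hM
    have h := Sim.bind (k' := fun Y => mfWith (signExperts F v) Y (roundsOf π y) fun _ => none)
      (k := fun a => ((mfProgram true).playFrom O ((roundsOf π y).map fun r => (r.1, bit r.2)) a.1).map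
        fun q => (q.1, a.2 + q.2))
      (R' := fun ps q => q.1 = ps.map bit ∧ q.2 ≤ 4 + (7 * T + 1) + T * (2 * c + 10))
      hset fun Y o ho => (sim_mfWith hO.computes Y _ (nodup_roundsOf π y) (fun _ _ => rfl) ho.1.1
        ho.1.2).map_left fun _ _ hq => ⟨hq.1, by
          have := Nat.add_le_add ho.2 hq.2
          rwa [length_roundsOf] at this⟩
    refine Sim.mono h fun ps q hq => ⟨hq.1, hq.2.trans ?_⟩
    have : T * (2 * c + 10) ≤ T * (7 * T + 2 * c + 11) := Nat.mul_le_mul_left _ (by omega)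
    omega

end Play

/-! ### Simulation of the `R²` Forecaster -/

section R2Play

open Finset

variable {T : ℕ} {O : Subroutines T} {m : ℕ} {b ρ : ℝ} {s : Fin T → Option Bool}
  {pos : ℕ} {acc : ℝ} {M : Mem}

lemma run_r2_predict {G : Set (Fin T → ℝ)} {c : ℕ} (hO : Computes O sgn (infLoss G) c) {i : Fin T}
    (hi : s i = none) (hM : Holds sgn m b ρ s i acc M) :
    Run O r2Program.predict M (PMF.uniformOfFintype (Fin m → Fin T → Bool))
      (m * (7 * T + 2 * c + 9) + 5) fun Y M' =>
        M'.real 2 = b / m * ∑ j, playout G s i (Y j) ∧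
          Holds sgn m b ρ s i (∑ j, playout G s i (Y j)) M' := by
  have h13 : exec O (.const 13 0) M = step (M.setReal 13 0) 1 := by
    rw [exec, Rat.cast_zero]
  have hloop := Run.loop (O := O) (α := fun n => Fin n → Fin T → Bool)
    (μ := fun n => PMF.uniformOfFintype (Fin n → Fin T → Bool))
    (k := fun n Y => (signs T).map fun a => (Fin.snoc Y a : Fin (n + 1) → Fin T → Bool))
    (fun n => uniform_snoc n) (uniform_zero Fin.elim0)
    (i := 5) (j := 1) (t := 7 * T + 2 * c + 8) (s := M.setReal 13 0) (N := m)
    (c := .seq fillCmd <| .seq compareCmd <|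
      .seq (.arith 10 .mul 10 4) (.arith 13 .add 13 10)) hM.nat1
    (Q := fun n Y M' => Holds sgn m b ρ s i (∑ j, playout G s i (Y j)) M')
    (by simpa using hM.setAcc 0) ?_
  · have h := Run.step_seq h13 (Run.seq_pure hloop (n' := 3)
      (d := .seq (.cast 14 1) <| .seq (.arith 14 .div 0 14) (.arith 2 .mul 14 13))
      (Q' := fun Y M' => M'.real 2 = b / m * ∑ j, playout G s i (Y j) ∧
          Holds sgn m b ρ s i (∑ j, playout G s i (Y j)) M') ?_)
    · exact Run.mono h (fun _ _ h => h)
        (by rw [show 7 * T + 2 * c + 9 = 7 * T + 2 * c + 8 + 1 from rfl]; omega)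
    intro Y M' hM'
    refine Run.step_seq (t := 1) (n := 2) rfl (Run.step_seq (t := 1) (n := 1) rfl
      (Run.of_step (t := 1) rfl ⟨?_, ?_⟩ le_rfl))
    · simp [ArithOp.apply, hM'.nat1, hM'.real0, hM'.real13]
    · exact ((hM'.setReal _ (by decide)).setReal _ (by decide)).setReal _ (by decide)
  intro n hn Y M' hM'
  rw [← PMF.bind_pure_comp]
  have hM'' := hM'.setNat (k := 5) n (by decide)
  refine Run.mono (Run.seq (run_fillCmd hM'') fun Z M₁ h₁ =>
    Run.pure_seq (n' := 2) (run_compareCmd hO hi h₁.1 h₁.2) fun M₂ h₂ => ?_)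
    (fun _ _ h => h) (by omega)
  refine Run.step_seq (t := 1) (n := 1) rfl (Run.of_step (t := 1) rfl ?_ le_rfl)
  -- Here ERM returns the full absolute loss, so the difference is halved before it is added to the
  -- accumulator.
  have hacc : (M₂.setReal 10 (ArithOp.mul.apply (M₂.real 10) (M₂.real 4))).real 13 +
      (M₂.setReal 10 (ArithOp.mul.apply (M₂.real 10) (M₂.real 4))).real 10 =
      ∑ j, playout G s i ((Fin.snoc Y Z : Fin (n + 1) → Fin T → Bool) j) := by
    rw [Fin.sum_univ_castSucc]
    simp only [Fin.snoc_castSucc, Fin.snoc_last, real_setReal, Nat.reduceEqDiff, if_false, if_true,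
      h₂.1.real13, h₂.1.real4, h₂.2.2, ArithOp.apply, playout]
    ring
  have := (h₂.1.setReal (k := 10) (ArithOp.mul.apply (M₂.real 10) (M₂.real 4)) (by decide)).setAcc
    (∑ j, playout G s i ((Fin.snoc Y Z : Fin (n + 1) → Fin T → Bool) j))
  rw [← hacc] at this
  change Holds _ _ _ _ _ _ (∑ j, playout G s i ((Fin.snoc Y Z : Fin (n + 1) → Fin T → Bool) j)) _
  rw [← hacc]
  exact this

lemma run_r2_update {c' : ℕ} {i : Fin T} (hM : Holds sgn m b ρ s i acc M) {p y : ℝ}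
    (hp : M.real 2 = p) (hc' : O.gradTime p y ≤ c') :
    Run O r2Program.update (M.setReal 3 y) (coin ((1 - O.grad p y / ρ) / 2)) (c' + 9) fun z M' =>
      Holds sgn m b ρ (Function.update s i (some z)) i acc M' := by
  have h3 : Holds sgn m b ρ s i acc (M.setReal 3 y) := hM.setReal _ (by decide)
  have hgrad : exec O (.grad 15 2 3) (M.setReal 3 y) =
      step ((M.setReal 3 y).setReal 15 (O.grad p y)) (1 + O.gradTime p y) := by
    rw [exec]
    simp [hp]
  have h4 := h3.setReal (k := 15) (O.grad p y) (by decide)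
  set M₀ := (M.setReal 3 y).setReal 15 (O.grad p y) with hM₀
  have hg : M₀.real 15 = O.grad p y := by simp [hM₀]
  refine Run.mono (Run.step_seq hgrad (Run.step_seq (t := 1) (n := 7) rfl
    (Run.step_seq (t := 1) (n := 6) rfl (Run.step_seq (t := 1) (n := 5) rfl
    (Run.seq_pure (n := 1) (n' := 4) (Q := fun z M' => ∃ M₁, Holds sgn m b ρ s i acc M₁ ∧
      M' = M₁.setReal 15 (bit z)) (Run.toss ?_ fun z => ⟨_, ?_, rfl⟩) ?_)))))
    (fun _ _ h => h) (by omega)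
  · have h1 := h4.real1
    have h11 := h4.real11_eq
    have hh := h4.real4
    simp only [real_setReal, ArithOp.apply, Nat.reduceEqDiff, if_false, if_true,
      hg, h1, h11, hh]
    ring
  · exact ((h4.setReal _ (by decide)).setReal _ (by decide)).setReal _ (by decide)
  · rintro z _ ⟨M₁, hM₁, rfl⟩
    have henc := hM₁.enc z
    have h5 : Holds sgn m b ρ s i acc
        (((M₁.setReal 15 (bit z)).setReal 15 (bit z * M₁.real 8)).setReal 15 (sgn z)) :=
      ((hM₁.setReal _ (by decide)).setReal _ (by decide)).setReal _ (by decide)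
    refine Run.step_seq (t := 1) (n := 3)
      (s' := (M₁.setReal 15 (bit z)).setReal 15 (bit z * M₁.real 8)) ?_
      (Run.step_seq (t := 1) (n := 2)
        (s' := ((M₁.setReal 15 (bit z)).setReal 15 (bit z * M₁.real 8)).setReal 15 (sgn z)) ?_
      (Run.step_seq (t := 1) (n := 1)
        (s' := (((M₁.setReal 15 (bit z)).setReal 15 (bit z * M₁.real 8)).setReal 15 (sgn z)).setArr
          1 i (sgn z)) ?_
      (Run.of_step (t := 1) (s' := ((((M₁.setReal 15 (bit z)).setReal 15 (bit z * M₁.real 8)).setReal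
        15 (sgn z)).setArr 1 i (sgn z)).setArr 0 i 1) ?_ (h5.visit i z) le_rfl)))
    · rw [exec]
      simp [ArithOp.apply]
    · rw [exec]
      simp [ArithOp.apply, henc]
    · rw [exec, h5.nat2]
      simp
    · rw [exec, nat_setArr, h5.nat2, real_setArr, h5.real11_eq]

lemma sim_r2From {G : Set (Fin T → ℝ)} (hne : G.Nonempty) (hG : ∀ h ∈ G, ∀ i, |h i| ≤ 1)
    (hb : 0 < b) (hm : 0 < m) {c c' : ℕ} (hO : Computes O sgn (infLoss G) c)
    (hgrad : ∀ p ∈ Set.Icc (-b) b, ∀ y ∈ Set.Icc (-b) b, O.gradTime p y ≤ c')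
    (rounds : List (Fin T × ℝ)) (hy : ∀ r ∈ rounds, r.2 ∈ Set.Icc (-b) b)
    (hnd : (rounds.map Prod.fst).Nodup)
    (hs : ∀ i ∈ rounds.map Prod.fst, s i = none) (hM : Holds sgn m b ρ s pos acc M) :
    Sim (r2Program.playFrom O rounds M) (r2From m b ρ O.grad G rounds s)
      fun ps q => q.1 = ps.map id ∧ q.2 ≤ rounds.length * (m * (7 * T + 2 * c + 9) + c' + 14) := by
  induction rounds generalizing s pos acc M with
  | nil => exact Sim.pure ⟨rfl, by simp⟩
  | cons r rest ih =>
    obtain ⟨i, y⟩ := r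
    simp only [List.map_cons, List.nodup_cons, List.mem_cons, forall_eq_or_imp] at hnd hs hy
    have hmpos : (0 : ℝ) < m := by exact_mod_cast hm
    -- The time of a subgradient call is bounded only on `[-b, b]²`, so the prediction must be shown
    -- to lie in `[-b, b]`.
    have hp : ∀ Y : Fin m → Fin T → Bool,
        b / m * ∑ j, playout G s i (Y j) ∈ Set.Icc (-b) b := by
      intro Y
      have h1 : |∑ j, playout G s i (Y j)| ≤ m := by
        refine (abs_sum_le_sum_abs _ _).trans ?_
        refine (sum_le_sum fun j _ => abs_playout_le hne hG s i (Y j)).trans ?_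
        simp
      rw [Set.mem_Icc, ← abs_le, abs_mul, abs_of_pos (by positivity : 0 < b / m)]
      calc b / m * |∑ j, playout G s i (Y j)| ≤ b / m * m := by gcongr
        _ = b := by field_simp
    have hpred : Run O r2Program.predict (M.setNat 2 i)
        (PMF.uniformOfFintype (Fin m → Fin T → Bool)) (m * (7 * T + 2 * c + 9) + 5) fun Y M' =>
          M'.real 2 = b / m * ∑ j, playout G s i (Y j) ∧
            Holds sgn m b ρ s i (∑ j, playout G s i (Y j)) M' :=
      run_r2_predict hO hs.1 (hM.setPos i)
    have hupd : ∀ (Y : Fin m → Fin T → Bool) (M' : Mem),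
        M'.real 2 = b / m * ∑ j, playout G s i (Y j) ∧
          Holds sgn m b ρ s i (∑ j, playout G s i (Y j)) M' →
        Run O r2Program.update (M'.setReal 3 y)
          (coin ((1 - O.grad (b / m * ∑ j, playout G s i (Y j)) y / ρ) / 2)) (c' + 9) fun z M' =>
            Holds sgn m b ρ (Function.update s i (some z)) i (∑ j, playout G s i (Y j)) M' :=
      fun Y M' h => run_r2_update h.2 h.1 (hgrad _ (hp Y) _ hy.1)
    have hrest : ∀ (Y : Fin m → Fin T → Bool) (z : Bool) (M' : Mem),
        Holds sgn m b ρ (Function.update s i (some z)) i (∑ j, playout G s i (Y j)) M' →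
        Sim (r2Program.playFrom O rest M')
          (r2From m b ρ O.grad G rest (Function.update s i (some z)))
          fun ps q => q.1 = ps.map id ∧
            q.2 ≤ rest.length * (m * (7 * T + 2 * c + 9) + c' + 14) := by
      intro _ z M hM
      refine ih hy.2 hnd.2 (fun j hj => ?_) hM
      rw [Function.update_of_ne (ne_of_mem_of_not_mem hj hnd.1)]
      exact hs.2 j hj
    have hout : ∀ (Y : Fin m → Fin T → Bool) (M' : Mem),
        M'.real 2 = b / m * ∑ j, playout G s i (Y j) ∧
          Holds sgn m b ρ s i (∑ j, playout G s i (Y j)) M' →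
        M'.real 2 = id (b / m * ∑ j, playout G s i (Y j)) := fun _ _ h => h.1
    have h := Sim.playFrom_cons (α := Fin m → Fin T → Bool) (γ := Bool) (ξ := ℝ)
      (A := r2Program) (i := i) (y := y) (rest := rest)
      (μ := PMF.uniformOfFintype (Fin m → Fin T → Bool))
      (ν := fun Y => coin ((1 - O.grad (b / m * ∑ j, playout G s i (Y j)) y / ρ) / 2))
      (k := fun _ z => r2From m b ρ O.grad G rest (Function.update s i (some z))) (f := id)
      (out := fun Y => b / m * ∑ j, playout G s i (Y j))
      (n' := c' + 9)
      (Q := fun Y M' => M'.real 2 = b / m * ∑ j, playout G s i (Y j) ∧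
          Holds sgn m b ρ s i (∑ j, playout G s i (Y j)) M')
      (Q' := fun Y z M' =>
        Holds sgn m b ρ (Function.update s i (some z)) i (∑ j, playout G s i (Y j)) M')
      hpred hout hupd hrest
    rw [r2From]
    refine Sim.mono h fun ps q hq => ⟨hq.1, hq.2.trans ?_⟩
    rw [List.length_cons, Nat.succ_mul rest.length]
    omega

lemma Subroutines.AbsERM.computes {X : Type u} {F : Set (X → ℝ)} {v : Fin T → X} {c : ℕ}
    (hO : O.AbsERM F b v c) : Computes O sgn (infLoss (experts (1 / b) F v)) c := by
  intro w
  refine ⟨?_, (hO w).2⟩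
  rw [(hO w).1, infLoss, experts,
    iInf_image F _ (fun h : Fin T → ℝ => ∑ i, |h i - sgn (w i)|)]
  simp only [one_div_mul_eq_div]

lemma sim_r2Program {X : Type u} {F : Set (X → ℝ)} (hne : F.Nonempty) (hb : 0 < b)
    (hF : ∀ f ∈ F, ∀ x, f x ∈ Set.Icc (-b) b) {v : Fin T → X} (hm : 0 < m) {c c' : ℕ}
    (hO : O.AbsERM F b v c)
    (hgrad : ∀ p ∈ Set.Icc (-b) b, ∀ y ∈ Set.Icc (-b) b, O.gradTime p y ≤ c')
    (π : Equiv.Perm (Fin T)) {y : Fin T → ℝ} (hy : ∀ t, y t ∈ Set.Icc (-b) b) :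
    Sim (r2Program.play O m b ρ (roundsOf π y)) (r2 m b ρ O.grad (experts (1 / b) F v) (roundsOf π y))
      fun ps q => q.1 = ps.map id ∧ q.2 ≤ 4 + T * (m * (7 * T + 2 * c + 9) + c' + 14) := by
  have hinit : Run O (initCmd 2 (-1)) (inputMem T m b ρ) (PMF.pure ()) 4 fun _ M =>
      Holds (T := T) sgn m b ρ (fun _ => none) 0 0 M :=
    run_initCmd (by intro c; cases c <;> norm_num [sgn]) rfl
  have h := Sim.play (A := r2Program) (f := id) hinit fun M hM =>
    sim_r2From (hne.image _) (abs_experts_le hb hF v) hb hm hO.computes hgrad (roundsOf π y)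
      (fun r hr => by
        obtain ⟨j, rfl⟩ := List.mem_ofFn.1 hr
        exact hy j) (nodup_roundsOf π y) (fun _ _ => rfl) hM
  rwa [length_roundsOf] at h

end R2Play

end

/-! ### Time bounds and assembly -/

lemma HasVCDim.nonempty {X : Type u} {F : Set (X → Bool)} {d : ℕ} (h : HasVCDim F d) :
    F.Nonempty := by
  obtain ⟨⟨S, -, hS⟩, -⟩ := h
  obtain ⟨f, hf, -⟩ := hS fun _ => true
  exact ⟨f, hf⟩

lemma mf_time_le {T : ℕ} (hT : 1 ≤ T) (c : ℕ) :
    5 + 7 * T + T * (7 * T + 2 * c + 11) ≤ 30 * (T * (c + T)) := by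
  have h : T * 1 ≤ T * T := Nat.mul_le_mul_left T hT
  have h' : 0 ≤ T * c := Nat.zero_le _
  nlinarith

lemma r2_time_le {T m κ : ℕ} (hT : 1 ≤ T) (hm : m ≤ κ * T) (c c' : ℕ) :
    4 + T * (m * (7 * T + 2 * c + 9) + c' + 14) ≤ (16 * κ + 18) * (T ^ 2 * (c + T) + T * c') := by
  have h1 : m * (7 * T + 2 * c + 9) ≤ κ * T * (16 * (c + T)) :=
    Nat.mul_le_mul hm (by omega)
  have h2 : T * (m * (7 * T + 2 * c + 9)) ≤ 16 * κ * (T ^ 2 * (c + T)) :=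
    (Nat.mul_le_mul_left T h1).trans (le_of_eq (by ring))
  have h3 : T ≤ T ^ 2 * (c + T) := by
    calc T = T * 1 * 1 := by ring
      _ ≤ T * T * (c + T) := Nat.mul_le_mul (Nat.mul_le_mul_left T hT) (by omega)
      _ = T ^ 2 * (c + T) := by ring
  have h4 : 0 ≤ κ * (T * c') := Nat.zero_le _
  have h5 : 4 + T * (m * (7 * T + 2 * c + 9) + c' + 14) =
      4 + T * (m * (7 * T + 2 * c + 9)) + T * c' + 14 * T := by ring
  have h6 : (16 * κ + 18) * (T ^ 2 * (c + T) + T * c') = 16 * κ * (T ^ 2 * (c + T)) +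
      18 * (T ^ 2 * (c + T)) + 16 * (κ * (T * c')) + 18 * (T * c') := by ring
  rw [h5, h6]
  omega

end Transductive

open Transductive in
theorem theorem4 :
    -- the expected zero-one regret of `MF*` on a class of VC dimension `d`
    (∃ C : ℝ, ∀ (X : Type u) (F : Set (X → Bool)) (d : ℕ), HasVCDim F d →
      ∀ (T : ℕ), 1 ≤ T →
      ∀ (v : Fin T → X) (π : Equiv.Perm (Fin T)) (y : Fin T → Bool) (reuse : Bool),
        ∃ r : ℝ,
          HasSum (fun ps : List Bool =>
            (mfStar reuse (signExperts F v) (roundsOf π y) ps).toReal *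
              regret zeroOne F (fun t => v (π t)) y ps) r ∧
          r ≤ C * Real.sqrt (d * T)) ∧
    -- `MF*` is efficient: total time `O(T (c + T))`, where `c` is the time of one ERM
    (∀ reuse : Bool, ∃ (A : OnlineProgram) (K : ℕ),
      ∀ (X : Type u) (F : Set (X → Bool)), F.Nonempty →
      ∀ (T : ℕ), 1 ≤ T →
      ∀ (v : Fin T → X) (O : Subroutines T) (c : ℕ), O.ZeroOneERM F v c →
      ∀ (π : Equiv.Perm (Fin T)) (y : Fin T → Bool),
        (A.play O 0 0 0 (roundsOf π fun t => bit (y t))).map Prod.fst =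
          (mfStar reuse (signExperts F v) (roundsOf π y)).map (List.map bit) ∧
        ∀ o ∈ (A.play O 0 0 0 (roundsOf π fun t => bit (y t))).support,
          o.2 ≤ K * (T * (c + T))) ∧
    -- the regret of the `R²` Forecaster with `⌈η T⌉` playouts per round, with high probability
    (∀ η : ℝ, 0 < η → ∃ C : ℝ,
      ∀ (b ρ : ℝ), 0 < b → 0 < ρ →
      ∀ (l g : ℝ → ℝ → ℝ),
        (∀ y ∈ Set.Icc (-b) b, ConvexOn ℝ (Set.Icc (-b) b) fun p => l p y) →
        (∀ y ∈ Set.Icc (-b) b, ∀ p ∈ Set.Icc (-b) b, ∀ q ∈ Set.Icc (-b) b,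
          |l p y - l q y| ≤ ρ * |p - q|) →
        IsSubgradient l g b ρ →
      ∀ (X : Type u) (F : Set (X → ℝ)), F.Nonempty →
        (∀ f ∈ F, ∀ x, f x ∈ Set.Icc (-b) b) →
      ∀ (T : ℕ), 1 ≤ T →
      ∀ (v : Fin T → X) (π : Equiv.Perm (Fin T)) (y : Fin T → ℝ),
        (∀ t, y t ∈ Set.Icc (-b) b) →
      ∀ δ : ℝ, 0 < δ → δ < 1 →
        ENNReal.ofReal (1 - δ) ≤
          (r2 ⌈η * T⌉₊ b ρ g (experts (1 / b) F v) (roundsOf π y)).toOuterMeasure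
            {ps | regret l F (fun t => v (π t)) y ps ≤
              ρ * rademacher (experts 1 F v) +
                C * (ρ * b * Real.sqrt (T * Real.log (T / δ)))}) ∧
    -- the `R²` Forecaster is efficient: total time `O(T² (c + T) + T c')`, where `c` is the time
    -- of one ERM and `c'` the time of one evaluation of a subgradient
    (∃ A : OnlineProgram, ∀ η : ℝ, 0 < η → ∃ K : ℕ,
      ∀ (b ρ : ℝ), 0 < b → 0 < ρ →
      ∀ (X : Type u) (F : Set (X → ℝ)), F.Nonempty →
        (∀ f ∈ F, ∀ x, f x ∈ Set.Icc (-b) b) →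
      ∀ (T : ℕ), 1 ≤ T →
      ∀ (v : Fin T → X) (O : Subroutines T) (c c' : ℕ), O.AbsERM F b v c →
        (∀ p ∈ Set.Icc (-b) b, ∀ y ∈ Set.Icc (-b) b, O.gradTime p y ≤ c') →
      ∀ (π : Equiv.Perm (Fin T)) (y : Fin T → ℝ), (∀ t, y t ∈ Set.Icc (-b) b) →
        (A.play O ⌈η * T⌉₊ b ρ (roundsOf π y)).map Prod.fst =
          r2 ⌈η * T⌉₊ b ρ O.grad (experts (1 / b) F v) (roundsOf π y) ∧
        ∀ o ∈ (A.play O ⌈η * T⌉₊ b ρ (roundsOf π y)).support,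
          o.2 ≤ K * (T ^ 2 * (c + T) + T * c')) := by
  refine ⟨⟨53, ?_⟩, fun reuse => ⟨mfProgram reuse, 30, ?_⟩, fun η hη => ⟨2 * (11 + 1 / η), ?_⟩,
    r2Program, fun η hη => ⟨16 * ⌈η⌉₊ + 18, ?_⟩⟩
  · intro X F d hF T hT v π y reuse
    refine ⟨_, hasMean_regret_mfStar hF.nonempty v π y reuse, ?_⟩
    have h := rademacher_signExperts_le hF.nonempty hF.2 hT v
    have := Real.sqrt_nonneg ((d : ℝ) * T)
    linarith
  · intro X F _ T hT v O c hO π y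
    have h := sim_mfProgram hO reuse π y
    refine ⟨h.map_eq fun _ _ hq => hq.1, fun o ho => ?_⟩
    obtain ⟨_, -, hq⟩ := h.forall_support ho
    exact hq.trans (mf_time_le hT c)
  · intro b ρ hb hρ l g _ hl hg X F hne hF T hT v π y hy δ hδ hδ1
    exact r2_regret hη hne hb hρ hF hl hg hT v π hy hδ hδ1
  · intro b ρ hb _ X F hne hF T hT v O c c' hO hgrad π y hy
    have hm : 0 < ⌈η * T⌉₊ := Nat.ceil_pos.2 (mul_pos hη (by exact_mod_cast hT))
    have h := sim_r2Program (ρ := ρ) hne hb hF hm hO hgrad π hy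
    refine ⟨?_, fun o ho => ?_⟩
    · have := h.map_eq (f := Prod.fst) (f' := id) fun ps _ hq => by rw [hq.1, List.map_id, id]
      rwa [PMF.map_id] at this
    · obtain ⟨_, -, hq⟩ := h.forall_support ho
      refine hq.trans (r2_time_le hT ?_ c c')
      -- The number of playouts satisfies `⌈η T⌉ ≤ ⌈η⌉ T`, so `κ = ⌈η⌉` makes the constant depend on
      -- `η` alone.
      refine Nat.ceil_le.2 ?_
      push_cast
      exact mul_le_mul_of_nonneg_right (Nat.le_ceil η) (Nat.cast_nonneg T)
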